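/- For a partition, let its rank be its largest part minus the number of its parts; let $N(m,n)$ be the number of partitions of $n$ of rank $m$, and $N_k(n):=\sum_{m\in\mathbb Z}m^kN(m,n)$. Let $q=e^{2\pi i z}$ and let $\eta(z)=q^{1/24}\prod_{n\ge1}(1-q^n)$ be Dedekind's eta function. For a prime $\ell$, a rational number is $\ell$-integral if its denominator is prime to $\ell$; a modular form is called $\ell$-integral (resp. integral) if all coefficients of its $q$-expansion are $\ell$-integral rational numbers (resp. integers); and two $q$-series are congruent modulo $\ell$ if their difference is $\ell$ times a $q$-series with $\ell$-integral coefficients. Level $1$ means modular for $\mathrm{SL}_2(\mathbb Z)$, and sums of modular forms are finite sums of forms whose weights may differ. **Theorem 1.3.** Let $\ell>3$ be prime, let $1\le\beta_\ell\le\ell-1$ with $24\beta_\ell\equiv1\pmod\ell$, and let $r_\ell:=\frac{24\beta_\ell-1}{\ell}$. 1. There is a function $G_{\ell,2}$ which is a sum of $\ell$-integral modular forms of level $1$, each of weight at most $\frac{\ell(\ell+3)-r_\ell-1}{2}$, such that $$\sum_{n=0}^\infty N_2(\ell n+\beta_\ell)q^{24n+r_\ell}\equiv\eta^{r_\ell}(24z)\,G_{\ell,2}(24z)\pmod\ell.$$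 2. For every integer $k$ with $2\le k\le\frac{\ell-3}{2}$ there are an integer $c_k$ and a function $G_{\ell,2k}$ which is a sum of $\ell$-integral modular forms of level $1$, each of weight at most $k(\ell+1)-1+\frac12(\ell-r_\ell)$, such that $$\sum_{n=0}^\infty N_{2k}(\ell n+\beta_\ell)q^{24n+r_\ell}\equiv c_k\sum_{n=0}^\infty N_2(\ell n+\beta_\ell)q^{24n+r_\ell}+\eta^{r_\ell}(24z)\,G_{\ell,2k}(24z)\pmod\ell.$$ 3. There are an integer $c_{\ell-1}$, a function $G_{\ell,\ell-1}$ which is a sum of integral modular forms of level $1$, each of weight at most $\frac{\ell(\ell+1)-r_\ell-3}{2}$, and integral modular forms $H_{1,\ell}$, $H_{2,\ell}$ of level $1$ and of weights $\frac{\ell(\ell-1)-r_\ell-1}{2}$ and $\frac{\ell(\ell+1)-r_\ell-3}{2}$ respectively, such that $H_{1,\ell}\equiv H_{2,\ell}\pmod\ell$ and $$\sum_{n=0}^\infty N_{\ell-1}(\ell n+\beta_\ell)q^{24n+r_\ell}\equiv c_{\ell-1}\sum_{n=0}^\infty N_2(\ell n+\beta_\ell)q^{24n+r_\ell}+\eta^{r_\ell}(24z)\,G_{\ell,\ell-1}(24z)+\frac1\ell\,\eta^{r_\ell}(24z)\bigl(H_{1,\ell}(24z)-H_{2,\ell}(24z)\bigr)\pmod\ell.$$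 -/

import Mathlib

open scoped UpperHalfPlane MatrixGroups

/-- Dyson's rank of a partition: its largest part minus the number of its parts
(the empty partition has rank `0`). -/
def partitionRank {n : ℕ} (p : n.Partition) : ℤ :=
  (p.parts.sup : ℤ) - (Multiset.card p.parts : ℤ)

/-- `N(m, n)`: the number of partitions of `n` with rank `m`. -/
def rankCount (m : ℤ) (n : ℕ) : ℕ :=
  (Finset.univ.filter fun p : n.Partition => partitionRank p = m).card

/-- The `k`-th rank moment `N_k(n) = ∑_{m ∈ ℤ} m ^ k N(m, n)`; only finitely many terms are
nonzero, see `rankMoment_eq_sum`. -/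
noncomputable def rankMoment (k n : ℕ) : ℤ :=
  ∑ᶠ m : ℤ, m ^ k * (rankCount m n : ℤ)

theorem rankMoment_eq_sum (k n : ℕ) :
    rankMoment k n = ∑ p : n.Partition, partitionRank p ^ k := by
  classical
  unfold rankMoment
  rw [finsum_eq_sum_of_support_subset
    (s := Finset.univ.image (fun p : n.Partition => partitionRank p))]
  · rw [← Finset.sum_fiberwise_of_maps_to
      (g := fun p : n.Partition => partitionRank p)
      (t := Finset.univ.image (fun p : n.Partition => partitionRank p))
      (fun p hp => Finset.mem_image_of_mem _ hp)]
    refine Finset.sum_congr rfl fun m _ => ?_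
    rw [Finset.sum_congr rfl (g := fun _ => m ^ k)
      (fun p hp => by rw [(Finset.mem_filter.mp hp).2])]
    simp [rankCount, mul_comm]
  · intro m hm
    have h : rankCount m n ≠ 0 := by
      intro h0
      simp [h0] at hm
    obtain ⟨p, hp⟩ := Finset.card_ne_zero.mp h
    exact Finset.mem_coe.mpr
      (Finset.mem_image.mpr ⟨p, Finset.mem_univ p, (Finset.mem_filter.mp hp).2⟩)

/-- The `q`-series `∑_{n ≥ 0} a(n) q ^ (24 n + r)`. The coefficient of `q ^ m` is the sum of `a(n)`
over the (at most one) `n` with `24 n + r = m`. -/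
noncomputable def stretchedSeries (r : ℕ) (a : ℕ → ℤ) : PowerSeries ℂ :=
  PowerSeries.mk fun m => ∑ n ∈ Finset.range (m + 1), if 24 * n + r = m then (a n : ℂ) else 0

/-- All coefficients are rational numbers whose denominator is prime to the prime `ℓ`. -/
def IsPrimeIntegral (ℓ : ℕ) (A : PowerSeries ℂ) : Prop :=
  ∀ n, ∃ a : ℚ, ¬ ℓ ∣ a.den ∧ PowerSeries.coeff n A = (a : ℂ)

/-- All coefficients are rational integers. -/
def IsIntegralSeries (A : PowerSeries ℂ) : Prop :=
  ∀ n, ∃ a : ℤ, PowerSeries.coeff n A = (a : ℂ)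

/-- Congruence of `q`-series modulo the prime `ℓ`: the difference is `ℓ` times a `q`-series with
`ℓ`-integral coefficients. -/
def SeriesCongr (ℓ : ℕ) (A B : PowerSeries ℂ) : Prop :=
  ∃ D : PowerSeries ℂ, IsPrimeIntegral ℓ D ∧ A - B = (ℓ : ℂ) • D

/-- The point `24 z` of the upper half plane. -/
noncomputable def scale24 (z : ℍ) : ℍ :=
  ⟨24 * (z : ℂ), by simpa using z.im_pos⟩

/-- The function `z ↦ η(24 z) ^ r * G(24 z)`, where `η` is Dedekind's eta function. -/
noncomputable def etaPowMul (r : ℕ) (G : ℍ → ℂ) : ℍ → ℂ :=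
  fun z => ModularForm.eta (scale24 z : ℂ) ^ r * G (scale24 z)

/-- `G` is a (finite) sum of modular forms of level `1`, each of weight at most `W` and with a
`q`-expansion satisfying `P`. -/
def IsSumOfLevelOneForms (P : PowerSeries ℂ → Prop) (W : ℚ) (G : ℍ → ℂ) : Prop :=
  ∃ (s : ℕ) (w : Fin s → ℤ) (g : ∀ i, ModularForm 𝒮ℒ (w i)),
    (∀ i, (w i : ℚ) ≤ W ∧ P (UpperHalfPlane.qExpansion 1 (g i))) ∧
      ∀ z, G z = ∑ i, g i z

/-!
# Rank moments in arithmetic progressions modulo a prime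

Write `P = ∑ p(n) q ^ n`, `R_k = ∑ N_k(n) q ^ n` and `z = exp u`. The argument is a congruence
version of the fact that the rank moments are quasimodular apart from the contribution of `R_2`.

*The rank-crank differential equation.* Moving a column of a Young diagram to a row
(`card_rank_le_eq_card_le_rank`) gives functional equations between the generating series of the
partitions of rank at most `m` and at most `m - 3`. The operator `6 q d/dq + m ^ 2 + m` turns
their corrections into a quadratic polynomial in `m`, which is killed by the third difference and
so by the cube of the theta function `(1 - z) ∏ (1 - z q ^ n) (1 - z⁻¹ q ^ n)`. Since the theta
function obeys the opposite functional equations, its cube times the rank series has a single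
coefficient (`thetaCube_aeval_rankLeHeat`). A heat operator applied to the rank generating
function is therefore a multiple of `z ∏ (1 - z q ^ n) ^ (-3) (1 - z⁻¹ q ^ n) ^ (-3)`, and its
logarithmic derivative yields a linear differential equation in `u` whose coefficients are divisor
sums (`uDeriv_heatOp_rankGen`).

*The recursion.* Expanding in powers of `u`, the series `rankSigma j`, which are combinations of
`R_0, R_2, …, R_{2 j}` and conversely (`rankMomentSeries_eq_sum`), satisfy `rankSigma_succ`: up to
`rankSigma 1`, each one is obtained from a product of `P` with a polynomial in Eisenstein series
and from the derivative `q d/dq - 1 / 24` of the preceding one.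

*Arithmetic progressions.* Let `L F` be the series with
`η ^ r L F = ∑ F_{ℓ m + β} q ^ (m + r / 24)` (`progressionLift`). As `24 β = ℓ r + 1`, the
operator `q d/dq - 1 / 24` gains a factor `ℓ` under `L` (`progressionLift_qDerivShift`). For a
modular form `F` of level one, `P F` is congruent to a series in `q ^ ℓ` times `η ^ (ℓ - 1) F`
modulo `ℓ`, and to one times `η ^ (ℓ ^ 2 - 1) F` modulo `ℓ ^ 2`, if the fractional powers of `q`
in `η` are disregarded. The Hecke operator at `ℓ` maps products of powers of `η` with forms of
level one to such products (`IsLevelOne.hecke`), so `L (P F)` is a modular form modulo `ℓ`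
(`progressionLift_partitionSeries_mul_mem`), and modulo `ℓ ^ 2` at the cost of a larger weight
(`exists_isLevelOne_congr_sq`). Since `E₂` is congruent to a form of weight `ℓ + 1`, quasimodular
forms cause no trouble.

*The moments.* For `j < (ℓ - 1) / 2` no denominator contains `ℓ`, so that the derivative drops out
of the recursion and `L (rankSigma j)` is a modular form modulo `ℓ` if `2 ≤ j`, while
`rankSigma 1` is a combination of `R_2` and `P`. This settles the moments of order less than
`ℓ - 1`. For order `ℓ - 1` the denominator `ℓ` occurs in the Eisenstein series of weight `ℓ - 1`
and in a multiple of `P`. By von Staudt-Clausen and Fermat these two terms fit together to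
`(H₁ - H₂) / ℓ`, where the forms modulo `ℓ ^ 2` are used. For `R_2` itself the moment of order
`ℓ + 1` is expanded: it is congruent to `R_2` but contains only one half of it. The terms with the
denominator `ℓ` collapse to `L (P M) / ℓ` for one form `M` of weight `ℓ + 1`, because the product
of `P` with `E₂ E_{ℓ - 1}` is a derivative plus a product of `P` with a Serre derivative.
Everything else being integral, `L (P M)` is divisible by `ℓ`, and the congruence modulo `ℓ ^ 2`
shows that the quotient is modular modulo `ℓ`.
-/

/-! ### Dyson's symmetry of the rank -/

lemma multiset_sum_map_pred_add_card (s : Multiset ℕ) (hs : ∀ a ∈ s, 0 < a) :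
    (s.map (· - 1)).sum + s.card = s.sum := by
  induction s using Multiset.induction_on with
  | empty => simp
  | cons a s ih =>
    have h1 := ih fun b hb => hs b (Multiset.mem_cons_of_mem hb)
    have h2 := hs a (Multiset.mem_cons_self a s)
    simp only [Multiset.map_cons, Multiset.sum_cons, Multiset.card_cons]
    omega

/-- The parts of a partition are recovered from the nonempty rows that are left after the removal of
the first column. -/
lemma multiset_restore_column (s : Multiset ℕ) (hs : ∀ a ∈ s, 0 < a) :
    ((s.map (· - 1)).filter (· ≠ 0)).card ≤ s.card ∧
    ((s.map (· - 1)).filter (· ≠ 0)).map (· + 1) +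
      Multiset.replicate (s.card - ((s.map (· - 1)).filter (· ≠ 0)).card) 1 = s := by
  induction s using Multiset.induction_on with
  | empty => simp
  | cons a s ih =>
    obtain ⟨h1, h2⟩ := ih fun b hb => hs b (Multiset.mem_cons_of_mem hb)
    have h3 := hs a (Multiset.mem_cons_self a s)
    rw [Multiset.map_cons]
    by_cases ha : a - 1 = 0
    · have ha1 : a = 1 := by omega
      subst ha1
      rw [Multiset.filter_cons_of_neg _ (by simp)]
      refine ⟨h1.trans (by simp), ?_⟩
      conv_rhs => rw [← h2]
      rw [Multiset.card_cons, Nat.succ_sub h1, Multiset.replicate_succ, Multiset.add_cons]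
    · rw [Multiset.filter_cons_of_pos (p := (· ≠ 0)) _ ha]
      simp only [Multiset.card_cons, Multiset.map_cons]
      refine ⟨by omega, ?_⟩
      conv_rhs => rw [← h2]
      rw [Multiset.cons_add, Nat.add_sub_add_right]
      congr 1
      omega

/-- A row that is at least as long as all others is the largest one, also when it is empty. -/
lemma multiset_erase_sup_of_cons (M : ℕ) (s : Multiset ℕ) (hs : ∀ a ∈ s, a ≤ M) :
    ((M ::ₘ s).filter (· ≠ 0)).sup = M ∧
    ((M ::ₘ s).filter (· ≠ 0)).erase M = s.filter (· ≠ 0) := by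
  have hsup : (s.filter (· ≠ 0)).sup ≤ M :=
    Multiset.sup_le.2 fun b hb => hs b (Multiset.mem_of_mem_filter hb)
  by_cases hM : M = 0
  · subst hM
    rw [Multiset.filter_cons_of_neg _ (by simp)]
    refine ⟨by simpa using hsup, Multiset.erase_of_notMem (by simp)⟩
  · rw [Multiset.filter_cons_of_pos (p := (· ≠ 0)) _ hM]
    refine ⟨?_, by simp⟩
    rw [Multiset.sup_cons]
    exact sup_eq_left.2 hsup

lemma multiset_mem_le_sup {s : Multiset ℕ} {a : ℕ} (h : a ∈ s) : a ≤ s.sup := Multiset.le_sup h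

lemma multiset_sup_mem {s : Multiset ℕ} (h : s ≠ 0) : s.sup ∈ s := by
  induction s using Multiset.induction_on with
  | empty => exact absurd rfl h
  | cons a s ih =>
    rw [Multiset.sup_cons]
    by_cases hs : s = 0
    · subst hs; simp
    · rcases le_total a s.sup with h1 | h1
      · rw [sup_eq_right.2 h1]; exact Multiset.mem_cons_of_mem (ih hs)
      · rw [sup_eq_left.2 h1]; exact Multiset.mem_cons_self _ _

/-- Removing the first column of a Young diagram (of length the number of parts) and inserting a
row that is longer by `m - 1`. -/
def dysonMap (m : ℤ) (s : Multiset ℕ) : Multiset ℕ :=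
  ((m + s.card - 1).toNat ::ₘ s.map (· - 1)).filter (· ≠ 0)

/-- Removing the largest row of a Young diagram and inserting a first column that is shorter
by `m - 1`; the inverse of `dysonMap m`. -/
def dysonInv (m : ℤ) (t : Multiset ℕ) : Multiset ℕ :=
  (t.erase t.sup).map (· + 1) +
    Multiset.replicate (((t.sup : ℤ) - m + 1).toNat - (t.erase t.sup).card) 1

section
variable {m : ℤ} {n n' : ℕ} {s t : Multiset ℕ}

/-- `dysonMap m` sends the partitions of `n` of rank at most `m` to partitions of `n + m - 1` of
rank at least `m - 2`, and `dysonInv m` undoes it. -/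
lemma dysonMap_facts (hs : ∀ a ∈ s, 0 < a) (hsum : s.sum = n) (hn : 1 ≤ n)
    (hnn : (n' : ℤ) = n + m - 1) (hr : (s.sup : ℤ) - s.card ≤ m) :
    (dysonMap m s).sum = n' ∧ m - 2 ≤ ((dysonMap m s).sup : ℤ) - (dysonMap m s).card ∧
      dysonInv m (dysonMap m s) = s := by
  have hs0 : s ≠ 0 := by rintro rfl; simp at hsum; omega
  have hsup : 0 < s.sup := hs _ (multiset_sup_mem hs0)
  have hle : ∀ a ∈ s.map (· - 1), a ≤ (m + s.card - 1).toNat := by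
    intro a ha
    obtain ⟨b, hb, rfl⟩ := Multiset.mem_map.1 ha
    have := multiset_mem_le_sup hb
    omega
  obtain ⟨h1, h2⟩ := multiset_erase_sup_of_cons _ _ hle
  have h3 := multiset_sum_map_pred_add_card s hs
  have hrest := multiset_restore_column s hs
  refine ⟨?_, ?_, ?_⟩
  · have : (dysonMap m s).sum = (m + s.card - 1).toNat + (s.map (· - 1)).sum := by
      unfold dysonMap
      rw [← Multiset.sum_cons]
      conv_rhs => rw [← Multiset.filter_add_not (· ≠ 0) (_ ::ₘ s.map (· - 1)), Multiset.sum_add]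
      rw [left_eq_add]
      exact Multiset.sum_eq_zero fun x hx => by simpa using (Multiset.mem_filter.1 hx).2
    rw [this]
    omega
  · have h4 : (dysonMap m s).card ≤ s.card + 1 := by
      refine (Multiset.card_le_card (Multiset.filter_le _ _)).trans ?_
      simp
    have h5 : (dysonMap m s).sup = (m + s.card - 1).toNat := h1
    rw [h5]
    omega
  · unfold dysonInv
    have h5 : (dysonMap m s).sup = (m + s.card - 1).toNat := h1
    have h6 : (dysonMap m s).erase (m + s.card - 1).toNat = _ := h2
    rw [h5, h6]
    have h7 : (((m + s.card - 1).toNat : ℤ) - m + 1).toNat = s.card := by omega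
    rw [h7]
    exact hrest.2

/-- `dysonInv m` sends the partitions of `n + m - 1` of rank at least `m - 2` to partitions of `n`
of rank at most `m`, and `dysonMap m` undoes it. -/
lemma dysonInv_facts (ht : ∀ a ∈ t, 0 < a) (hsum : t.sum = n') (hn : 1 ≤ n)
    (hnn : (n' : ℤ) = n + m - 1) (hr : m - 2 ≤ (t.sup : ℤ) - t.card) :
    (dysonInv m t).sum = n ∧ (∀ a ∈ dysonInv m t, 0 < a) ∧
      ((dysonInv m t).sup : ℤ) - (dysonInv m t).card ≤ m ∧ dysonMap m (dysonInv m t) = t := by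
  -- the new column is at least as long as the number of remaining rows
  have key : 0 ≤ (t.sup : ℤ) - m + 1 ∧
      ((t.erase t.sup).card : ℤ) ≤ (t.sup : ℤ) - m + 1 ∧
      t.sup + (t.erase t.sup).sum = n' := by
    by_cases ht0 : t = 0
    · subst ht0
      simp at hsum ⊢
      omega
    · have hmem := multiset_sup_mem ht0
      have h1 := Multiset.card_erase_add_one hmem
      have h2 : t.sup + (t.erase t.sup).sum = t.sum := by
        rw [← Multiset.sum_cons, Multiset.cons_erase hmem]
      have h3 : 0 < t.card := Multiset.card_pos.2 ht0
      refine ⟨?_, ?_, ?_⟩ <;> omega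
  obtain ⟨h1, h2, h3⟩ := key
  have hcard : (dysonInv m t).card = ((t.sup : ℤ) - m + 1).toNat := by
    simp only [dysonInv, Multiset.card_add, Multiset.card_map, Multiset.card_replicate]
    omega
  refine ⟨?_, ?_, ?_, ?_⟩
  · simp only [dysonInv, Multiset.sum_add, Multiset.sum_map_add, Multiset.map_id',
      Multiset.map_const', Multiset.sum_replicate, smul_eq_mul, mul_one]
    omega
  · intro a ha
    rcases Multiset.mem_add.1 ha with ha | ha
    · obtain ⟨b, -, rfl⟩ := Multiset.mem_map.1 ha
      omega
    · rw [Multiset.eq_of_mem_replicate ha]; omega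
  · have : (dysonInv m t).sup ≤ t.sup + 1 := by
      refine Multiset.sup_le.2 fun a ha => ?_
      rcases Multiset.mem_add.1 ha with ha | ha
      · obtain ⟨b, hb, rfl⟩ := Multiset.mem_map.1 ha
        have := multiset_mem_le_sup (Multiset.mem_of_mem_erase hb)
        omega
      · rw [Multiset.eq_of_mem_replicate ha]; omega
    rw [hcard]
    omega
  · unfold dysonMap
    rw [hcard]
    have h4 : (m + (((t.sup : ℤ) - m + 1).toNat : ℤ) - 1).toNat = t.sup := by omega
    rw [h4]
    have h5 : (dysonInv m t).map (· - 1) = t.erase t.sup + Multiset.replicate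
        (((t.sup : ℤ) - m + 1).toNat - (t.erase t.sup).card) 0 := by
      simp [dysonInv, Multiset.map_map]
    rw [h5, ← Multiset.cons_add, Multiset.filter_add]
    have h6 : ∀ k, (Multiset.replicate k 0).filter (· ≠ 0) = 0 := fun k =>
      Multiset.filter_eq_nil.2 fun a ha => by simp [Multiset.eq_of_mem_replicate ha]
    rw [h6, add_zero]
    by_cases ht0 : t = 0
    · subst ht0; simp
    · rw [Multiset.cons_erase (multiset_sup_mem ht0)]
      exact Multiset.filter_eq_self.2 fun a ha => (ht a ha).ne'

end

/-- **Dyson's symmetry.** Moving the first column to a row gives a bijection between the partitions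
of `n` of rank at most `m` and the partitions of `n + m - 1` of rank at least `m - 2`. -/
theorem card_rank_le_eq_card_le_rank {n n' : ℕ} {m : ℤ} (hn : 1 ≤ n)
    (hnn : (n' : ℤ) = n + m - 1) :
    (Finset.univ.filter fun p : n.Partition => partitionRank p ≤ m).card =
      (Finset.univ.filter fun p : n'.Partition => m - 2 ≤ partitionRank p).card := by
  refine Finset.card_bij'
    (fun p hp => ⟨dysonMap m p.parts, fun hi => Nat.pos_of_ne_zero (Multiset.mem_filter.1 hi).2,
      (dysonMap_facts (fun a ha => p.parts_pos ha) p.parts_sum hn hnn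
        (Finset.mem_filter.1 hp).2).1⟩)
    (fun p hp => ⟨dysonInv m p.parts,
      fun hi => (dysonInv_facts (fun a ha => p.parts_pos ha) p.parts_sum hn hnn
        (Finset.mem_filter.1 hp).2).2.1 _ hi,
      (dysonInv_facts (fun a ha => p.parts_pos ha) p.parts_sum hn hnn
        (Finset.mem_filter.1 hp).2).1⟩) ?_ ?_ ?_ ?_
  · intro p hp
    exact Finset.mem_filter.2 ⟨Finset.mem_univ _, (dysonMap_facts (fun a ha => p.parts_pos ha)
      p.parts_sum hn hnn (Finset.mem_filter.1 hp).2).2.1⟩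
  · intro p hp
    exact Finset.mem_filter.2 ⟨Finset.mem_univ _, (dysonInv_facts (fun a ha => p.parts_pos ha)
      p.parts_sum hn hnn (Finset.mem_filter.1 hp).2).2.2.1⟩
  · intro p hp
    exact Nat.Partition.ext (dysonMap_facts (fun a ha => p.parts_pos ha)
      p.parts_sum hn hnn (Finset.mem_filter.1 hp).2).2.2
  · intro p hp
    exact Nat.Partition.ext (dysonInv_facts (fun a ha => p.parts_pos ha)
      p.parts_sum hn hnn (Finset.mem_filter.1 hp).2).2.2.2

/-- The generating series `∑ p(n) q ^ n` of the partition numbers. -/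
noncomputable def partitionSeries : PowerSeries ℚ :=
  PowerSeries.mk fun n => (Fintype.card n.Partition : ℚ)

/-- The generating series of the partitions of rank at most `m`. -/
noncomputable def rankLeSeries (m : ℤ) : PowerSeries ℚ :=
  PowerSeries.mk fun n =>
    ((Finset.univ.filter fun p : n.Partition => partitionRank p ≤ m).card : ℚ)

lemma card_rank_le_add_card_lt_rank (n : ℕ) (m : ℤ) :
    (Finset.univ.filter fun p : n.Partition => m ≤ partitionRank p).card +
      (Finset.univ.filter fun p : n.Partition => partitionRank p ≤ m - 1).card =
      Fintype.card n.Partition := by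
  have h := Finset.card_filter_add_card_filter_not (s := (Finset.univ : Finset n.Partition))
    (fun p => m ≤ partitionRank p)
  rw [Finset.card_univ] at h
  rw [← h]
  congr 2
  ext p
  simp only [Finset.mem_filter, Finset.mem_univ, true_and]
  omega

lemma partitionRank_lt {n : ℕ} (hn : 1 ≤ n) (p : n.Partition) :
    partitionRank p ≤ n - 1 ∧ 1 - (n : ℤ) ≤ partitionRank p := by
  have hs0 : p.parts ≠ 0 := fun h => by
    have := p.parts_sum
    rw [h] at this
    simp at this
    omega
  have h1 := Multiset.card_pos.2 hs0
  have h2 := p.parts_pos (multiset_sup_mem hs0)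
  have h3 := Nat.Partition.le_of_mem_parts (multiset_sup_mem hs0)
  have h4 : p.parts.card ≤ n := by
    have := multiset_sum_map_pred_add_card p.parts fun a ha => p.parts_pos ha
    rw [p.parts_sum] at this
    omega
  unfold partitionRank
  constructor <;> omega

lemma partitionRank_of_zero (p : (0 : ℕ).Partition) : partitionRank p = 0 := by
  simp [partitionRank]

open PowerSeries in
lemma coeff_rankLeSeries_zero (m : ℤ) : coeff 0 (rankLeSeries m) = if 0 ≤ m then 1 else 0 := by
  simp only [rankLeSeries, coeff_mk, partitionRank_of_zero]
  split_ifs with h <;> simp [h]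

open PowerSeries in
lemma coeff_rankLeSeries_eq {n n' : ℕ} {m : ℤ} (hn : 1 ≤ n) (hnn : (n' : ℤ) = n + m - 1) :
    coeff n (rankLeSeries m) = coeff n' partitionSeries - coeff n' (rankLeSeries (m - 3)) := by
  have h1 := card_rank_le_eq_card_le_rank hn hnn
  have h2 := card_rank_le_add_card_lt_rank n' (m - 2)
  simp only [rankLeSeries, partitionSeries, coeff_mk]
  rw [h1, ← h2, show m - 2 - 1 = m - 3 by ring]
  push_cast
  ring

open PowerSeries in
lemma coeff_rankLeSeries_of_lt {n : ℕ} {m : ℤ} (hn : 1 ≤ n) (h : (n : ℤ) + m - 1 < 0) :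
    coeff n (rankLeSeries m) = 0 := by
  simp only [rankLeSeries, coeff_mk, Nat.cast_eq_zero, Finset.card_eq_zero,
    Finset.filter_eq_empty_iff, Finset.mem_univ, true_imp_iff]
  intro p
  have := (partitionRank_lt hn p).2
  omega

open PowerSeries in
lemma coeff_rankLeSeries_of_ge {n : ℕ} {m : ℤ} (h : (n : ℤ) ≤ m) :
    coeff n (rankLeSeries m) = coeff n partitionSeries := by
  simp only [rankLeSeries, partitionSeries, coeff_mk, Nat.cast_inj]
  rw [Finset.filter_true_of_mem, Finset.card_univ]
  intro p _
  rcases Nat.eq_zero_or_pos n with rfl | hn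
  · rw [partitionRank_of_zero]; simpa using h
  · have := (partitionRank_lt hn p).1
    omega

open PowerSeries in
lemma coeff_rankLeSeries_of_pos {n : ℕ} {m : ℤ} (hn : 1 ≤ n) (h : (n : ℤ) - 1 ≤ m) :
    coeff n (rankLeSeries m) = coeff n partitionSeries := by
  simp only [rankLeSeries, partitionSeries, coeff_mk, Nat.cast_inj]
  rw [Finset.filter_true_of_mem, Finset.card_univ]
  intro p _
  have := (partitionRank_lt hn p).1
  omega

open PowerSeries in
lemma coeff_rankLeSeries_sub_two (n : ℕ) :
    coeff n (rankLeSeries (n - 2)) = coeff n partitionSeries - 1 := by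
  rcases Nat.eq_zero_or_pos n with rfl | hn
  · rw [coeff_rankLeSeries_zero]
    simp [partitionSeries]
  · have h2 := card_rank_le_add_card_lt_rank n (n - 1)
    have h3 : (Finset.univ.filter fun p : n.Partition => (n : ℤ) - 1 ≤ partitionRank p).card
        = 1 := by
      refine Finset.card_eq_one.2 ⟨Nat.Partition.indiscrete n, ?_⟩
      ext p
      simp only [Finset.mem_filter, Finset.mem_univ, true_and, Finset.mem_singleton]
      constructor
      · intro h
        have hs0 : p.parts ≠ 0 := fun h => by
          have := p.parts_sum
          rw [h] at this
          simp at this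
          omega
        have h1 := Multiset.card_pos.2 hs0
        have h3 := Nat.Partition.le_of_mem_parts (multiset_sup_mem hs0)
        have h4 : p.parts.card = 1 := by
          unfold partitionRank at h
          omega
        obtain ⟨a, ha⟩ := Multiset.card_eq_one.1 h4
        have h5 := p.parts_sum
        rw [ha, Multiset.sum_singleton] at h5
        refine Nat.Partition.ext ?_
        rw [ha, h5, Nat.Partition.indiscrete_parts (by omega)]
      · rintro rfl
        simp [partitionRank, Nat.Partition.indiscrete_parts (show n ≠ 0 by omega)]
    simp only [rankLeSeries, partitionSeries, coeff_mk]
    rw [← h2, h3, show (n : ℤ) - 1 - 1 = n - 2 by ring]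
    push_cast
    ring

open PowerSeries in
/-- The functional equation of the rank counting series for `1 ≤ m`. The empty partition, whose
rank is `0` by convention, is responsible for the correction. -/
theorem rankLeSeries_add_of_one_le {m : ℤ} (hm : 1 ≤ m) :
    X ^ (m - 1).toNat * rankLeSeries m + rankLeSeries (m - 3) =
      partitionSeries - if m = 2 then 1 else 0 := by
  ext n'
  rw [map_add, map_sub, coeff_X_pow_mul', apply_ite (coeff n'), coeff_one, map_zero]
  by_cases h1 : (m - 1).toNat ≤ n'
  · have h2 : (if m = 2 then if n' = 0 then (1 : ℚ) else 0 else 0) = 0 := by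
      split_ifs with h2 h3
      · omega
      all_goals rfl
    rw [if_pos h1, h2, sub_zero]
    rcases Nat.eq_zero_or_pos (n' - (m - 1).toNat) with h | h
    · have h4 : m - 3 = n' - 2 := by omega
      rw [h, coeff_rankLeSeries_zero, if_pos (by omega), h4, coeff_rankLeSeries_sub_two]
      ring
    · rw [coeff_rankLeSeries_eq (n := n' - (m - 1).toNat) (n' := n') h (by omega)]
      ring
  · rw [if_neg h1, zero_add]
    by_cases h2 : m = 2
    · have h3 : n' = 0 := by omega
      subst h3 h2
      rw [coeff_rankLeSeries_zero]
      simp [partitionSeries]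
    · rw [if_neg h2, sub_zero]
      rcases Nat.eq_zero_or_pos n' with h | h
      · exact coeff_rankLeSeries_of_ge (by omega)
      · exact coeff_rankLeSeries_of_pos h (by omega)

open PowerSeries in
/-- The functional equation of the rank counting series for `m ≤ 1`. -/
theorem rankLeSeries_add_of_le_one {m : ℤ} (hm : m ≤ 1) :
    rankLeSeries m + X ^ (1 - m).toNat * rankLeSeries (m - 3) =
      X ^ (1 - m).toNat * partitionSeries + if m = 0 then 1 else 0 := by
  ext n
  rw [map_add, map_add, coeff_X_pow_mul', coeff_X_pow_mul', apply_ite (coeff n), coeff_one,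
    map_zero]
  rcases Nat.eq_zero_or_pos n with h | h
  · subst h
    rw [coeff_rankLeSeries_zero]
    by_cases h1 : m = 1
    · subst h1
      simp [coeff_rankLeSeries_zero, partitionSeries]
    · have h2 : ¬ (1 - m).toNat ≤ 0 := by omega
      rw [if_neg h2, if_neg h2]
      by_cases h0 : m = 0
      · subst h0
        simp
      · have h3 : ¬ 0 ≤ m := by omega
        simp [h0, h3]
  · have h2 : (if m = 0 then if n = 0 then (1 : ℚ) else 0 else 0) = 0 := by
      split_ifs with h2 h3
      · omega
      all_goals rfl
    rw [h2, add_zero]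
    by_cases h1 : (1 - m).toNat ≤ n
    · rw [if_pos h1, if_pos h1,
        coeff_rankLeSeries_eq (n := n) (n' := n - (1 - m).toNat) h (by omega)]
      ring
    · rw [if_neg h1, if_neg h1, coeff_rankLeSeries_of_lt h (by omega), add_zero]

/-! ### A theta function acting on the rank series -/

section RankSeries

open PowerSeries

/-- The derivation `q d/dq` of `ℚ⟦q⟧`. -/
noncomputable def qDeriv : Derivation ℚ ℚ⟦X⟧ ℚ⟦X⟧ := (X : ℚ⟦X⟧) • PowerSeries.derivative ℚ

lemma coeff_qDeriv (f : ℚ⟦X⟧) (n : ℕ) : coeff n (qDeriv f) = n * coeff n f := by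
  have h : qDeriv f = X * PowerSeries.derivative ℚ f := rfl
  rw [h]
  cases n with
  | zero => simp
  | succ n => rw [coeff_succ_X_mul, PowerSeries.coeff_derivative]; push_cast; ring

lemma qDeriv_X_pow (n : ℕ) : qDeriv (X ^ n : ℚ⟦X⟧) = (n : ℚ⟦X⟧) * X ^ n := by
  ext m
  have h : (n : ℚ⟦X⟧) * X ^ n = C (n : ℚ) * (X ^ n : ℚ⟦X⟧) := by simp
  rw [coeff_qDeriv, h, coeff_C_mul, coeff_X_pow]
  split_ifs with h
  · rw [h]
  · simp

lemma X_pow_dvd_qDeriv {N : ℕ} {f : ℚ⟦X⟧} (h : X ^ N ∣ f) : X ^ N ∣ qDeriv f := by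
  rw [X_pow_dvd_iff] at h ⊢
  intro m hm
  rw [coeff_qDeriv, h m hm, mul_zero]

/-- The generating series of the partitions of rank at most `m`, with the operator
`6 q d/dq + m ^ 2 + m` applied: after this modification the corrections in the two functional
equations disappear. -/
noncomputable def rankLeHeat (m : ℤ) : ℚ⟦X⟧ :=
  6 * qDeriv (rankLeSeries m) + ((m ^ 2 + m : ℤ) : ℚ⟦X⟧) * rankLeSeries m

/-- The right hand side of the functional equations of `rankLeHeat`: a quadratic polynomial in
`m`. -/
noncomputable def partitionHeat (m : ℤ) : ℚ⟦X⟧ :=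
  6 * qDeriv partitionSeries + (((m - 2) * (m - 3) : ℤ) : ℚ⟦X⟧) * partitionSeries

lemma rankLeHeat_add_of_one_le {m : ℤ} (hm : 1 ≤ m) :
    X ^ (m - 1).toNat * rankLeHeat m + rankLeHeat (m - 3) = partitionHeat m := by
  have h := rankLeSeries_add_of_one_le hm
  have h1 := congrArg qDeriv h
  have h0 : qDeriv (if m = 2 then 1 else 0) = 0 := by split_ifs <;> simp
  have h2 : (((m - 2) * (m - 3) : ℤ) : ℚ⟦X⟧) * (if m = 2 then 1 else 0) = 0 := by
    split_ifs with h2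
    · simp [h2]
    · simp
  have h3 : (((m - 1).toNat : ℕ) : ℚ⟦X⟧) = (m : ℚ⟦X⟧) - 1 := by
    have : (((m - 1).toNat : ℕ) : ℤ) = m - 1 := by omega
    rw [← Int.cast_natCast, this]
    push_cast
    ring
  rw [map_add, map_sub, h0, Derivation.leibniz, qDeriv_X_pow, h3] at h1
  simp only [smul_eq_mul] at h1
  unfold rankLeHeat partitionHeat
  push_cast at h2 ⊢
  linear_combination 6 * h1 + ((m : ℚ⟦X⟧) - 2) * (m - 3) * h - h2

lemma rankLeHeat_add_of_le_one {m : ℤ} (hm : m ≤ 1) :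
    rankLeHeat m + X ^ (1 - m).toNat * rankLeHeat (m - 3) =
      X ^ (1 - m).toNat * partitionHeat m := by
  have h := rankLeSeries_add_of_le_one hm
  have h1 := congrArg qDeriv h
  have h0 : qDeriv (if m = 0 then 1 else 0) = 0 := by split_ifs <;> simp
  have h2 : ((m ^ 2 + m : ℤ) : ℚ⟦X⟧) * (if m = 0 then 1 else 0) = 0 := by
    split_ifs with h2
    · simp [h2]
    · simp
  have h3 : (((1 - m).toNat : ℕ) : ℚ⟦X⟧) = 1 - (m : ℚ⟦X⟧) := by
    have : (((1 - m).toNat : ℕ) : ℤ) = 1 - m := by omega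
    rw [← Int.cast_natCast, this]
    push_cast
    ring
  rw [map_add, map_add, h0, Derivation.leibniz, Derivation.leibniz, qDeriv_X_pow, h3] at h1
  simp only [smul_eq_mul] at h1
  unfold rankLeHeat partitionHeat
  push_cast at h2 ⊢
  linear_combination 6 * h1 + ((m : ℚ⟦X⟧) ^ 2 + m) * h + h2

/-- The polynomial `∏_{n = 1}^{N} (1 - z q ^ n) (z - q ^ n)`, which is `z ^ N` times a truncation of
the reciprocal of the crank generating function. -/
noncomputable def crankPoly (N : ℕ) : Polynomial ℚ⟦X⟧ :=
  ∏ n ∈ Finset.range N, ((1 - Polynomial.C (X ^ (n + 1)) * Polynomial.X) *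
    (Polynomial.X - Polynomial.C (X ^ (n + 1))))

/-- The truncated theta function `((1 - z) ∏_{n = 1}^{N} (1 - z q ^ n) (z - q ^ n)) ^ 3`. -/
noncomputable def thetaCube (N : ℕ) : Polynomial ℚ⟦X⟧ := (1 - Polynomial.X) ^ 3 * crankPoly N ^ 3

/-- The theta function `(1 - z) ∏ (1 - z q ^ n) (z - q ^ n)` changes by a monomial under `z ↦ q z`,
up to the factors at the ends of the truncated product. -/
lemma crankPoly_comp (N : ℕ) :
    (Polynomial.X - Polynomial.C (X ^ N)) * ((1 - Polynomial.X) * crankPoly N).comp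
        (Polynomial.C X * Polynomial.X) =
      - Polynomial.C (X ^ N) * (1 - Polynomial.C (X ^ (N + 1)) * Polynomial.X) *
        ((1 - Polynomial.X) * crankPoly N) := by
  induction N with
  | zero =>
    simp [crankPoly]
    ring
  | succ N ih =>
    have h : crankPoly (N + 1) = crankPoly N * ((1 - Polynomial.C (X ^ (N + 1)) * Polynomial.X) *
        (Polynomial.X - Polynomial.C (X ^ (N + 1)))) := by
      rw [crankPoly, Finset.prod_range_succ, crankPoly]
    have h0 : (Polynomial.X - Polynomial.C (X ^ N : ℚ⟦X⟧)) ≠ 0 := Polynomial.X_sub_C_ne_zero _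
    refine mul_left_cancel₀ h0 ?_
    rw [h, ← mul_assoc (1 - Polynomial.X), Polynomial.mul_comp]
    simp only [Polynomial.mul_comp, Polynomial.sub_comp, Polynomial.one_comp, Polynomial.X_comp,
      Polynomial.C_comp] at ih ⊢
    simp only [pow_succ, map_mul, map_pow] at ih ⊢
    linear_combination (Polynomial.X - Polynomial.C X ^ N * Polynomial.C X) *
      (1 - Polynomial.C X ^ N * Polynomial.C X * (Polynomial.C X * Polynomial.X)) *
      (Polynomial.C X * Polynomial.X - Polynomial.C X ^ N * Polynomial.C X) * ih

lemma thetaCube_comp (N : ℕ) :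
    (Polynomial.X - Polynomial.C (X ^ N)) ^ 3 * (thetaCube N).comp
        (Polynomial.C X * Polynomial.X) =
      - Polynomial.C (X ^ (3 * N)) * (1 - Polynomial.C (X ^ (N + 1)) * Polynomial.X) ^ 3 *
        thetaCube N := by
  have h := congrArg (· ^ 3) (crankPoly_comp N)
  have h1 : thetaCube N = ((1 - Polynomial.X) * crankPoly N) ^ 3 := by
    rw [thetaCube, mul_pow]
  rw [h1, Polynomial.pow_comp, ← mul_pow]
  rw [h]
  simp only [map_pow]
  ring

lemma coeff_mul_cube {R : Type*} [CommRing R] (a b : R) (p : Polynomial R) (i : ℕ) :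
    ((Polynomial.C a + Polynomial.C b * Polynomial.X) ^ 3 * p).coeff (i + 3) =
      a ^ 3 * p.coeff (i + 3) + 3 * a ^ 2 * b * p.coeff (i + 2) +
        3 * a * b ^ 2 * p.coeff (i + 1) + b ^ 3 * p.coeff i := by
  have h : (Polynomial.C a + Polynomial.C b * Polynomial.X) ^ 3 * p =
      Polynomial.C (a ^ 3) * p + Polynomial.C (3 * a ^ 2 * b) * (p * Polynomial.X) +
      Polynomial.C (3 * a * b ^ 2) * (p * Polynomial.X ^ 2) +
      Polynomial.C (b ^ 3) * (p * Polynomial.X ^ 3) := by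
    simp only [map_pow, map_mul, map_ofNat]
    ring
  rw [h]
  simp only [Polynomial.coeff_add, Polynomial.coeff_C_mul]
  rw [show i + 3 = (i + 2) + 1 by ring, Polynomial.coeff_mul_X, show i + 2 + 1 = (i + 1) + 2 by ring,
    Polynomial.coeff_mul_X_pow, show i + 1 + 2 = i + 3 by ring, Polynomial.coeff_mul_X_pow]

lemma thetaCube_coeff_rel (N i : ℕ) :
    X ^ i * (thetaCube N).coeff i + X ^ (3 * N) * (thetaCube N).coeff (i + 3) =
      X ^ N * X ^ i * (3 * X * (thetaCube N).coeff (i + 1)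
        - 3 * X ^ (N + 2) * (thetaCube N).coeff (i + 2)
        + X ^ (2 * N + 3) * (thetaCube N).coeff (i + 3)) +
      X ^ N * X ^ (3 * N) * (3 * X * (thetaCube N).coeff (i + 2)
        - 3 * X ^ (N + 2) * (thetaCube N).coeff (i + 1)
        + X ^ (2 * N + 3) * (thetaCube N).coeff i) := by
  have h := congrArg (fun p => p.coeff (i + 3)) (thetaCube_comp N)
  have h1 : (Polynomial.X - Polynomial.C (X ^ N : ℚ⟦X⟧)) =
      Polynomial.C (- X ^ N) + Polynomial.C 1 * Polynomial.X := by
    simp; ring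
  have h2 : (1 - Polynomial.C (X ^ (N + 1) : ℚ⟦X⟧) * Polynomial.X) =
      Polynomial.C 1 + Polynomial.C (- X ^ (N + 1)) * Polynomial.X := by
    simp; ring
  have h3 : - Polynomial.C (X ^ (3 * N) : ℚ⟦X⟧) = Polynomial.C (- X ^ (3 * N)) := by simp
  rw [h1, h2, h3, coeff_mul_cube, mul_assoc (Polynomial.C (- X ^ (3 * N))),
    Polynomial.coeff_C_mul, coeff_mul_cube] at h
  simp only [Polynomial.comp_C_mul_X_coeff] at h
  linear_combination h

/-- The truncated theta function is almost invariant under `z ↦ q z`: coefficients of index at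
least that of the centre. -/
lemma X_pow_dvd_thetaCube_of_ge {N i : ℕ} (hi : 3 * N ≤ i) :
    X ^ N ∣ (thetaCube N).coeff (i + 3) + X ^ (i - 3 * N) * (thetaCube N).coeff i := by
  obtain ⟨j, rfl⟩ := Nat.exists_eq_add_of_le hi
  have h := thetaCube_coeff_rel N (3 * N + j)
  rw [Nat.add_sub_cancel_left]
  have h0 : (X ^ (3 * N) : ℚ⟦X⟧) ≠ 0 := pow_ne_zero _ X_ne_zero
  refine ⟨X ^ j * (3 * X * (thetaCube N).coeff (3 * N + j + 1)
        - 3 * X ^ (N + 2) * (thetaCube N).coeff (3 * N + j + 2)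
        + X ^ (2 * N + 3) * (thetaCube N).coeff (3 * N + j + 3)) +
      (3 * X * (thetaCube N).coeff (3 * N + j + 2)
        - 3 * X ^ (N + 2) * (thetaCube N).coeff (3 * N + j + 1)
        + X ^ (2 * N + 3) * (thetaCube N).coeff (3 * N + j)), mul_left_cancel₀ h0 ?_⟩
  rw [pow_add X (3 * N) j] at h
  linear_combination h

/-- The truncated theta function is almost invariant under `z ↦ q z`: coefficients of index at
most that of the centre. -/
lemma X_pow_dvd_thetaCube_of_le {N i : ℕ} (hi : i ≤ 3 * N) :
    X ^ N ∣ (thetaCube N).coeff i + X ^ (3 * N - i) * (thetaCube N).coeff (i + 3) := by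
  obtain ⟨j, hj⟩ := Nat.exists_eq_add_of_le hi
  have h := thetaCube_coeff_rel N i
  rw [hj, Nat.add_sub_cancel_left]
  have h0 : (X ^ i : ℚ⟦X⟧) ≠ 0 := pow_ne_zero _ X_ne_zero
  refine ⟨(3 * X * (thetaCube N).coeff (i + 1)
        - 3 * X ^ (N + 2) * (thetaCube N).coeff (i + 2)
        + X ^ (2 * N + 3) * (thetaCube N).coeff (i + 3)) +
      X ^ j * (3 * X * (thetaCube N).coeff (i + 2)
        - 3 * X ^ (N + 2) * (thetaCube N).coeff (i + 1)
        + X ^ (2 * N + 3) * (thetaCube N).coeff i), mul_left_cancel₀ h0 ?_⟩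
  rw [hj, pow_add X i j] at h
  linear_combination h

lemma X_pow_dvd_thetaCube_of_lt {N i : ℕ} (hN : 1 ≤ N) (hi : i < 3) :
    X ^ N ∣ (thetaCube N).coeff i := by
  have h := X_pow_dvd_thetaCube_of_le (N := N) (i := i) (by omega)
  exact (dvd_add_left (Dvd.dvd.mul_right (pow_dvd_pow _ (by omega)) _)).1 h

/-- The termwise estimate behind the vanishing of the coefficients of the product of the theta
function with the rank series, to the right of the centre. -/
lemma thetaCube_mul_rankLeHeat_of_one_le {N i : ℕ} {M m : ℤ} (hM : 1 ≤ M)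
    (hm : m = M + 3 * N - i) :
    X ^ N ∣ (thetaCube N).coeff (i + 3) * rankLeHeat (m - 3) -
      X ^ (M - 1).toNat * ((thetaCube N).coeff i * rankLeHeat m) -
      (thetaCube N).coeff (i + 3) * partitionHeat m := by
  rcases le_total (3 * N) i with hi | hi
  · obtain ⟨w, hw⟩ := X_pow_dvd_thetaCube_of_ge hi
    rcases le_total 1 m with h1 | h1
    · have h := rankLeHeat_add_of_one_le h1
      rw [show (M - 1).toNat = (i - 3 * N) + (m - 1).toNat by omega, pow_add]
      exact ⟨- w * X ^ (m - 1).toNat * rankLeHeat m, by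
        linear_combination (thetaCube N).coeff (i + 3) * h
          - X ^ (m - 1).toNat * rankLeHeat m * hw⟩
    · have h := rankLeHeat_add_of_le_one h1
      rw [show i - 3 * N = (M - 1).toNat + (1 - m).toNat by omega, pow_add] at hw
      exact ⟨w * (rankLeHeat (m - 3) - partitionHeat m), by
        linear_combination (rankLeHeat (m - 3) - partitionHeat m) * hw -
          X ^ (M - 1).toNat * (thetaCube N).coeff i * h⟩
  · obtain ⟨w, hw⟩ := X_pow_dvd_thetaCube_of_le hi
    have h := rankLeHeat_add_of_one_le (show 1 ≤ m by omega)
    rw [show (m - 1).toNat = (M - 1).toNat + (3 * N - i) by omega, pow_add] at h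
    exact ⟨- w * X ^ (M - 1).toNat * rankLeHeat m, by
      linear_combination - X ^ (M - 1).toNat * rankLeHeat m * hw +
        (thetaCube N).coeff (i + 3) * h⟩

/-- The termwise estimate behind the vanishing of the coefficients of the product of the theta
function with the rank series, to the left of the centre. -/
lemma thetaCube_mul_rankLeHeat_of_le_one {N i : ℕ} {M m : ℤ} (hM : M ≤ 1)
    (hm : m = M + 3 * N - i) :
    X ^ N ∣ X ^ (1 - M).toNat * ((thetaCube N).coeff (i + 3) * rankLeHeat (m - 3)) -
      (thetaCube N).coeff i * rankLeHeat m -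
      X ^ (1 - M).toNat * ((thetaCube N).coeff (i + 3) * partitionHeat m) := by
  rcases le_total i (3 * N) with hi | hi
  · obtain ⟨w, hw⟩ := X_pow_dvd_thetaCube_of_le hi
    rcases le_total 1 m with h1 | h1
    · have h := rankLeHeat_add_of_one_le h1
      rw [show 3 * N - i = (1 - M).toNat + (m - 1).toNat by omega, pow_add] at hw
      exact ⟨- w * rankLeHeat m, by
        linear_combination - rankLeHeat m * hw +
          X ^ (1 - M).toNat * (thetaCube N).coeff (i + 3) * h⟩
    · have h := rankLeHeat_add_of_le_one h1
      rw [show (1 - M).toNat = (1 - m).toNat + (3 * N - i) by omega, pow_add]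
      exact ⟨w * X ^ (1 - m).toNat * (rankLeHeat (m - 3) - partitionHeat m), by
        linear_combination X ^ (1 - m).toNat * (rankLeHeat (m - 3) - partitionHeat m) * hw -
          (thetaCube N).coeff i * h⟩
  · obtain ⟨w, hw⟩ := X_pow_dvd_thetaCube_of_ge hi
    have h := rankLeHeat_add_of_le_one (show m ≤ 1 by omega)
    rw [show (1 - m).toNat = (1 - M).toNat + (i - 3 * N) by omega, pow_add] at h
    exact ⟨w * X ^ (1 - M).toNat * (rankLeHeat (m - 3) - partitionHeat m), by
      linear_combination X ^ (1 - M).toNat * (rankLeHeat (m - 3) - partitionHeat m) * hw -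
        (thetaCube N).coeff i * h⟩

/-- The shift of two-sided sequences, through which polynomials act on them: a two-sided sequence
is thought of as the coefficients of a Laurent series in a variable `z`, and the shift as the
multiplication by `z`. -/
def seqShift (A : Type*) [CommRing A] : Module.End A (ℤ → A) where
  toFun x m := x (m - 1)
  map_add' _ _ := rfl
  map_smul' _ _ := rfl

lemma seqShift_pow_apply {A : Type*} [CommRing A] (n : ℕ) (x : ℤ → A) (m : ℤ) :
    (seqShift A ^ n) x m = x (m - n) := by
  induction n generalizing m with
  | zero => simp
  | succ n ih =>
    rw [pow_succ', Module.End.mul_apply]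
    change (seqShift A ^ n) x (m - 1) = _
    rw [ih]
    congr 1
    push_cast
    ring

lemma aeval_seqShift_apply {A : Type*} [CommRing A] {p : Polynomial A} {n : ℕ}
    (hn : p.natDegree < n) (x : ℤ → A) (m : ℤ) :
    Polynomial.aeval (seqShift A) p x m = ∑ i ∈ Finset.range n, p.coeff i * x (m - i) := by
  rw [Polynomial.aeval_eq_sum_range' hn, LinearMap.sum_apply, Finset.sum_apply]
  refine Finset.sum_congr rfl fun i _ => ?_
  rw [LinearMap.smul_apply, Pi.smul_apply, seqShift_pow_apply, smul_eq_mul]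

lemma aeval_one_sub_X_cube_apply {A : Type*} [CommRing A] (x : ℤ → A) (m : ℤ) :
    Polynomial.aeval (seqShift A) ((1 - Polynomial.X) ^ 3 : Polynomial A) x m =
      x m - 3 * x (m - 1) + 3 * x (m - 2) - x (m - 3) := by
  have h : ((1 - Polynomial.X) ^ 3 : Polynomial A) =
      1 - (3 : A) • Polynomial.X + (3 : A) • Polynomial.X ^ 2 - Polynomial.X ^ 3 := by
    simp only [Polynomial.smul_eq_C_mul, map_ofNat]
    ring
  rw [h]
  simp only [map_sub, map_add, map_one, map_smul, Polynomial.aeval_X, map_pow]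
  simp only [LinearMap.sub_apply, LinearMap.add_apply, LinearMap.smul_apply, Pi.sub_apply,
    Pi.add_apply, Pi.smul_apply, seqShift_pow_apply, Module.End.one_apply, smul_eq_mul]
  rfl

lemma dvd_aeval_seqShift_sub {A : Type*} [CommRing A] {a : A} {x y : ℤ → A} (p : Polynomial A)
    (h : ∀ m, a ∣ x m - y m) (m : ℤ) :
    a ∣ Polynomial.aeval (seqShift A) p x m - Polynomial.aeval (seqShift A) p y m := by
  choose w hw using h
  have h1 : x - y = a • w := funext hw
  have h2 : Polynomial.aeval (seqShift A) p x - Polynomial.aeval (seqShift A) p y =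
      a • Polynomial.aeval (seqShift A) p w := by
    rw [← map_sub, h1, map_smul]
  exact ⟨_, congrFun h2 m⟩

/-- The third difference `(1 - z) ^ 3` kills the quadratic polynomial `partitionHeat`. -/
lemma thetaCube_aeval_partitionHeat (N : ℕ) :
    Polynomial.aeval (seqShift ℚ⟦X⟧) (thetaCube N) partitionHeat = 0 := by
  rw [thetaCube, mul_comm, map_mul, Module.End.mul_apply]
  have : Polynomial.aeval (seqShift ℚ⟦X⟧) ((1 - Polynomial.X) ^ 3 : Polynomial ℚ⟦X⟧)
      partitionHeat = 0 := by
    funext m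
    rw [aeval_one_sub_X_cube_apply]
    simp only [partitionHeat, Pi.zero_apply]
    push_cast
    ring
  rw [this, map_zero]

/-- The product of the theta function with the rank series is supported in a single place. -/
lemma thetaCube_aeval_rankLeHeat {N : ℕ} (hN : 1 ≤ N) {M : ℤ} (hM : M ≠ 1) :
    X ^ N ∣ Polynomial.aeval (seqShift ℚ⟦X⟧) (thetaCube N) rankLeHeat (M + 3 * N) := by
  set g := thetaCube N with hg
  set d := Polynomial.aeval (seqShift ℚ⟦X⟧) g rankLeHeat (M + 3 * N) with hd
  set n := g.natDegree + 1
  have hn : g.natDegree < n := Nat.lt_succ_self _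
  -- the sum over the shifted index, up to the three lowest terms
  have hsplit : ∀ (x : ℤ → ℚ⟦X⟧) (K : ℤ), X ^ N ∣ Polynomial.aeval (seqShift ℚ⟦X⟧) g x K -
      ∑ i ∈ Finset.range n, g.coeff (i + 3) * x (K - i - 3) := by
    intro x K
    have h : ∑ i ∈ Finset.range n, g.coeff (3 + i) * x (K - (3 + i : ℕ)) =
        ∑ i ∈ Finset.range n, g.coeff (i + 3) * x (K - i - 3) :=
      Finset.sum_congr rfl fun i _ => by rw [add_comm 3 i]; congr 2; push_cast; ring
    rw [aeval_seqShift_apply (n := n + 3) (by omega), add_comm n 3, Finset.sum_range_add, h,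
      add_sub_cancel_right]
    exact Finset.dvd_sum fun i hi => Dvd.dvd.mul_right
      (X_pow_dvd_thetaCube_of_lt hN (Finset.mem_range.1 hi)) _
  have h1 := hsplit rankLeHeat (M + 3 * N)
  have h2 := hsplit partitionHeat (M + 3 * N + 3)
  rw [thetaCube_aeval_partitionHeat, Pi.zero_apply, zero_sub, dvd_neg] at h2
  rw [← hd] at h1
  have h3 : d = ∑ i ∈ Finset.range n, g.coeff i * rankLeHeat (M + 3 * N - i) :=
    aeval_seqShift_apply hn _ _
  have hunit : ∀ {k : ℕ}, k ≠ 0 → IsUnit (1 - X ^ k : ℚ⟦X⟧) := fun {k} hk => by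
    rw [isUnit_iff_constantCoeff]
    simp [hk]
  rcases lt_or_gt_of_ne hM with hM' | hM'
  · have h4 := Finset.dvd_sum (s := Finset.range n) fun i _ =>
      thetaCube_mul_rankLeHeat_of_le_one (N := N) (i := i) (M := M) hM'.le rfl
    rw [Finset.sum_sub_distrib, Finset.sum_sub_distrib, ← Finset.mul_sum, ← Finset.mul_sum, ← h3]
      at h4
    have h5 : X ^ N ∣ (1 - X ^ (1 - M).toNat) * d := by
      rw [← hg] at h4
      have h6 : ∑ i ∈ Finset.range n, g.coeff (i + 3) * partitionHeat (M + 3 * N + 3 - i - 3) =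
          ∑ i ∈ Finset.range n, g.coeff (i + 3) * partitionHeat (M + 3 * N - i) :=
        Finset.sum_congr rfl fun i _ => by congr 2; ring
      rw [h6] at h2
      have h7 := dvd_add (dvd_add h4 (Dvd.dvd.mul_left h1 (X ^ (1 - M).toNat)))
        (Dvd.dvd.mul_left h2 (X ^ (1 - M).toNat))
      rw [← dvd_neg]
      convert h7 using 1
      ring
    exact ((hunit (by omega)).dvd_mul_left).1 h5
  · have h4 := Finset.dvd_sum (s := Finset.range n) fun i _ =>
      thetaCube_mul_rankLeHeat_of_one_le (N := N) (i := i) (M := M) hM'.le rfl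
    rw [Finset.sum_sub_distrib, Finset.sum_sub_distrib, ← Finset.mul_sum, ← h3] at h4
    have h5 : X ^ N ∣ (1 - X ^ (M - 1).toNat) * d := by
      rw [← hg] at h4
      have h6 : ∑ i ∈ Finset.range n, g.coeff (i + 3) * partitionHeat (M + 3 * N + 3 - i - 3) =
          ∑ i ∈ Finset.range n, g.coeff (i + 3) * partitionHeat (M + 3 * N - i) :=
        Finset.sum_congr rfl fun i _ => by congr 2; ring
      rw [h6] at h2
      have h7 := dvd_add (dvd_add h4 h1) h2
      convert h7 using 1
      ring
    exact ((hunit (by omega)).dvd_mul_left).1 h5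

end RankSeries

/-! ### The rank-crank differential equation -/

section RankODE

open PowerSeries

/-- The coefficients of a polynomial as a two-sided sequence. -/
def Polynomial.twoSided {A : Type*} [CommRing A] (p : Polynomial A) (m : ℤ) : A :=
  if 0 ≤ m then p.coeff m.toNat else 0

lemma Polynomial.twoSided_natCast {A : Type*} [CommRing A] (p : Polynomial A) (m : ℕ) :
    p.twoSided m = p.coeff m := by
  simp [Polynomial.twoSided]

lemma Polynomial.twoSided_C_mul_X_pow_mul {A : Type*} [CommRing A] (p : Polynomial A) (a : A)
    (n : ℕ) (m : ℤ) :
    (Polynomial.C a * Polynomial.X ^ n * p).twoSided m = a * p.twoSided (m - n) := by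
  unfold Polynomial.twoSided
  by_cases h : 0 ≤ m
  · rw [if_pos h, mul_assoc, Polynomial.coeff_C_mul, Polynomial.coeff_X_pow_mul']
    by_cases h1 : n ≤ m.toNat
    · rw [if_pos h1, if_pos (by omega)]
      congr 2
      omega
    · rw [if_neg h1, if_neg (by omega)]
  · rw [if_neg h, if_neg (by omega), mul_zero]

lemma Polynomial.twoSided_add {A : Type*} [CommRing A] (p q : Polynomial A) (m : ℤ) :
    (p + q).twoSided m = p.twoSided m + q.twoSided m := by
  unfold Polynomial.twoSided
  split_ifs <;> simp

lemma aeval_seqShift_twoSided {A : Type*} [CommRing A] (f p : Polynomial A) :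
    Polynomial.aeval (seqShift A) f p.twoSided = (f * p).twoSided := by
  induction f using Polynomial.induction_on' with
  | add f g hf hg =>
    funext m
    rw [map_add, LinearMap.add_apply, Pi.add_apply, hf, hg, add_mul, Polynomial.twoSided_add]
  | monomial n a =>
    funext m
    rw [← Polynomial.C_mul_X_pow_eq_monomial, map_mul, map_pow, Polynomial.aeval_C,
      Polynomial.aeval_X, Polynomial.twoSided_C_mul_X_pow_mul, Module.End.mul_apply,
      Module.algebraMap_end_apply, Pi.smul_apply, seqShift_pow_apply, smul_eq_mul]

/-- The generating series `∑ N(m, n) q ^ n` of the partitions of rank `m`. -/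
noncomputable def rankSeries (m : ℤ) : ℚ⟦X⟧ := PowerSeries.mk fun n => (rankCount m n : ℚ)

lemma rankSeries_eq_sub (m : ℤ) : rankSeries m = rankLeSeries m - rankLeSeries (m - 1) := by
  ext n
  rw [map_sub, rankSeries, rankLeSeries, rankLeSeries, coeff_mk, coeff_mk, coeff_mk, rankCount,
    eq_sub_iff_add_eq, ← Nat.cast_add, Nat.cast_inj, ← Finset.card_union_of_disjoint]
  · congr 1
    ext p
    simp only [Finset.mem_union, Finset.mem_filter, Finset.mem_univ, true_and]
    omega
  · rw [Finset.disjoint_filter]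
    intro p _ h
    omega

lemma X_pow_dvd_rankSeries {N : ℕ} {m : ℤ} (h : m < -N ∨ (N : ℤ) < m) :
    X ^ N ∣ rankSeries m := by
  rw [X_pow_dvd_iff]
  intro n hn
  simp only [rankSeries, coeff_mk, Nat.cast_eq_zero, rankCount, Finset.card_eq_zero,
    Finset.filter_eq_empty_iff, Finset.mem_univ, true_imp_iff]
  rintro p rfl
  rcases Nat.eq_zero_or_pos n with rfl | h0
  · rw [partitionRank_of_zero] at h
    omega
  · have := partitionRank_lt h0 p
    omega

/-- The polynomial `∑ y m z ^ (m + N)`, the sum being over `|m| ≤ N`. -/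
noncomputable def truncPoly (N : ℕ) (y : ℤ → ℚ⟦X⟧) : Polynomial ℚ⟦X⟧ :=
  ∑ i ∈ Finset.range (2 * N + 1), Polynomial.C (y (i - N)) * Polynomial.X ^ i

lemma dvd_truncPoly_twoSided {N : ℕ} {y : ℤ → ℚ⟦X⟧} (a : ℤ → ℚ⟦X⟧) (b : ℤ → ℚ⟦X⟧)
    (hy : ∀ m, y m = 6 * a m * qDeriv (rankSeries m) + b m * rankSeries m) (m : ℤ) :
    X ^ N ∣ (truncPoly N y).twoSided m - y (m - N) := by
  have h0 : ∀ m : ℤ, m < -N ∨ (N : ℤ) < m → X ^ N ∣ y m := fun m hm => by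
    rw [hy]
    exact dvd_add (Dvd.dvd.mul_left (X_pow_dvd_qDeriv (X_pow_dvd_rankSeries hm)) _)
      (Dvd.dvd.mul_left (X_pow_dvd_rankSeries hm) _)
  unfold Polynomial.twoSided truncPoly
  split_ifs with h
  · obtain ⟨k, rfl⟩ := Int.eq_ofNat_of_zero_le h
    simp only [Int.toNat_natCast, Polynomial.finsetSum_coeff, Polynomial.coeff_C_mul_X_pow]
    rw [Finset.sum_ite_eq]
    split_ifs with h1
    · simp
    · rw [zero_sub, dvd_neg]
      rw [Finset.mem_range] at h1
      exact h0 _ (by omega)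
  · rw [zero_sub, dvd_neg]
    exact h0 _ (by omega)

/-- The heat operator applied to the truncated rank generating function, as a polynomial. -/
noncomputable def rankHeatPoly (N : ℕ) : Polynomial ℚ⟦X⟧ :=
  (1 - Polynomial.X) ^ 2 * truncPoly N (fun m => 6 * qDeriv (rankSeries m) +
      ((m ^ 2 + m : ℤ) : ℚ⟦X⟧) * rankSeries m) +
    2 * Polynomial.X * (1 - Polynomial.X) * truncPoly N (fun m => (m : ℚ⟦X⟧) * rankSeries m) +
    2 * Polynomial.X * truncPoly N rankSeries

lemma rankHeatPoly_twoSided (N : ℕ) (m : ℤ) :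
    X ^ N ∣ (rankHeatPoly N).twoSided m - Polynomial.aeval (seqShift ℚ⟦X⟧)
      (Polynomial.X ^ N * (1 - Polynomial.X) ^ 3 : Polynomial ℚ⟦X⟧) rankLeHeat m := by
  set p₁ := truncPoly N (fun m => 6 * qDeriv (rankSeries m) +
      ((m ^ 2 + m : ℤ) : ℚ⟦X⟧) * rankSeries m) with hp₁
  set p₂ := truncPoly N (fun m => (m : ℚ⟦X⟧) * rankSeries m) with hp₂
  set p₃ := truncPoly N rankSeries with hp₃
  have e₁ : ∀ m, X ^ N ∣ p₁.twoSided m - _ := dvd_truncPoly_twoSided (fun _ => 1)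
    (fun m => ((m ^ 2 + m : ℤ) : ℚ⟦X⟧)) fun m => by ring
  have e₂ : ∀ m, X ^ N ∣ p₂.twoSided m - _ := dvd_truncPoly_twoSided (fun _ => 0)
    (fun m => (m : ℚ⟦X⟧)) fun m => by ring
  have e₃ : ∀ m, X ^ N ∣ p₃.twoSided m - _ := dvd_truncPoly_twoSided (fun _ => 0)
    (fun _ => 1) fun m => by ring
  have h : rankHeatPoly N = Polynomial.C 1 * Polynomial.X ^ 0 * p₁ +
      Polynomial.C (-2) * Polynomial.X ^ 1 * p₁ + Polynomial.C 1 * Polynomial.X ^ 2 * p₁ +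
      Polynomial.C 2 * Polynomial.X ^ 1 * p₂ + Polynomial.C (-2) * Polynomial.X ^ 2 * p₂ +
      Polynomial.C 2 * Polynomial.X ^ 1 * p₃ := by
    simp only [rankHeatPoly, map_neg, map_ofNat, map_one]
    ring
  rw [h, map_mul, Module.End.mul_apply, map_pow, Polynomial.aeval_X, seqShift_pow_apply,
    aeval_one_sub_X_cube_apply]
  simp only [Polynomial.twoSided_add, Polynomial.twoSided_C_mul_X_pow_mul]
  have key := dvd_add (dvd_add (dvd_add (dvd_add (dvd_add (e₁ m)
    (Dvd.dvd.mul_left (e₁ (m - 1)) (-2))) (e₁ (m - 2))) (Dvd.dvd.mul_left (e₂ (m - 1)) 2))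
    (Dvd.dvd.mul_left (e₂ (m - 2)) (-2))) (Dvd.dvd.mul_left (e₃ (m - 1)) 2)
  convert key using 1
  simp only [rankLeHeat, rankSeries_eq_sub, map_sub, Nat.cast_zero, Nat.cast_one, sub_zero,
    Nat.cast_ofNat, sub_right_comm m _ (N : ℤ), sub_sub (m - (N : ℤ))]
  norm_num only
  push_cast
  ring

/-- The rank-crank identity in truncated form: the cube of the crank product times the heat operator
applied to the rank generating function is concentrated in a single power of `z`. -/
lemma crankPoly_cube_mul_rankHeatPoly {N : ℕ} (hN : 1 ≤ N) :
    ∃ d : ℚ⟦X⟧, Polynomial.C (X ^ N) ∣ crankPoly N ^ 3 * rankHeatPoly N -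
      Polynomial.C d * Polynomial.X ^ (4 * N + 1) := by
  refine ⟨(crankPoly N ^ 3 * rankHeatPoly N).coeff (4 * N + 1), ?_⟩
  rw [Polynomial.C_dvd_iff_dvd_coeff]
  intro K
  rw [Polynomial.coeff_sub, Polynomial.coeff_C_mul_X_pow]
  split_ifs with hK
  · simp [hK]
  · rw [sub_zero, ← Polynomial.twoSided_natCast, ← aeval_seqShift_twoSided]
    have h1 := dvd_aeval_seqShift_sub (crankPoly N ^ 3) (rankHeatPoly_twoSided N) (K : ℤ)
    have h2 : Polynomial.aeval (seqShift ℚ⟦X⟧) (crankPoly N ^ 3) (fun m =>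
        Polynomial.aeval (seqShift ℚ⟦X⟧) (Polynomial.X ^ N * (1 - Polynomial.X) ^ 3 :
          Polynomial ℚ⟦X⟧) rankLeHeat m) K =
        Polynomial.aeval (seqShift ℚ⟦X⟧) (thetaCube N) rankLeHeat ((K - 4 * N : ℤ) + 3 * N) := by
      have h3 : crankPoly N ^ 3 * (Polynomial.X ^ N * (1 - Polynomial.X) ^ 3 :
          Polynomial ℚ⟦X⟧) = Polynomial.X ^ N * thetaCube N := by
        rw [thetaCube]; ring
      have h4 := congrArg (fun p => Polynomial.aeval (seqShift ℚ⟦X⟧) p rankLeHeat (K : ℤ)) h3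
      simp only [map_mul, Module.End.mul_apply] at h4
      rw [map_pow _ Polynomial.X, Polynomial.aeval_X, seqShift_pow_apply] at h4
      convert h4 using 2
      · simp only [map_mul, Module.End.mul_apply, map_pow, Polynomial.aeval_X]
      · ring
    rw [h2] at h1
    exact (dvd_iff_dvd_of_dvd_sub h1).2 (thetaCube_aeval_rankLeHeat hN (by omega))

/-- The power series `exp (m u)` in the variable `u`. -/
noncomputable def expU (m : ℤ) : ℚ⟦X⟧⟦X⟧ := rescale (m : ℚ⟦X⟧) (exp ℚ⟦X⟧)

lemma coeff_expU (m : ℤ) (k : ℕ) :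
    coeff k (expU m) = (m : ℚ⟦X⟧) ^ k * C (1 / (k.factorial : ℚ)) := by
  rw [expU, coeff_rescale, coeff_exp]
  rfl

lemma expU_add (m n : ℤ) : expU (m + n) = expU m * expU n := by
  rw [expU, expU, expU, exp_mul_exp_eq_exp_add]
  push_cast
  rfl

lemma expU_zero : expU 0 = 1 := by
  simp [expU]

lemma expU_natCast (n : ℕ) : expU n = expU 1 ^ n := by
  simp [expU, exp_pow_eq_rescale_exp, rescale_one]

lemma constantCoeff_expU (m : ℤ) : constantCoeff (expU m) = 1 := by
  rw [← coeff_zero_eq_constantCoeff_apply, coeff_expU]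
  simp

/-- The derivation `d/du`. -/
noncomputable abbrev uDeriv := PowerSeries.derivative ℚ⟦X⟧

lemma uDeriv_C_mul (a : ℚ⟦X⟧) (F : ℚ⟦X⟧⟦X⟧) : uDeriv (C a * F) = C a * uDeriv F := by
  ext1 k
  rw [PowerSeries.coeff_derivative, coeff_C_mul, coeff_C_mul, PowerSeries.coeff_derivative,
    mul_assoc]

lemma derivative_mul_eq {R : Type*} [CommSemiring R] (F G : R⟦X⟧) :
    PowerSeries.derivative R (F * G) =
      F * PowerSeries.derivative R G + G * PowerSeries.derivative R F := by
  simpa only [smul_eq_mul] using (PowerSeries.derivative R).leibniz F G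

lemma uDeriv_mul (F G : ℚ⟦X⟧⟦X⟧) : uDeriv (F * G) = F * uDeriv G + G * uDeriv F :=
  derivative_mul_eq F G

lemma uDeriv_one : uDeriv 1 = 0 := by
  have h := uDeriv_mul 1 1
  rw [mul_one, one_mul] at h
  exact left_eq_add.1 h

lemma uDeriv_expU (m : ℤ) : uDeriv (expU m) = C (m : ℚ⟦X⟧) * expU m := by
  ext1 k
  rw [PowerSeries.coeff_derivative, coeff_C_mul, coeff_expU, coeff_expU]
  have h : (C (1 / ((k + 1).factorial : ℚ)) : ℚ⟦X⟧) * ((k : ℚ⟦X⟧) + 1) =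
      C (1 / (k.factorial : ℚ)) := by
    have h1 : ((k : ℚ⟦X⟧) + 1) = C ((k : ℚ) + 1) := by simp
    rw [h1, ← map_mul]
    congr 1
    rw [Nat.factorial_succ]
    have := Nat.factorial_ne_zero k
    push_cast
    field_simp
  linear_combination (m : ℚ⟦X⟧) ^ (k + 1) * h

lemma C_dvd_iff {A : Type*} [CommRing A] {a : A} {F : A⟦X⟧} : C a ∣ F ↔ ∀ k, a ∣ coeff k F := by
  constructor
  · rintro ⟨G, rfl⟩ k
    rw [coeff_C_mul]
    exact dvd_mul_right _ _
  · intro h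
    choose w hw using h
    exact ⟨PowerSeries.mk w, by ext1 k; rw [coeff_C_mul, coeff_mk, hw]⟩

lemma C_dvd_uDeriv {a : ℚ⟦X⟧} {F : ℚ⟦X⟧⟦X⟧} (h : C a ∣ F) : C a ∣ uDeriv F := by
  obtain ⟨G, rfl⟩ := h
  rw [uDeriv_C_mul]
  exact dvd_mul_right _ _

/-- The operator `q d/dq` on the coefficients of a power series in `u`. -/
noncomputable def qDerivU : ℚ⟦X⟧⟦X⟧ →+ ℚ⟦X⟧⟦X⟧ where
  toFun F := PowerSeries.mk fun k => qDeriv (coeff k F)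
  map_zero' := by ext1 k; simp
  map_add' F G := by ext1 k; simp

lemma coeff_qDerivU (F : ℚ⟦X⟧⟦X⟧) (k : ℕ) : coeff k (qDerivU F) = qDeriv (coeff k F) := by
  simp [qDerivU]

lemma qDerivU_C_mul_expU (a : ℚ⟦X⟧) (m : ℤ) : qDerivU (C a * expU m) = C (qDeriv a) * expU m := by
  ext1 k
  rw [coeff_qDerivU, coeff_C_mul, coeff_C_mul, coeff_expU]
  have h : (m : ℚ⟦X⟧) ^ k * C (1 / (k.factorial : ℚ)) = C ((m : ℚ) ^ k * (1 / (k.factorial : ℚ))) := by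
    simp
  rw [h, mul_comm a, ← smul_eq_C_mul, Derivation.map_smul, smul_eq_C_mul, mul_comm]

/-- The heat operator `(1 - Z) ^ 2 (6 q d/dq + d²/du² + d/du) + 2 Z (1 - Z) d/du + 2 Z`, where
`Z = exp u`. -/
noncomputable def heatOp (F : ℚ⟦X⟧⟦X⟧) : ℚ⟦X⟧⟦X⟧ :=
  (1 - expU 1) ^ 2 * (6 * qDerivU F + uDeriv (uDeriv F) + uDeriv F) +
    2 * expU 1 * (1 - expU 1) * uDeriv F + 2 * expU 1 * F

/-- The generating series `∑ N_k(n) q ^ n` of the rank moments of order `k`. -/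
noncomputable def rankMomentSeries (k : ℕ) : ℚ⟦X⟧ := PowerSeries.mk fun n => (rankMoment k n : ℚ)

/-- The rank generating function `∑ N(m, n) z ^ m q ^ n` at `z = exp u`, as the exponential
generating series of the rank moments. -/
noncomputable def rankGen : ℚ⟦X⟧⟦X⟧ :=
  PowerSeries.mk fun k => C (1 / (k.factorial : ℚ)) * rankMomentSeries k

/-- The rank generating function, restricted to the ranks between `-N` and `N`. -/
noncomputable def rankGenTrunc (N : ℕ) : ℚ⟦X⟧⟦X⟧ :=
  ∑ i ∈ Finset.range (2 * N + 1), C (rankSeries (i - N)) * expU (i - N)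

lemma C_dvd_rankGen_sub (N : ℕ) : C (X ^ N) ∣ rankGen - rankGenTrunc N := by
  rw [C_dvd_iff]
  intro k
  rw [X_pow_dvd_iff]
  intro n hn
  rw [map_sub, rankGen, rankGenTrunc, coeff_mk, map_sum]
  have h : ∀ i ∈ Finset.range (2 * N + 1), coeff k (C (rankSeries (i - N)) * expU (i - N)) =
      C (1 / (k.factorial : ℚ)) * (C (((i : ℤ) - N : ℤ) ^ k : ℚ) * rankSeries (i - N)) := by
    intro i _
    rw [coeff_C_mul, coeff_expU]
    simp only [map_pow, map_intCast]
    ring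
  rw [Finset.sum_congr rfl h, ← Finset.mul_sum, ← mul_sub, coeff_C_mul, map_sub, map_sum]
  simp only [coeff_C_mul, rankSeries, coeff_mk, rankMomentSeries]
  rw [rankMoment_eq_sum]
  have h2 : ∑ p : n.Partition, partitionRank p ^ k =
      ∑ i ∈ Finset.range (2 * N + 1), ((i : ℤ) - N) ^ k * rankCount (i - N) n := by
    rw [← Finset.sum_fiberwise_of_maps_to (g := fun p : n.Partition => (partitionRank p + N).toNat)
      (t := Finset.range (2 * N + 1))]
    · refine Finset.sum_congr rfl fun i hi => ?_
      rw [Finset.sum_congr rfl (g := fun _ => ((i : ℤ) - N) ^ k), Finset.sum_const, rankCount,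
        nsmul_eq_mul, mul_comm]
      · congr 3
        ext p
        have hb : -(N : ℤ) ≤ partitionRank p := by
          rcases Nat.eq_zero_or_pos n with rfl | h0
          · rw [partitionRank_of_zero]; omega
          · have := partitionRank_lt h0 p; omega
        simp only [Finset.mem_filter, Finset.mem_univ, true_and]
        omega
      · intro p hp
        have hb : -(N : ℤ) ≤ partitionRank p := by
          rcases Nat.eq_zero_or_pos n with rfl | h0
          · rw [partitionRank_of_zero]; omega
          · have := partitionRank_lt h0 p; omega
        have := (Finset.mem_filter.1 hp).2
        congr 1
        omega
    · intro p _
      rw [Finset.mem_range]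
      rcases Nat.eq_zero_or_pos n with rfl | h0
      · rw [partitionRank_of_zero]; omega
      · have := partitionRank_lt h0 p; omega
  rw [h2]
  push_cast
  rw [sub_self, mul_zero]

lemma C_dvd_heatOp_sub {a : ℕ} {F G : ℚ⟦X⟧⟦X⟧} (h : C (X ^ a) ∣ F - G) :
    C (X ^ a) ∣ heatOp F - heatOp G := by
  have h1 : C (X ^ a) ∣ qDerivU (F - G) := by
    rw [C_dvd_iff] at h ⊢
    intro k
    rw [coeff_qDerivU]
    exact X_pow_dvd_qDeriv (h k)
  have h2 := C_dvd_uDeriv h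
  have h3 := C_dvd_uDeriv h2
  have h4 : heatOp F - heatOp G = (1 - expU 1) ^ 2 * (6 * qDerivU (F - G) +
      uDeriv (uDeriv (F - G)) + uDeriv (F - G)) +
      2 * expU 1 * (1 - expU 1) * uDeriv (F - G) + 2 * expU 1 * (F - G) := by
    simp only [map_sub, heatOp]
    ring
  rw [h4]
  exact dvd_add (dvd_add (Dvd.dvd.mul_left (dvd_add (dvd_add (Dvd.dvd.mul_left h1 _) h3) h2) _)
    (Dvd.dvd.mul_left h2 _)) (Dvd.dvd.mul_left h _)

/-- The substitution `z = exp u`. -/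
noncomputable def polyExp : Polynomial ℚ⟦X⟧ →+* ℚ⟦X⟧⟦X⟧ :=
  Polynomial.eval₂RingHom (C : ℚ⟦X⟧ →+* ℚ⟦X⟧⟦X⟧) (expU 1)

lemma polyExp_C (a : ℚ⟦X⟧) : polyExp (Polynomial.C a) = C a := by simp [polyExp]

lemma polyExp_X : polyExp Polynomial.X = expU 1 := by simp [polyExp]

lemma polyExp_truncPoly (N : ℕ) (y : ℤ → ℚ⟦X⟧) : polyExp (truncPoly N y) * expU (-N) =
    ∑ i ∈ Finset.range (2 * N + 1), C (y (i - N)) * expU (i - N) := by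
  rw [truncPoly, map_sum, Finset.sum_mul]
  refine Finset.sum_congr rfl fun i _ => ?_
  rw [map_mul, polyExp_C, map_pow, polyExp_X, ← expU_natCast, mul_assoc, ← expU_add, sub_eq_add_neg]

lemma polyExp_rankHeatPoly (N : ℕ) :
    polyExp (rankHeatPoly N) * expU (-N) = heatOp (rankGenTrunc N) := by
  have h1 : uDeriv (rankGenTrunc N) = polyExp (truncPoly N fun m => (m : ℚ⟦X⟧) * rankSeries m) *
      expU (-N) := by
    rw [polyExp_truncPoly, rankGenTrunc, map_sum]
    refine Finset.sum_congr rfl fun i _ => ?_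
    rw [uDeriv_C_mul, uDeriv_expU, map_mul]
    ring
  have h2 : 6 * qDerivU (rankGenTrunc N) + uDeriv (uDeriv (rankGenTrunc N)) +
      uDeriv (rankGenTrunc N) = polyExp (truncPoly N fun m => 6 * qDeriv (rankSeries m) +
        ((m ^ 2 + m : ℤ) : ℚ⟦X⟧) * rankSeries m) * expU (-N) := by
    rw [h1, polyExp_truncPoly, polyExp_truncPoly, map_sum, rankGenTrunc, map_sum, Finset.mul_sum,
      ← Finset.sum_add_distrib, ← Finset.sum_add_distrib]
    refine Finset.sum_congr rfl fun i _ => ?_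
    rw [qDerivU_C_mul_expU, uDeriv_C_mul, uDeriv_expU]
    simp only [map_mul, map_add, map_intCast, map_pow, map_ofNat, Int.cast_add, Int.cast_pow]
    ring
  have h3 : rankGenTrunc N = polyExp (truncPoly N rankSeries) * expU (-N) := by
    rw [polyExp_truncPoly, rankGenTrunc]
  rw [heatOp, h2, h1]
  conv_rhs => rw [h3]
  simp only [rankHeatPoly, map_add, map_mul, map_sub, map_one, map_pow, polyExp_X, map_ofNat]
  ring

/-- The truncated crank product `∏_{n = 1}^{N} (1 - z q ^ n) (1 - z⁻¹ q ^ n)` at `z = exp u`. -/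
noncomputable def crankU (N : ℕ) : ℚ⟦X⟧⟦X⟧ :=
  ∏ n ∈ Finset.range N, ((1 - C (X ^ (n + 1)) * expU 1) * (1 - C (X ^ (n + 1)) * expU (-1)))

lemma polyExp_crankPoly (N : ℕ) : polyExp (crankPoly N) * expU (-N) = crankU N := by
  have h : expU (-N) = ∏ n ∈ Finset.range N, expU (-1) := by
    induction N with
    | zero => simp [expU_zero]
    | succ N ih =>
      rw [Finset.prod_range_succ, ← ih, ← expU_add]
      congr 1
      push_cast
      ring
  rw [crankPoly, map_prod, h, ← Finset.prod_mul_distrib, crankU]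
  refine Finset.prod_congr rfl fun n _ => ?_
  have h1 : expU 1 * expU (-1) = 1 := by
    rw [← expU_add]
    exact expU_zero
  simp only [map_mul, map_sub, map_one, polyExp_X, polyExp_C]
  linear_combination (1 - C (X ^ (n + 1)) * expU 1) * h1

lemma isUnit_crankU (N : ℕ) : IsUnit (crankU N) := by
  rw [isUnit_iff_constantCoeff, isUnit_iff_constantCoeff, crankU, map_prod, map_prod]
  simp [constantCoeff_expU]

/-- A truncation of the logarithmic derivative of the crank product with respect to `u`. -/
noncomputable def crankLogDeriv (N : ℕ) : ℚ⟦X⟧⟦X⟧ :=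
  ∑ n ∈ Finset.range N, ∑ e ∈ Finset.range N,
    ((C (X ^ (n + 1)) * expU (-1)) ^ (e + 1) - (C (X ^ (n + 1)) * expU 1) ^ (e + 1))

lemma C_dvd_uDeriv_mul_sub {a : ℚ⟦X⟧} {F G Λ M : ℚ⟦X⟧⟦X⟧} (hF : C a ∣ uDeriv F - F * Λ)
    (hG : C a ∣ uDeriv G - G * M) : C a ∣ uDeriv (F * G) - F * G * (Λ + M) := by
  have h : uDeriv (F * G) - F * G * (Λ + M) =
      G * (uDeriv F - F * Λ) + F * (uDeriv G - G * M) := by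
    rw [uDeriv_mul]
    ring
  rw [h]
  exact dvd_add (Dvd.dvd.mul_left hF _) (Dvd.dvd.mul_left hG _)

lemma C_dvd_uDeriv_one_sub (N n : ℕ) (j : ℤ) :
    C (X ^ N) ∣ uDeriv (1 - C (X ^ (n + 1)) * expU j) - (1 - C (X ^ (n + 1)) * expU j) *
      (- C (j : ℚ⟦X⟧) * ∑ e ∈ Finset.range N, (C (X ^ (n + 1)) * expU j) ^ (e + 1)) := by
  have h1 : uDeriv (1 - C (X ^ (n + 1)) * expU j) =
      - C (j : ℚ⟦X⟧) * (C (X ^ (n + 1)) * expU j) := by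
    rw [map_sub, uDeriv_one, uDeriv_C_mul, uDeriv_expU]
    ring
  have h2 := mul_neg_geom_sum (C (X ^ (n + 1)) * expU j) N
  simp only [pow_succ _ _, ← Finset.sum_mul] at h2 ⊢
  have h3 : C (X ^ N) ∣ (C (X ^ n * X) * expU j) ^ N := by
    rw [mul_pow, ← map_pow, mul_pow, map_mul, mul_assoc]
    exact Dvd.dvd.mul_left (dvd_mul_right _ _) _
  rw [pow_succ] at h1
  rw [h1]
  convert Dvd.dvd.mul_left h3 (- C (j : ℚ⟦X⟧) * (C (X ^ n * X) * expU j)) using 1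
  linear_combination C (j : ℚ⟦X⟧) * (C (X ^ n * X) * expU j) * h2

/-- Modulo `q ^ N`, the series `crankLogDeriv N` is the logarithmic derivative of `crankU N`. -/
lemma C_dvd_uDeriv_crankU (N : ℕ) :
    C (X ^ N) ∣ uDeriv (crankU N) - crankU N * crankLogDeriv N := by
  have key : ∀ K, C (X ^ N) ∣ uDeriv (∏ n ∈ Finset.range K, ((1 - C (X ^ (n + 1)) * expU 1) *
      (1 - C (X ^ (n + 1)) * expU (-1)))) - (∏ n ∈ Finset.range K,
        ((1 - C (X ^ (n + 1)) * expU 1) * (1 - C (X ^ (n + 1)) * expU (-1)))) *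
      ∑ n ∈ Finset.range K, ∑ e ∈ Finset.range N,
        ((C (X ^ (n + 1)) * expU (-1)) ^ (e + 1) - (C (X ^ (n + 1)) * expU 1) ^ (e + 1)) := by
    intro K
    induction K with
    | zero => simp
    | succ K ih =>
      rw [Finset.prod_range_succ, Finset.sum_range_succ]
      refine C_dvd_uDeriv_mul_sub ih ?_
      have h := C_dvd_uDeriv_mul_sub (C_dvd_uDeriv_one_sub N K 1) (C_dvd_uDeriv_one_sub N K (-1))
      convert h using 3
      simp only [Finset.sum_sub_distrib]
      push_cast
      simp only [map_neg, map_one]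
      ring
  exact key N

/-- The generating series `∑ σ_k(n) q ^ n` of the divisor sums. -/
noncomputable def sigmaSeries (k : ℕ) : ℚ⟦X⟧ :=
  PowerSeries.mk fun n => (ArithmeticFunction.sigma k n : ℚ)

/-- The series `∑ sigmaSeries k u ^ k / k!`, the sum being over the odd `k`. -/
noncomputable def sigmaGen : ℚ⟦X⟧⟦X⟧ :=
  PowerSeries.mk fun k => if Odd k then C (1 / (k.factorial : ℚ)) * sigmaSeries k else 0

/-- Expanding the geometric sums in `crankLogDeriv N` in powers of `u` produces divisor sums. -/
lemma C_dvd_crankLogDeriv_add (N : ℕ) : C (X ^ N) ∣ crankLogDeriv N + 2 * sigmaGen := by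
  rw [C_dvd_iff]
  intro k
  rw [X_pow_dvd_iff]
  intro m hm
  have h1 : ∀ (n e : ℕ) (j : ℤ), coeff m (coeff k ((C (X ^ (n + 1)) * expU j) ^ (e + 1))) =
      if (n + 1) * (e + 1) = m then ((j : ℚ) ^ k) * (1 / (k.factorial : ℚ)) * ((e + 1 : ℕ) : ℚ) ^ k
      else 0 := by
    intro n e j
    have h2 : expU j ^ (e + 1) = expU (j * (e + 1 : ℕ)) := by
      induction e with
      | zero => simp
      | succ e ih =>
        rw [pow_succ, ih, ← expU_add]
        congr 1
        push_cast
        ring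
    rw [mul_pow, h2, ← map_pow, coeff_C_mul, coeff_expU, ← pow_mul]
    have h3 : (((j * (e + 1 : ℕ) : ℤ) : ℚ⟦X⟧) ^ k * C (1 / (k.factorial : ℚ))) =
        C ((j : ℚ) ^ k * (1 / (k.factorial : ℚ)) * ((e + 1 : ℕ) : ℚ) ^ k) := by
      simp only [map_mul, map_pow, map_intCast, map_natCast]
      push_cast
      rw [mul_pow]
      ring
    rw [h3, mul_comm, coeff_C_mul, coeff_X_pow]
    simp only [eq_comm (a := m)]
    split_ifs <;> simp
  have h2 : ∑ n ∈ Finset.range N, ∑ e ∈ Finset.range N,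
      (if (n + 1) * (e + 1) = m then ((e + 1 : ℕ) : ℚ) ^ k else 0) =
      (ArithmeticFunction.sigma k m : ℚ) := by
    rw [ArithmeticFunction.sigma_apply, ← Finset.sum_product', ← Finset.sum_filter]
    push_cast
    rcases Nat.eq_zero_or_pos m with rfl | hm0
    · simp
    refine Finset.sum_nbij' (fun p => p.2 + 1) (fun d => (m / d - 1, d - 1)) ?_ ?_ ?_ ?_ ?_
    · rintro ⟨n, e⟩ h
      simp only [Finset.mem_filter] at h
      exact Nat.mem_divisors.2 ⟨⟨n + 1, by rw [← h.2]; ring⟩, hm0.ne'⟩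
    · intro d hd
      have hd1 := Nat.pos_of_mem_divisors hd
      have hd2 := Nat.divisor_le hd
      have hd3 := Nat.mul_div_cancel' (Nat.dvd_of_mem_divisors hd)
      have hd4 : m / d ≤ m := Nat.div_le_self _ _
      have hd5 : 0 < m / d := Nat.div_pos hd2 hd1
      simp only [Finset.mem_filter, Finset.mem_product, Finset.mem_range]
      refine ⟨⟨by omega, by omega⟩, ?_⟩
      rw [Nat.sub_add_cancel hd5, Nat.sub_add_cancel hd1, mul_comm]
      exact hd3
    · rintro ⟨n, e⟩ h
      simp only [Finset.mem_filter] at h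
      rw [← h.2]
      simp
    · intro d hd
      exact Nat.sub_add_cancel (Nat.pos_of_mem_divisors hd)
    · rintro ⟨n, e⟩ h
      simp
  have h3 : coeff m (coeff k (crankLogDeriv N)) = (((-1 : ℤ) : ℚ) ^ k - 1) *
      (1 / (k.factorial : ℚ)) * ArithmeticFunction.sigma k m := by
    rw [← h2, crankLogDeriv]
    simp only [map_sum, map_sub, h1, Finset.mul_sum]
    refine Finset.sum_congr rfl fun n _ => Finset.sum_congr rfl fun e _ => ?_
    split_ifs
    · push_cast
      ring
    · simp
  have h4 : (2 : ℚ⟦X⟧⟦X⟧) = C (C (2 : ℚ)) := by simp only [map_ofNat]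
  rw [map_add, map_add, h3, h4, coeff_C_mul, coeff_C_mul, sigmaGen, coeff_mk]
  split_ifs with hk
  · rw [coeff_C_mul, sigmaSeries, coeff_mk]
    push_cast
    rw [hk.neg_one_pow]
    ring
  · rw [Nat.not_odd_iff_even] at hk
    push_cast
    rw [hk.neg_one_pow]
    simp

/-- **The rank-crank differential equation** of Atkin and Garvan, as an ordinary differential
equation in `u`. -/
theorem uDeriv_heatOp_rankGen :
    uDeriv (heatOp rankGen) = (1 + 6 * sigmaGen) * heatOp rankGen := by
  rw [← sub_eq_zero]
  -- it suffices to prove the divisibility by all powers of `q`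
  suffices h : ∀ N, 1 ≤ N → C (X ^ N) ∣
      uDeriv (heatOp rankGen) - (1 + 6 * sigmaGen) * heatOp rankGen by
    ext k n
    exact X_pow_dvd_iff.1 (C_dvd_iff.1 (h (n + 1) (by omega)) k) n (by omega)
  intro N hN
  obtain ⟨d, hd⟩ := crankPoly_cube_mul_rankHeatPoly hN
  have h1 := map_dvd polyExp hd
  rw [polyExp_C, map_sub, map_mul, map_mul, map_pow _ (crankPoly N), map_pow _ Polynomial.X,
    polyExp_X, polyExp_C] at h1
  set H := heatOp (rankGenTrunc N) with hH
  set K := crankU N with hK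
  have hone : ∀ m : ℤ, expU m * expU (-m) = 1 := fun m => by
    rw [← expU_add, add_neg_cancel, expU_zero]
  have h2 : C (X ^ N) ∣ K ^ 3 * H - C d * expU 1 := by
    have h := Dvd.dvd.mul_left h1 (expU (-N) ^ 4)
    convert h using 1
    rw [hK, hH, ← polyExp_crankPoly, ← polyExp_rankHeatPoly, pow_succ (expU 1), pow_mul',
      ← expU_natCast]
    have h4 : (expU N ^ 4) * expU (-N) ^ 4 = 1 := by rw [← mul_pow, hone, one_pow]
    linear_combination (C d * expU 1) * h4
  have h3 := C_dvd_uDeriv h2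
  have h4 := C_dvd_uDeriv_crankU N
  rw [← hK] at h4
  have h5 : C (X ^ N) ∣ K ^ 3 * (uDeriv H + 3 * crankLogDeriv N * H - H) := by
    have e : uDeriv (K ^ 3 * H - C d * expU 1) = 3 * K ^ 2 * uDeriv K * H + K ^ 3 * uDeriv H -
        C d * expU 1 := by
      rw [map_sub, pow_succ, pow_two, uDeriv_mul, uDeriv_mul, uDeriv_mul, uDeriv_C_mul, uDeriv_expU,
        Int.cast_one, map_one]
      ring
    rw [e] at h3
    have h6 := dvd_sub (dvd_sub h3 h2) (Dvd.dvd.mul_left h4 (3 * K ^ 2 * H))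
    convert h6 using 1
    ring
  have h6 := (((isUnit_crankU N).pow 3).dvd_mul_left).1 h5
  have h7 := C_dvd_heatOp_sub (C_dvd_rankGen_sub N)
  rw [← hH] at h7
  have h8 := C_dvd_crankLogDeriv_add N
  have h9 := dvd_add (dvd_sub (dvd_add h6 (C_dvd_uDeriv h7)) (Dvd.dvd.mul_left h8 (3 * H)))
    (Dvd.dvd.mul_left h7 (-(1 + 6 * sigmaGen)))
  convert h9 using 1
  rw [map_sub]
  ring

end RankODE

/-! ### A recursion for the even rank moments -/

section RankRecursion

open PowerSeries

/-- The series `2 sinh (u / 2) = exp (u / 2) - exp (- u / 2)`. -/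
noncomputable def sinhSeries : ℚ⟦X⟧ := rescale (1 / 2 : ℚ) (exp ℚ) - rescale (-1 / 2 : ℚ) (exp ℚ)

/-- The series `cosh (u / 2)`. -/
noncomputable def coshSeries : ℚ⟦X⟧ :=
  C (1 / 2 : ℚ) * (rescale (1 / 2 : ℚ) (exp ℚ) + rescale (-1 / 2 : ℚ) (exp ℚ))

/-- The series `2 sinh (u / 2) / u`. -/
noncomputable def sinhcSeries : ℚ⟦X⟧ :=
  PowerSeries.mk fun k => if Even k then 1 / (2 ^ k * ((k + 1).factorial : ℚ)) else 0

lemma derivative_rescale_exp (a : ℚ) :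
    PowerSeries.derivative ℚ (rescale a (exp ℚ)) = C a * rescale a (exp ℚ) := by
  ext k
  rw [PowerSeries.coeff_derivative, coeff_C_mul, coeff_rescale, coeff_rescale, coeff_exp, coeff_exp,
    Nat.factorial_succ]
  have := Nat.factorial_ne_zero k
  simp only [Algebra.algebraMap_self, RingHom.id_apply]
  push_cast
  field_simp
  ring

lemma two_mul_C_half : (2 : ℚ⟦X⟧) * C (1 / 2 : ℚ) = 1 := by
  have h : (2 : ℚ⟦X⟧) = C (2 : ℚ) := by simp only [map_ofNat]
  rw [h, ← map_mul]
  norm_num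

lemma rescale_exp_mul (a b : ℚ) :
    rescale a (exp ℚ) * rescale b (exp ℚ) = rescale (a + b) (exp ℚ) :=
  exp_mul_exp_eq_exp_add a b

lemma X_mul_sinhcSeries : X * sinhcSeries = sinhSeries := by
  ext k
  rcases k with _ | k
  · rw [coeff_zero_X_mul, sinhSeries, map_sub, coeff_rescale, coeff_rescale]
    simp
  · rw [coeff_succ_X_mul, sinhcSeries, sinhSeries, coeff_mk, map_sub, coeff_rescale, coeff_rescale,
      coeff_exp]
    simp only [Algebra.algebraMap_self, RingHom.id_apply]
    have := Nat.factorial_ne_zero (k + 1)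
    rw [neg_div, neg_pow, pow_succ (-1 : ℚ)]
    split_ifs with h
    · rw [h.neg_one_pow, div_pow, one_pow, pow_succ]
      field_simp
      ring
    · rw [(Nat.not_even_iff_odd.1 h).neg_one_pow]
      ring

lemma derivative_sinhSeries : PowerSeries.derivative ℚ sinhSeries = coshSeries := by
  rw [sinhSeries, map_sub, derivative_rescale_exp, derivative_rescale_exp, coshSeries, neg_div,
    map_neg]
  ring

lemma derivative_coshSeries :
    PowerSeries.derivative ℚ coshSeries = C (1 / 4 : ℚ) * sinhSeries := by
  have h : (C (1 / 4 : ℚ) : ℚ⟦X⟧) = C (1 / 2) * C (1 / 2) := by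
    rw [← map_mul]; norm_num
  rw [coshSeries, ← smul_eq_C_mul, Derivation.map_smul, map_add, derivative_rescale_exp,
    derivative_rescale_exp, sinhSeries, neg_div, map_neg, h, smul_eq_C_mul]
  ring

lemma coshSeries_sq : coshSeries ^ 2 = 1 + C (1 / 4 : ℚ) * sinhSeries ^ 2 := by
  have h : (C (1 / 4 : ℚ) : ℚ⟦X⟧) = C (1 / 2) * C (1 / 2) := by
    rw [← map_mul]; norm_num
  have h1 := rescale_exp_mul (1 / 2) (-1 / 2)
  have h2 : (rescale ((1 / 2 : ℚ) + -1 / 2) (exp ℚ)) = 1 := by norm_num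
  have h3 : (4 : ℚ⟦X⟧) * (C (1 / 2) * C (1 / 2)) = 1 := by
    rw [← h, show (4 : ℚ⟦X⟧) = C (4 : ℚ) by simp only [map_ofNat], ← map_mul]; norm_num
  rw [h2] at h1
  rw [coshSeries, sinhSeries, h]
  linear_combination (4 : ℚ⟦X⟧) * (C (1 / 2) * C (1 / 2)) * h1 + h3

lemma bernoulliPowerSeries_mul_sinhSeries :
    X * coshSeries = (bernoulliPowerSeries ℚ + C (1 / 2 : ℚ) * X) * sinhSeries := by
  have h := bernoulliPowerSeries_mul_exp_sub_one ℚ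
  have h1 := rescale_exp_mul (1 / 2) (-1 / 2)
  have h2 : (rescale ((1 / 2 : ℚ) + -1 / 2) (exp ℚ)) = 1 := by norm_num
  have h3 : exp ℚ = rescale (1 / 2 : ℚ) (exp ℚ) * rescale (1 / 2 : ℚ) (exp ℚ) := by
    rw [rescale_exp_mul]; norm_num
  have h4 := two_mul_C_half
  rw [h2] at h1
  rw [h3] at h
  rw [coshSeries, sinhSeries]
  linear_combination (- rescale (-1 / 2 : ℚ) (exp ℚ)) * h + bernoulliPowerSeries ℚ *
    rescale (1 / 2 : ℚ) (exp ℚ) * h1 + X * rescale (-1 / 2 : ℚ) (exp ℚ) * h4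

/-- The operator `u d/du` applied to the logarithm of `2 sinh (u / 2) / u`; its coefficients are the
Bernoulli numbers of even index. -/
noncomputable def bernoulliEvenSeries : ℚ⟦X⟧ := bernoulliPowerSeries ℚ - 1 + C (1 / 2 : ℚ) * X

lemma coshSeries_eq :
    coshSeries = sinhcSeries + X * PowerSeries.derivative ℚ sinhcSeries := by
  rw [← derivative_sinhSeries, ← X_mul_sinhcSeries, derivative_mul_eq, PowerSeries.derivative_X]
  ring

lemma X_mul_derivative_sinhcSeries :
    X * PowerSeries.derivative ℚ sinhcSeries = bernoulliEvenSeries * sinhcSeries := by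
  have h := bernoulliPowerSeries_mul_sinhSeries
  rw [coshSeries_eq, ← X_mul_sinhcSeries] at h
  refine mul_left_cancel₀ (X_ne_zero (R := ℚ)) ?_
  rw [bernoulliEvenSeries]
  linear_combination h

lemma coeff_bernoulliEvenSeries_of_odd {k : ℕ} (hk : Odd k) : coeff k bernoulliEvenSeries = 0 := by
  rw [bernoulliEvenSeries, map_add, map_sub, coeff_C_mul, coeff_X, coeff_one, bernoulliPowerSeries,
    coeff_mk]
  by_cases h1 : k = 1
  · subst h1
    simp [bernoulli_one]
    norm_num
  · rw [bernoulli_eq_zero_of_odd hk (by rcases hk with ⟨j, rfl⟩; omega), if_neg h1,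
      if_neg (by rcases hk with ⟨j, rfl⟩; omega)]
    simp

lemma coeff_bernoulliEvenSeries {k : ℕ} (hk : 2 ≤ k) :
    coeff k bernoulliEvenSeries = bernoulli k / k.factorial := by
  rw [bernoulliEvenSeries, map_add, map_sub, coeff_C_mul, coeff_X, coeff_one, bernoulliPowerSeries,
    coeff_mk, if_neg (by omega), if_neg (by omega)]
  simp

lemma coeff_zero_bernoulliEvenSeries : coeff 0 bernoulliEvenSeries = 0 := by
  rw [bernoulliEvenSeries, map_add, map_sub, coeff_C_mul, coeff_X, coeff_one, bernoulliPowerSeries,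
    coeff_mk]
  simp

lemma constantCoeff_sinhcSeries : constantCoeff sinhcSeries = 1 := by
  rw [← coeff_zero_eq_constantCoeff_apply, sinhcSeries, coeff_mk]
  simp

/-- The inclusion of the series in `u` with constant coefficients. -/
noncomputable abbrev constU : ℚ⟦X⟧ →+* ℚ⟦X⟧⟦X⟧ := PowerSeries.map (C : ℚ →+* ℚ⟦X⟧)

lemma uDeriv_constU (f : ℚ⟦X⟧) : uDeriv (constU f) = constU (PowerSeries.derivative ℚ f) := by
  ext1 k
  rw [PowerSeries.coeff_derivative, coeff_map, coeff_map, PowerSeries.coeff_derivative]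
  simp

lemma qDerivU_constU_mul (f : ℚ⟦X⟧) (F : ℚ⟦X⟧⟦X⟧) :
    qDerivU (constU f * F) = constU f * qDerivU F := by
  ext1 k
  rw [coeff_qDerivU, coeff_mul, coeff_mul, map_sum]
  refine Finset.sum_congr rfl fun p _ => ?_
  rw [coeff_map, ← smul_eq_C_mul, Derivation.map_smul, smul_eq_C_mul, coeff_qDerivU]

lemma expU_one_eq : expU 1 = constU (exp ℚ) := by
  rw [expU, Int.cast_one, rescale_one, constU, map_exp]
  rfl

lemma expU_sq_sub : constU sinhSeries ^ 2 = expU 1 - 2 + expU (-1) := by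
  have h : expU (-1) = constU (rescale (-1 : ℚ) (exp ℚ)) := by
    ext1 k
    rw [coeff_expU, coeff_map, coeff_rescale, coeff_exp]
    simp
  have h1 := rescale_exp_mul (1 / 2) (-1 / 2)
  have h2 : (rescale ((1 / 2 : ℚ) + -1 / 2) (exp ℚ)) = 1 := by norm_num
  have h3 : rescale (1 / 2 : ℚ) (exp ℚ) * rescale (1 / 2 : ℚ) (exp ℚ) = exp ℚ := by
    rw [rescale_exp_mul]; norm_num
  have h4 : rescale (-1 / 2 : ℚ) (exp ℚ) * rescale (-1 / 2 : ℚ) (exp ℚ) =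
      rescale (-1 : ℚ) (exp ℚ) := by
    rw [rescale_exp_mul]; norm_num
  rw [h2] at h1
  have h5 : sinhSeries ^ 2 = exp ℚ - 2 + rescale (-1 : ℚ) (exp ℚ) := by
    rw [sinhSeries]
    linear_combination h3 + h4 - 2 * h1
  rw [← map_pow, h5, h, expU_one_eq, map_add, map_sub, map_ofNat]

lemma expU_sub : 2 * constU sinhSeries * constU coshSeries = expU 1 - expU (-1) := by
  have h : expU (-1) = constU (rescale (-1 : ℚ) (exp ℚ)) := by
    ext1 k
    rw [coeff_expU, coeff_map, coeff_rescale, coeff_exp]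
    simp
  have h3 : rescale (1 / 2 : ℚ) (exp ℚ) * rescale (1 / 2 : ℚ) (exp ℚ) = exp ℚ := by
    rw [rescale_exp_mul]; norm_num
  have h4 : rescale (-1 / 2 : ℚ) (exp ℚ) * rescale (-1 / 2 : ℚ) (exp ℚ) =
      rescale (-1 : ℚ) (exp ℚ) := by
    rw [rescale_exp_mul]; norm_num
  have h6 := two_mul_C_half
  have h5 : 2 * sinhSeries * coshSeries = exp ℚ - rescale (-1 : ℚ) (exp ℚ) := by
    rw [sinhSeries, coshSeries]
    linear_combination h3 - h4 + (rescale (1 / 2 : ℚ) (exp ℚ) * rescale (1 / 2 : ℚ) (exp ℚ) -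
      rescale (-1 / 2 : ℚ) (exp ℚ) * rescale (-1 / 2 : ℚ) (exp ℚ)) * h6
  rw [h, expU_one_eq, ← map_sub, ← h5, map_mul, map_mul, map_ofNat]

/-- The quotient of the rank generating function by `2 sinh (u / 2) / u`. -/
noncomputable def rankSigmaGen : ℚ⟦X⟧⟦X⟧ := constU sinhcSeries⁻¹ * rankGen

lemma constU_sinhcSeries_mul_inv : constU sinhcSeries * constU sinhcSeries⁻¹ = 1 := by
  rw [← map_mul, PowerSeries.mul_inv_cancel _ (by rw [constantCoeff_sinhcSeries]; exact one_ne_zero),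
    map_one]

lemma rankGen_eq : rankGen = constU sinhcSeries * rankSigmaGen := by
  rw [rankSigmaGen, ← mul_assoc, constU_sinhcSeries_mul_inv, one_mul]

/-- The heat operator in terms of `rankSigmaGen`. -/
lemma heatOp_rankGen_mul :
    heatOp rankGen * expU (-1) = constU sinhcSeries ^ 3 *
      (X ^ 2 * (6 * qDerivU rankSigmaGen - C (C (1 / 4 : ℚ)) * rankSigmaGen) +
        X ^ 2 * uDeriv (uDeriv rankSigmaGen) - 2 * X * uDeriv rankSigmaGen + 2 * rankSigmaGen) := by
  set S := constU sinhcSeries with hS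
  set ρ := rankSigmaGen with hρ
  have hone : expU 1 * expU (-1) = 1 := by rw [← expU_add]; exact expU_zero
  have hs : constU sinhSeries = X * S := by rw [← X_mul_sinhcSeries, map_mul, map_X]
  have hc : constU coshSeries = S + X * uDeriv S := by
    rw [coshSeries_eq, map_add, map_mul, map_X, ← uDeriv_constU]
  have h1 : uDeriv (constU coshSeries) = C (C (1 / 4 : ℚ)) * (X * S) := by
    rw [uDeriv_constU, derivative_coshSeries, map_mul, map_C, hs]
  have h2 : constU coshSeries ^ 2 = 1 + C (C (1 / 4 : ℚ)) * (X * S) ^ 2 := by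
    rw [← map_pow, coshSeries_sq, map_add, map_one, map_mul, map_pow, map_C, hs]
  have h3 := expU_sq_sub
  have h4 := expU_sub
  rw [hs] at h3 h4
  rw [hc, map_add, uDeriv_mul, PowerSeries.derivative_X] at h1
  rw [hc] at h2 h4
  have hR : rankGen = S * ρ := rankGen_eq
  have hV : heatOp rankGen * expU (-1) = (X * S) ^ 2 * (6 * qDerivU rankGen +
      uDeriv (uDeriv rankGen)) - 2 * (X * S) * (S + X * uDeriv S) * uDeriv rankGen +
      2 * rankGen := by
    rw [h3, h4, heatOp]
    linear_combination ((expU 1 - 2) * (6 * qDerivU rankGen + uDeriv (uDeriv rankGen) +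
      uDeriv rankGen) + 2 * (1 - expU 1) * uDeriv rankGen + 2 * rankGen) * hone
  rw [hV, hR, hS, qDerivU_constU_mul, ← hS, uDeriv_mul, map_add, uDeriv_mul, uDeriv_mul]
  linear_combination X * S ^ 2 * ρ * h1 - 2 * S * ρ * h2

/-- The coefficients of `rankSigmaGen` at the even powers of `u`. -/
noncomputable def rankSigma (j : ℕ) : ℚ⟦X⟧ := coeff (2 * j) rankSigmaGen

lemma constantCoeff_partitionSeries : constantCoeff partitionSeries = 1 := by
  rw [← coeff_zero_eq_constantCoeff_apply, partitionSeries, coeff_mk]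
  simp

/-- The solution of the rank-crank differential equation, normalized to have constant term `1` in
`u` and divided by the cube of `2 sinh (u / 2) / u`. -/
noncomputable def quasiGen : ℚ⟦X⟧⟦X⟧ :=
  C (C (1 / 2 : ℚ) * partitionSeries⁻¹) * (heatOp rankGen * expU (-1)) * constU sinhcSeries⁻¹ ^ 3

/-- The coefficients of `quasiGen` at the even powers of `u`: they are polynomials in the
Eisenstein series. -/
noncomputable def quasiCoeff (j : ℕ) : ℚ⟦X⟧ := coeff (2 * j) quasiGen

lemma two_mul_partitionSeries_mul_quasiGen : C (2 * partitionSeries) * quasiGen =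
      X ^ 2 * (6 * qDerivU rankSigmaGen - C (C (1 / 4 : ℚ)) * rankSigmaGen) +
        X ^ 2 * uDeriv (uDeriv rankSigmaGen) - 2 * X * uDeriv rankSigmaGen + 2 * rankSigmaGen := by
  have h1 : C (2 * partitionSeries) * C (C (1 / 2 : ℚ) * partitionSeries⁻¹) =
      (1 : ℚ⟦X⟧⟦X⟧) := by
    rw [← map_mul]
    have h2 : partitionSeries * partitionSeries⁻¹ = 1 :=
      PowerSeries.mul_inv_cancel _ (by rw [constantCoeff_partitionSeries]; exact one_ne_zero)
    have h6 := two_mul_C_half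
    have h3 : 2 * partitionSeries * (C (1 / 2 : ℚ) * partitionSeries⁻¹) = 1 := by
      linear_combination (2 * C (1 / 2 : ℚ)) * h2 + h6
    rw [h3, map_one]
  rw [quasiGen, heatOp_rankGen_mul]
  set Y := X ^ 2 * (6 * qDerivU rankSigmaGen - C (C (1 / 4 : ℚ)) * rankSigmaGen) +
        X ^ 2 * uDeriv (uDeriv rankSigmaGen) - 2 * X * uDeriv rankSigmaGen + 2 * rankSigmaGen
  have h4 := congrArg (· ^ 3) constU_sinhcSeries_mul_inv
  simp only [mul_pow, one_pow] at h4
  linear_combination (Y * constU sinhcSeries ^ 3 * constU sinhcSeries⁻¹ ^ 3) * h1 + Y * h4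

/-- The operator `q d/dq - 1 / 24`, which is `q d/dq` up to the factor `q ^ (-1 / 24)`. -/
noncomputable def qDerivShift (f : ℚ⟦X⟧) : ℚ⟦X⟧ := qDeriv f - C (1 / 24 : ℚ) * f

/-- The recursion expressing the coefficients `rankSigma` by Eisenstein series. -/
theorem rankSigma_succ (j : ℕ) :
    C ((2 * j + 1) * (2 * j) : ℚ) * rankSigma (j + 1) + 6 * qDerivShift (rankSigma j) =
      2 * partitionSeries * quasiCoeff (j + 1) := by
  have h := congrArg (coeff (2 * (j + 1))) two_mul_partitionSeries_mul_quasiGen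
  have e6 : (6 : ℚ⟦X⟧⟦X⟧) = C (C (6 : ℚ)) := by simp only [map_ofNat]
  have e2 : (2 : ℚ⟦X⟧⟦X⟧) = C (C (2 : ℚ)) := by simp only [map_ofNat]
  rw [coeff_C_mul, map_add, map_sub, map_add, e6, e2, mul_assoc (C (C (2 : ℚ))),
    show 2 * (j + 1) = 2 * j + 2 by ring, coeff_X_pow_mul, coeff_X_pow_mul, coeff_C_mul,
    coeff_C_mul, coeff_succ_X_mul, map_sub, coeff_C_mul, coeff_C_mul, coeff_qDerivU,
    PowerSeries.coeff_derivative, PowerSeries.coeff_derivative] at h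
  change 2 * partitionSeries * quasiCoeff (j + 1) = _ at h
  have h2 : coeff (2 * j) rankSigmaGen = rankSigma j := rfl
  have h3 : coeff (2 * j + 1 + 1) rankSigmaGen = rankSigma (j + 1) := rfl
  rw [h2, h3] at h
  rw [h, qDerivShift]
  have e3 : (C (1 / 4 : ℚ) : ℚ⟦X⟧) = 6 * C (1 / 24 : ℚ) := by
    rw [show (6 : ℚ⟦X⟧) = C (6 : ℚ) by simp only [map_ofNat], ← map_mul]; norm_num
  rw [e3]
  simp only [map_mul, map_add, map_one, map_ofNat, map_natCast]
  push_cast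
  ring

lemma sum_antidiagonal_two_mul {A : Type*} [CommRing A] {f : ℕ → A} (g : ℕ → A) (k : ℕ)
    (hf : ∀ i, Odd i → f i = 0) :
    ∑ p ∈ Finset.HasAntidiagonal.antidiagonal (2 * k), f p.1 * g p.2 =
      ∑ i ∈ Finset.range (k + 1), f (2 * i) * g (2 * (k - i)) := by
  rw [Finset.Nat.sum_antidiagonal_eq_sum_range_succ (fun a b => f a * g b)]
  symm
  refine Finset.sum_of_injOn (fun i => 2 * i) ?_ ?_ ?_ ?_
  · intro a _ b _ h
    simpa using h
  · intro i hi
    simp only [Finset.coe_range, Set.mem_Iio] at hi ⊢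
    omega
  · intro i hi h
    rw [hf i, zero_mul]
    by_contra h1
    rw [Nat.not_odd_iff_even] at h1
    obtain ⟨a, rfl⟩ := h1
    refine h ⟨a, ?_, by ring⟩
    simp only [Finset.coe_range, Set.mem_Iio, Finset.mem_range] at hi ⊢
    omega
  · intro i _
    rw [← Nat.mul_sub]

/-- The even rank moments in terms of the coefficients `rankSigma`. -/
theorem rankMomentSeries_eq_sum (k : ℕ) :
    rankMomentSeries (2 * k) = ∑ i ∈ Finset.range (k + 1),
      C ((2 * k).factorial / (4 ^ i * ((2 * i + 1).factorial : ℚ))) * rankSigma (k - i) := by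
  have h := congrArg (coeff (2 * k)) rankGen_eq
  rw [rankGen, coeff_mk, coeff_mul,
    sum_antidiagonal_two_mul (f := fun i => coeff i (constU sinhcSeries))
      (g := fun i => coeff i rankSigmaGen)] at h
  · have h0 := Nat.factorial_ne_zero (2 * k)
    have h1 : rankMomentSeries (2 * k) = C (((2 * k).factorial : ℚ)) *
        (C (1 / ((2 * k).factorial : ℚ)) * rankMomentSeries (2 * k)) := by
      rw [← mul_assoc, ← map_mul, mul_one_div_cancel (by exact_mod_cast h0), map_one, one_mul]
    rw [h1, h, Finset.mul_sum]
    refine Finset.sum_congr rfl fun i _ => ?_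
    have h2 : ((2 * k).factorial : ℚ) * (1 / (2 ^ (2 * i) * ((2 * i + 1).factorial : ℚ))) =
        (2 * k).factorial / (4 ^ i * ((2 * i + 1).factorial : ℚ)) := by
      rw [pow_mul, mul_one_div]
      norm_num
    rw [coeff_map, sinhcSeries, coeff_mk, if_pos (even_two_mul i), ← mul_assoc, ← map_mul, h2]
    rfl
  · intro i hi
    rw [coeff_map, sinhcSeries, coeff_mk, if_neg (Nat.not_even_iff_odd.2 hi), map_zero]

lemma rankMomentSeries_zero : rankMomentSeries 0 = partitionSeries := by
  ext n
  simp [rankMomentSeries, rankMoment_eq_sum, partitionSeries]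

lemma rankSigma_zero : rankSigma 0 = partitionSeries := by
  have h := rankMomentSeries_eq_sum 0
  rw [mul_zero, rankMomentSeries_zero] at h
  simpa using h.symm

lemma quasiCoeff_zero : quasiCoeff 0 = 1 := by
  have h := congrArg (coeff 0) two_mul_partitionSeries_mul_quasiGen
  rw [coeff_C_mul] at h
  have h1 : coeff 0 quasiGen = quasiCoeff 0 := rfl
  have h2 : coeff 0 rankSigmaGen = partitionSeries := rankSigma_zero
  have h3 : (2 * partitionSeries : ℚ⟦X⟧) ≠ 0 := fun h0 => by
    have h4 := congrArg constantCoeff h0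
    rw [map_mul, constantCoeff_partitionSeries, map_ofNat] at h4
    norm_num at h4
  have e2 : (2 : ℚ⟦X⟧⟦X⟧) = C (C (2 : ℚ)) := by simp only [map_ofNat]
  rw [h1, map_add, map_sub, map_add, mul_assoc 2 X, e2, coeff_C_mul, coeff_C_mul,
    coeff_zero_X_mul, pow_two, mul_assoc X X, mul_assoc X X, coeff_zero_X_mul, coeff_zero_X_mul, h2,
    map_ofNat] at h
  refine mul_left_cancel₀ h3 ?_
  rw [h]
  ring

/-- The Eisenstein series of weight `k`, normalized to have the constant term `B_k`. -/
noncomputable def eisen (k : ℕ) : ℚ⟦X⟧ := C (bernoulli k) - C (2 * k : ℚ) * sigmaSeries (k - 1)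

/-- The differential equation of `quasiGen`, in which the Bernoulli numbers coming from
`2 sinh (u / 2) / u` complete the divisor sums to Eisenstein series. -/
lemma X_mul_uDeriv_quasiGen :
    X * uDeriv quasiGen = (6 * X * sigmaGen - 3 * constU bernoulliEvenSeries) * quasiGen := by
  set S := constU sinhcSeries with hS
  set T := constU sinhcSeries⁻¹ with hT
  have h1 : S * T = 1 := constU_sinhcSeries_mul_inv
  have h2 : X * uDeriv S = constU bernoulliEvenSeries * S := by
    rw [hS, uDeriv_constU, ← map_X (C : ℚ →+* ℚ⟦X⟧), ← map_mul, X_mul_derivative_sinhcSeries,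
      map_mul]
  have h3 : uDeriv (S * T) = 0 := by rw [h1, uDeriv_one]
  have h4 : X * uDeriv T = - constU bernoulliEvenSeries * T := by
    rw [uDeriv_mul] at h3
    linear_combination (X * T) * h3 - T ^ 2 * h2 - X * uDeriv T * h1 -
      T * constU bernoulliEvenSeries * h1
  have h5 : uDeriv (heatOp rankGen * expU (-1)) =
      6 * sigmaGen * (heatOp rankGen * expU (-1)) := by
    rw [uDeriv_mul, uDeriv_heatOp_rankGen, uDeriv_expU, Int.cast_neg, Int.cast_one, map_neg, map_one]
    ring
  rw [quasiGen, mul_assoc, uDeriv_C_mul, uDeriv_mul, pow_succ, pow_two, uDeriv_mul, uDeriv_mul, h5]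
  linear_combination 3 * C (C (1 / 2 : ℚ) * partitionSeries⁻¹) *
    (heatOp rankGen * expU (-1)) * T ^ 2 * h4

/-- The recursion for the coefficients `quasiCoeff`. -/
theorem quasiCoeff_rec (j : ℕ) :
    C (2 * j : ℚ) * quasiCoeff j = -3 * ∑ i ∈ Finset.range j,
      C (1 / ((2 * (i + 1)).factorial : ℚ)) * eisen (2 * (i + 1)) * quasiCoeff (j - (i + 1)) := by
  set L := 6 * X * sigmaGen - 3 * constU bernoulliEvenSeries with hL
  have e6 : (6 : ℚ⟦X⟧⟦X⟧) = C (C (6 : ℚ)) := by simp only [map_ofNat]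
  have e3 : (3 : ℚ⟦X⟧⟦X⟧) = C (C (3 : ℚ)) := by simp only [map_ofNat]
  have hodd : ∀ i, Odd i → coeff i L = 0 := by
    intro i hi
    obtain ⟨a, rfl⟩ := hi
    rw [hL, e6, e3, map_sub, mul_assoc, coeff_C_mul, coeff_succ_X_mul, coeff_C_mul, coeff_map,
      coeff_bernoulliEvenSeries_of_odd ⟨a, rfl⟩, sigmaGen, coeff_mk,
      if_neg (Nat.not_odd_iff_even.2 (even_two_mul a))]
    simp
  have h := congrArg (coeff (2 * j)) X_mul_uDeriv_quasiGen
  rw [← hL, coeff_mul _ L, sum_antidiagonal_two_mul (f := fun i => coeff i L)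
      (g := fun i => coeff i quasiGen) j hodd, Finset.sum_range_succ'] at h
  have h0 : coeff (2 * 0) L = 0 := by
    rw [hL, e3, map_sub, coeff_C_mul, coeff_map, mul_zero, coeff_zero_bernoulliEvenSeries]
    simp
  have hl : coeff (2 * j) (X * uDeriv quasiGen) = C (2 * j : ℚ) * quasiCoeff j := by
    rcases j with _ | j
    · simp
    · rw [show 2 * (j + 1) = 2 * j + 1 + 1 by ring, coeff_succ_X_mul, PowerSeries.coeff_derivative]
      change quasiCoeff (j + 1) * _ = _
      simp only [map_mul, map_ofNat, map_natCast]
      push_cast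
      ring
  rw [hl, h0, zero_mul, add_zero] at h
  rw [h, Finset.mul_sum]
  refine Finset.sum_congr rfl fun i _ => ?_
  have h1 : coeff (2 * (i + 1)) L = -3 * (C (1 / ((2 * (i + 1)).factorial : ℚ)) *
      eisen (2 * (i + 1))) := by
    have hb := coeff_bernoulliEvenSeries (k := 2 * (i + 1)) (by omega)
    rw [hL, e6, e3, map_sub, mul_assoc, coeff_C_mul, coeff_C_mul, coeff_map, hb,
      show 2 * (i + 1) = (2 * i + 1) + 1 by ring, coeff_succ_X_mul, sigmaGen, coeff_mk,
      if_pos ⟨i, rfl⟩, eisen, Nat.add_sub_cancel]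
    have hf := Nat.factorial_ne_zero (2 * i + 1)
    have h5 : (C (bernoulli (2 * i + 1 + 1) / ((2 * i + 1 + 1).factorial : ℚ)) : ℚ⟦X⟧) =
        C (bernoulli (2 * i + 1 + 1)) * C (1 / ((2 * i + 1 + 1).factorial : ℚ)) := by
      rw [← map_mul, mul_one_div]
    have h6 : (C (1 / ((2 * i + 1).factorial : ℚ)) : ℚ⟦X⟧) =
        C (((2 * i + 1 + 1 : ℕ) : ℚ)) * C (1 / ((2 * i + 1 + 1).factorial : ℚ)) := by
      rw [← map_mul, Nat.factorial_succ (2 * i + 1)]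
      congr 1
      push_cast
      field_simp
    rw [h5, h6, map_mul, map_ofNat, map_ofNat, map_ofNat]
    ring
  rw [h1]
  change _ * quasiCoeff (j - (i + 1)) = _
  ring

end RankRecursion

/-! ### Everywhere convergent `q`-series and modular forms of level one -/

section QSeries

open PowerSeries UpperHalfPlane

open scoped Manifold ModularForm

/-- The function `h` on the upper half plane is given by the power series `F` in
`q = exp (2 π i τ)`, which converges everywhere. -/
def HasQSeries (F : ℂ⟦X⟧) (h : ℍ → ℂ) : Prop :=
  ∀ τ : ℍ, HasSum (fun m => coeff m F • Function.Periodic.qParam 1 τ ^ m) (h τ)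

namespace HasQSeries

variable {F G : ℂ⟦X⟧} {f g : ℍ → ℂ}

lemma add (hF : HasQSeries F f) (hG : HasQSeries G g) : HasQSeries (F + G) (f + g) := fun τ => by
  simpa [add_mul] using (hF τ).add (hG τ)

lemma smul (hF : HasQSeries F f) (a : ℂ) : HasQSeries (a • F) (a • f) := fun τ => by
  simpa [mul_assoc] using (hF τ).mul_left a

lemma mul (hF : HasQSeries F f) (hG : HasQSeries G g) : HasQSeries (F * G) (f * g) := fun τ => by
  have h1 := (hF τ).summable.norm
  have h2 := (hG τ).summable.norm
  have h3 := (summable_norm_sum_mul_antidiagonal_of_summable_norm h1 h2).of_norm.hasSum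
  rw [← tsum_mul_tsum_eq_tsum_sum_antidiagonal_of_summable_norm h1 h2, (hF τ).tsum_eq,
    (hG τ).tsum_eq] at h3
  refine Eq.mpr (congrArg (fun s => HasSum s _) (funext fun m => ?_)) h3
  rw [coeff_mul, Finset.sum_smul]
  refine Finset.sum_congr rfl fun p hp => ?_
  rw [← Finset.HasAntidiagonal.mem_antidiagonal.1 hp, pow_add]
  simp only [smul_eq_mul]
  ring

lemma one : HasQSeries 1 1 := fun τ => by
  refine Eq.mpr (congrArg (fun s => HasSum s _) (funext fun m => ?_)) (hasSum_ite_eq (0 : ℕ) (1 : ℂ))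
  rw [coeff_one]
  split_ifs with h
  · simp [h]
  · simp

lemma pow (hF : HasQSeries F f) (n : ℕ) : HasQSeries (F ^ n) (f ^ n) := by
  induction n with
  | zero => simpa using one
  | succ n ih => simpa only [pow_succ] using ih.mul hF

lemma norm_le (τ : ℍ) {w : ℂ} (hw : τ.im ≤ w.im) (m : ℕ) :
    ‖coeff m F • Function.Periodic.qParam 1 w ^ m‖ ≤
      ‖coeff m F • Function.Periodic.qParam 1 τ ^ m‖ := by
  rw [norm_smul, norm_smul, norm_pow, norm_pow]
  refine mul_le_mul_of_nonneg_left (pow_le_pow_left₀ (norm_nonneg _) ?_ _) (norm_nonneg _)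
  rw [Function.Periodic.norm_qParam, Function.Periodic.norm_qParam, Real.exp_le_exp, div_one,
    div_one]
  have h2 : (τ : ℂ).im ≤ w.im := hw
  nlinarith [Real.pi_pos]

lemma eqOn_tsum (hF : HasQSeries F f) : Set.EqOn (f ∘ ofComplex)
    (fun w => ∑' m, coeff m F • Function.Periodic.qParam 1 w ^ m) upperHalfPlaneSet := by
  intro w hw
  have := (hF ⟨w, hw⟩).tsum_eq
  simp only [Function.comp_apply]
  rw [ofComplex_apply_of_im_pos hw, ← this]

lemma differentiableOn_term (m : ℕ) (U : Set ℂ) :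
    DifferentiableOn ℂ (fun w => coeff m F • Function.Periodic.qParam 1 w ^ m) U :=
  (((Function.Periodic.differentiable_qParam).fun_pow m).fun_const_smul _).differentiableOn

lemma isOpen_im_gt (y : ℝ) : IsOpen {w : ℂ | y < w.im} :=
  isOpen_lt continuous_const Complex.continuous_im

lemma mdiff (hF : HasQSeries F f) : MDiff f := by
  rw [UpperHalfPlane.mdifferentiable_iff]
  intro w hw
  have hw' : 0 < w.im := hw
  let τ : ℍ := ⟨w.im / 2 * Complex.I, by simpa using hw'⟩
  have hτ : τ.im = w.im / 2 := by
    change (w.im / 2 * Complex.I : ℂ).im = _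
    simp
  have h1 := Complex.differentiableOn_tsum_of_summable_norm (hF τ).summable.norm
    (fun m => differentiableOn_term (F := F) m {w : ℂ | τ.im < w.im}) (isOpen_im_gt _)
    fun m z hz => norm_le τ (le_of_lt hz) m
  have h2 : w ∈ {w : ℂ | τ.im < w.im} := by
    simp only [Set.mem_ofPred_eq, hτ]
    linarith
  refine DifferentiableAt.differentiableWithinAt ?_
  refine (h1.differentiableAt ((isOpen_im_gt _).mem_nhds h2)).congr_of_eventuallyEq ?_
  filter_upwards [isOpen_upperHalfPlaneSet.mem_nhds hw] with z hz
  exact hF.eqOn_tsum hz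

lemma isBoundedAtImInfty (hF : HasQSeries F f) : IsBoundedAtImInfty f :=
  isBoundedAtImInfty_of_hasSum_qExpansion one_pos hF

lemma periodic (hF : HasQSeries F f) : Function.Periodic (f ∘ ofComplex) 1 := by
  intro w
  by_cases hw : 0 < w.im
  · have hw' : 0 < (w + 1).im := by simpa using hw
    rw [hF.eqOn_tsum hw, hF.eqOn_tsum hw']
    have : Function.Periodic.qParam 1 (w + 1) = Function.Periodic.qParam 1 w := by
      simp [Function.Periodic.qParam, mul_add, Complex.exp_add]
    simp only [this]
  · have hw' : ¬ 0 < (w + 1).im := by simpa using hw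
    simp only [Function.comp_apply]
    rw [ofComplex_apply_of_im_nonpos (not_lt.1 hw), ofComplex_apply_of_im_nonpos (not_lt.1 hw')]

lemma qExpansion_eq (hF : HasQSeries F f) : qExpansion 1 f = F := by
  ext m
  have h0 : AnalyticAt ℂ (cuspFunction 1 f) 0 := analyticAt_cuspFunction_zero one_pos
    (by rw [Complex.ofReal_one]; exact hF.periodic) hF.mdiff hF.isBoundedAtImInfty
  have h1 := (hasFPowerSeriesOnBall_cuspFunction one_pos h0 hF).hasFPowerSeriesAt
  have h2 := congrArg (fun p => FormalMultilinearSeries.coeff p m)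
    (h1.eq_formalMultilinearSeries h0.hasFPowerSeriesAt)
  simp only [FormalMultilinearSeries.coeff_ofScalars] at h2
  rw [h2, qExpansion_coeff]
  ring

lemma unique (hF : HasQSeries F f) (hG : HasQSeries G f) : F = G :=
  hF.qExpansion_eq.symm.trans hG.qExpansion_eq

lemma deriv (hF : HasQSeries F f) :
    HasQSeries (X * PowerSeries.derivative ℂ F) (Derivative.normalizedDerivOfComplex f) := by
  intro w
  let τ : ℍ := ⟨w.im / 2 * Complex.I, by simpa using w.im_pos⟩
  have hτ : τ.im = w.im / 2 := by
    change (w.im / 2 * Complex.I : ℂ).im = _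
    simp
  have h2 : (w : ℂ) ∈ {w : ℂ | τ.im < w.im} := by
    simp only [Set.mem_ofPred_eq, hτ]
    have := w.im_pos
    change w.im / 2 < w.im
    linarith
  have h1 := Complex.hasSum_deriv_of_summable_norm (hF τ).summable.norm
    (fun m => differentiableOn_term (F := F) m {w : ℂ | τ.im < w.im}) (isOpen_im_gt _)
    (fun m z hz => norm_le τ (le_of_lt hz) m) h2
  have h3 : (f ∘ ofComplex) =ᶠ[nhds (w : ℂ)]
      (fun w => ∑' m, coeff m F • Function.Periodic.qParam 1 w ^ m) := by
    filter_upwards [isOpen_upperHalfPlaneSet.mem_nhds w.im_pos] with z hz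
    exact hF.eqOn_tsum hz
  rw [← h3.deriv_eq] at h1
  have h4 := h1.mul_left (2 * Real.pi * Complex.I : ℂ)⁻¹
  refine Eq.mpr (congrArg (fun s => HasSum s _) (funext fun m => ?_)) h4
  have h5 : HasDerivAt (fun z => Function.Periodic.qParam 1 z)
      (Function.Periodic.qParam 1 w * (2 * Real.pi * Complex.I)) (w : ℂ) := by
    have h6 : HasDerivAt (fun z : ℂ => 2 * Real.pi * Complex.I * z / (1 : ℝ))
        (2 * Real.pi * Complex.I) (w : ℂ) := by
      simpa using (hasDerivAt_id (w : ℂ)).const_mul (2 * Real.pi * Complex.I : ℂ)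
    exact h6.cexp
  have h7 := ((h5.fun_pow m).const_mul (coeff m F)).deriv
  simp only [smul_eq_mul]
  rw [h7]
  have h8 : (2 * Real.pi * Complex.I : ℂ) ≠ 0 := by simp [Real.pi_ne_zero]
  rcases m with _ | m
  · simp
  · rw [coeff_succ_X_mul, PowerSeries.coeff_derivative, Nat.add_sub_cancel, pow_succ]
    push_cast
    field_simp

end HasQSeries

/-- The inclusion of the power series with rational coefficients. -/
noncomputable abbrev toComplexSeries : ℚ⟦X⟧ →+* ℂ⟦X⟧ := PowerSeries.map (algebraMap ℚ ℂ)

lemma toComplexSeries_injective : Function.Injective toComplexSeries :=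
  PowerSeries.map_injective _ (algebraMap ℚ ℂ).injective

lemma toComplexSeries_C_mul (a : ℚ) (F : ℚ⟦X⟧) :
    toComplexSeries (C a * F) = (a : ℂ) • toComplexSeries F := by
  rw [map_mul, map_C, smul_eq_C_mul]
  rfl

lemma toComplexSeries_qDeriv (F : ℚ⟦X⟧) :
    toComplexSeries (qDeriv F) = X * PowerSeries.derivative ℂ (toComplexSeries F) := by
  ext m
  rw [coeff_map, coeff_qDeriv]
  rcases m with _ | m
  · simp
  · rw [coeff_succ_X_mul, PowerSeries.coeff_derivative, coeff_map]
    push_cast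
    simp
    ring

/-- `F` is the `q`-expansion of a modular form of level one and weight `w`. -/
def IsLevelOne (w : ℤ) (F : ℚ⟦X⟧) : Prop :=
  ∃ g : ModularForm 𝒮ℒ w, HasQSeries (toComplexSeries F) g

lemma hasQSeries_of_modularForm {w : ℤ} (g : ModularForm 𝒮ℒ w) : HasQSeries (qExpansion 1 g) g :=
  fun τ => ModularForm.hasSum_qExpansion g one_pos one_mem_strictPeriods_SL τ

/-- A modular form of level one from the invariance under the generators `S` and `T` and the
behaviour at the cusp `∞`. -/
lemma exists_modularForm {w : ℤ} {h : ℍ → ℂ} (hS : h ∣[w] ModularGroup.S = h)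
    (hT : h ∣[w] ModularGroup.T = h) (hd : MDiff h) (hb : IsBoundedAtImInfty h) :
    ∃ g : ModularForm 𝒮ℒ w, (g : ℍ → ℂ) = h :=
  ⟨{ toFun := h
     slash_action_eq' := by
      rintro A ⟨A, rfl⟩
      exact SlashInvariantForm.slash_action_generators_SL2Z hS hT A
     holo' := hd
     bdd_at_cusps' := by
      intro c hc
      rw [Subgroup.IsArithmetic.isCusp_iff_isCusp_SL2Z] at hc
      rw [OnePoint.isBoundedAt_iff_forall_SL2Z hc]
      intro γ _
      rw [SlashInvariantForm.slash_action_generators_SL2Z hS hT]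
      exact hb }, rfl⟩

namespace IsLevelOne

variable {v w : ℤ} {F G : ℚ⟦X⟧}

lemma add (hF : IsLevelOne w F) (hG : IsLevelOne w G) : IsLevelOne w (F + G) := by
  obtain ⟨f, hf⟩ := hF
  obtain ⟨g, hg⟩ := hG
  exact ⟨f + g, by rw [map_add]; exact hf.add hg⟩

lemma C_mul (hF : IsLevelOne w F) (a : ℚ) : IsLevelOne w (C a * F) := by
  obtain ⟨f, hf⟩ := hF
  exact ⟨(a : ℂ) • f, by rw [toComplexSeries_C_mul]; exact hf.smul _⟩

lemma mul (hF : IsLevelOne v F) (hG : IsLevelOne w G) : IsLevelOne (v + w) (F * G) := by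
  obtain ⟨f, hf⟩ := hF
  obtain ⟨g, hg⟩ := hG
  exact ⟨f.mul g, by rw [map_mul]; exact hf.mul hg⟩

lemma one : IsLevelOne 0 1 := ⟨1, by rw [map_one]; exact HasQSeries.one⟩

lemma zero (w : ℤ) : IsLevelOne w 0 := ⟨0, fun τ => by simp⟩

lemma cast (hF : IsLevelOne v F) (h : v = w) : IsLevelOne w F := h ▸ hF

lemma eq_zero_of_neg (hF : IsLevelOne w F) (hw : w < 0) : F = 0 := by
  obtain ⟨g, hg⟩ := hF
  refine toComplexSeries_injective (hg.unique ?_)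
  rw [ModularFormClass.levelOne_neg_weight_eq_zero hw g, map_zero]
  exact fun τ => by simp

end IsLevelOne

lemma bernoulli_ne_zero_of_even {k : ℕ} (hk : k ≠ 0) (hk2 : Even k) : bernoulli k ≠ 0 := by
  obtain ⟨j, rfl⟩ := hk2
  rw [← two_mul] at hk ⊢
  intro h0
  have h := hasSum_zeta_nat (k := j) (by lia)
  rw [h0] at h
  simp only [Rat.cast_zero, mul_zero, zero_div] at h
  have h1 := (hasSum_zero_iff_of_nonneg fun n => by positivity).1 h
  simpa using congrFun h1 1

lemma isLevelOne_eisen {k : ℕ} (hk : 3 ≤ k) (hk2 : Even k) : IsLevelOne k (eisen k) := by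
  have hb : bernoulli k ≠ 0 := bernoulli_ne_zero_of_even (by lia) hk2
  refine ⟨((bernoulli k : ℚ) : ℂ) • ModularForm.E hk, ?_⟩
  have h := (hasQSeries_of_modularForm (ModularForm.E hk)).smul ((bernoulli k : ℚ) : ℂ)
  change HasQSeries _ (((bernoulli k : ℚ) : ℂ) • (ModularForm.E hk : ℍ → ℂ))
  convert h using 1
  ext m
  have hb' : ((bernoulli k : ℚ) : ℂ) ≠ 0 := by exact_mod_cast hb
  rw [coeff_smul, EisensteinSeries.E_qExpansion_coeff hk hk2, coeff_map, eisen, map_sub, coeff_C,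
    coeff_C_mul, sigmaSeries, coeff_mk]
  split_ifs with hm
  · subst hm
    simp
  · simp only [zero_sub, smul_eq_mul, map_neg, map_mul]
    simp
    field_simp

/-- The Eisenstein series of weight two. -/
noncomputable def eisenTwo : ℚ⟦X⟧ := 1 - 24 * sigmaSeries 1

lemma hasQSeries_eisenTwo : HasQSeries (toComplexSeries eisenTwo) EisensteinSeries.E2 := fun τ => by
  have h := EisensteinSeries.hasSum_qExpansion_E2 (z := τ)
  refine Eq.mpr (congrArg (fun s => HasSum s _) (funext fun m => ?_)) h
  have e : (24 : ℚ⟦X⟧) = C (24 : ℚ) := by simp only [map_ofNat]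
  rw [coeff_map, eisenTwo, e, map_sub, coeff_one, coeff_C_mul, sigmaSeries, coeff_mk]
  simp only [Function.Periodic.qParam, Complex.ofReal_one, div_one]
  split_ifs with hm
  · simp [hm]
  · simp

/-- The Serre derivative of a modular form is a modular form. -/
lemma IsLevelOne.serre {w : ℤ} {F : ℚ⟦X⟧} (hF : IsLevelOne w F) :
    IsLevelOne (w + 2) (12 * qDeriv F - (w : ℚ⟦X⟧) * eisenTwo * F) := by
  obtain ⟨f, hf⟩ := hF
  have h1 : HasQSeries (toComplexSeries (qDeriv F - C (w / 12 : ℚ) * (eisenTwo * F)))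
      (Derivative.serreDerivative w f) := by
    rw [map_sub, toComplexSeries_qDeriv, toComplexSeries_C_mul, map_mul, sub_eq_add_neg,
      ← neg_smul (((w / 12 : ℚ) : ℂ)) (toComplexSeries eisenTwo * toComplexSeries F)]
    have h2 := hf.deriv.add ((hasQSeries_eisenTwo.mul hf).smul (-((w / 12 : ℚ) : ℂ)))
    convert h2 using 1
    funext z
    simp only [Derivative.serreDerivative_apply, Pi.add_apply, Pi.smul_apply, Pi.mul_apply,
      smul_eq_mul]
    push_cast
    ring
  have hinv : ∀ γ : SL(2, ℤ), Derivative.serreDerivative w f ∣[w + 2] γ =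
      Derivative.serreDerivative w f := fun γ =>
    Derivative.serreDerivative_slash_invariant f.holo' (f.slash_action_eq' _ ⟨γ, rfl⟩)
  obtain ⟨g, hg⟩ := exists_modularForm (hinv _) (hinv _) h1.mdiff h1.isBoundedAtImInfty
  have h3 : IsLevelOne (w + 2) (qDeriv F - C (w / 12 : ℚ) * (eisenTwo * F)) :=
    ⟨g, by rw [hg]; exact h1⟩
  have h4 := h3.C_mul 12
  convert h4 using 1
  have e : (C (w / 12 : ℚ) : ℚ⟦X⟧) = C (1 / 12 : ℚ) * (w : ℚ⟦X⟧) := by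
    rw [← map_intCast (C : ℚ →+* ℚ⟦X⟧), ← map_mul]
    congr 1
    ring
  have e2 : C (12 : ℚ) * C (1 / 12 : ℚ) = (1 : ℚ⟦X⟧) := by
    rw [← map_mul]
    norm_num
  rw [e, show (12 : ℚ⟦X⟧) = C (12 : ℚ) by simp only [map_ofNat]]
  linear_combination (w : ℚ⟦X⟧) * eisenTwo * F * e2

/-- The product `∏ (1 - q ^ n)`, as a function on the upper half plane. -/
noncomputable def eulerFun (z : ℍ) : ℂ := ∏' n, (1 - ModularForm.eta_q n z)

lemma eta_eq (z : ℍ) : ModularForm.eta z = Function.Periodic.qParam 24 z * eulerFun z := rfl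

lemma eulerFun_ne_zero (z : ℍ) : eulerFun z ≠ 0 := ModularForm.eta_tprod_ne_zero z.2

/-- The power series of `∏ (1 - q ^ n)`, the inverse of the generating series of the partition
numbers. -/
noncomputable def eulerSeries : ℚ⟦X⟧ := partitionSeries⁻¹

lemma partitionSeries_mul_eulerSeries : partitionSeries * eulerSeries = 1 :=
  PowerSeries.mul_inv_cancel _ (by rw [constantCoeff_partitionSeries]; exact one_ne_zero)

/-- The logarithmic derivative of the generating series of the partition numbers. -/
lemma qDeriv_partitionSeries : qDeriv partitionSeries = sigmaSeries 1 * partitionSeries := by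
  have h := rankSigma_succ 0
  have h1 := quasiCoeff_rec 1
  simp only [Finset.sum_range_one] at h1
  norm_num [quasiCoeff_zero, rankSigma_zero, eisen, qDerivShift] at h h1
  have e1 : (C (1 / 2) * C (1 / 6) : ℚ⟦X⟧) = C 2 * C (1 / 24) := by
    rw [← map_mul, ← map_mul]
    norm_num
  have e2 : (C (1 / 2) * C 4 : ℚ⟦X⟧) = C 2 := by
    rw [← map_mul]
    norm_num
  have e3 : (C 2 : ℚ⟦X⟧) = 2 := by simp only [map_ofNat]
  rw [e3] at h1 e1 e2
  have h6 : (6 : ℚ⟦X⟧) * (qDeriv partitionSeries - sigmaSeries 1 * partitionSeries) = 0 := by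
    linear_combination h + partitionSeries * h1 - 3 * partitionSeries * e1 +
      3 * partitionSeries * sigmaSeries 1 * e2
  have e4 : (6 : ℚ⟦X⟧) ≠ 0 := by
    rw [← map_ofNat (C : ℚ →+* ℚ⟦X⟧)]
    exact (map_ne_zero_iff _ PowerSeries.C_injective).2 (by norm_num)
  exact sub_eq_zero.1 ((mul_eq_zero.1 h6).resolve_left e4)

lemma exists_hasQSeries_eulerFun : ∃ F : ℂ⟦X⟧, HasQSeries F eulerFun ∧ constantCoeff F = 1 := by
  set g : ℂ → ℂ := fun q => ∏' n : ℕ, (1 - q ^ (n + 1)) with hg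
  refine ⟨PowerSeries.mk fun n => (n.factorial : ℂ)⁻¹ * iteratedDeriv n g 0, fun τ => ?_, ?_⟩
  · have hq : Function.Periodic.qParam 1 τ ∈ Metric.ball (0 : ℂ) 1 := by
      simpa using Function.Periodic.norm_qParam_lt_one one_pos τ.im_pos
    have h := Complex.hasSum_taylorSeries_on_ball
      (ModularForm.differentiableOn_tprod_one_sub_pow) hq
    have e : eulerFun τ = g (Function.Periodic.qParam 1 τ) := rfl
    rw [e]
    refine Eq.mpr (congrArg (fun s => HasSum s _) (funext fun m => ?_)) h
    rw [coeff_mk, sub_zero]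
    simp only [smul_eq_mul, hg]
    ring
  · rw [← coeff_zero_eq_constantCoeff_apply, coeff_mk]
    simp [hg]

/-- The product `∏ (1 - q ^ n)` has the `q`-series `eulerSeries`: both have the constant term `1`
and the same logarithmic derivative. -/
lemma hasQSeries_eulerFun : HasQSeries (toComplexSeries eulerSeries) eulerFun := by
  obtain ⟨F, hF, h0⟩ := exists_hasQSeries_eulerFun
  -- the logarithmic derivative of the eta function
  have h1 : X * PowerSeries.derivative ℂ F = - toComplexSeries (sigmaSeries 1) * F := by
    have h2 : HasQSeries (toComplexSeries (C (1 / 24 : ℚ) * (eisenTwo - 1)) * F)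
        (Derivative.normalizedDerivOfComplex eulerFun) := by
      have h3 := hasQSeries_eisenTwo.add (HasQSeries.one.smul (-1))
      have h4 := (h3.smul ((1 / 24 : ℚ) : ℂ)).mul hF
      rw [toComplexSeries_C_mul, map_sub, map_one, sub_eq_add_neg]
      rw [neg_one_smul] at h4
      convert h4 using 1
      funext z
      have h5 := ModularForm.logDeriv_eta_eq_E2 z
      have h6 : ModularForm.eta = fun w => Function.Periodic.qParam 24 w *
        ∏' n, (1 - ModularForm.eta_q n w) := rfl
      rw [h6, logDeriv_mul _ (Function.Periodic.qParam_ne_zero _) (eulerFun_ne_zero z) (by fun_prop)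
        (ModularForm.differentiableAt_eta_tprod z.2), ModularForm.logDeriv_qParam,
        logDeriv_apply] at h5
      have h7 : (eulerFun ∘ ofComplex) =ᶠ[nhds (z : ℂ)]
          fun w => ∏' n, (1 - ModularForm.eta_q n w) := by
        filter_upwards [isOpen_upperHalfPlaneSet.mem_nhds z.im_pos] with w hw
        simp only [Function.comp_apply, eulerFun]
        rw [ofComplex_apply_of_im_pos hw]
      have h8 : (2 * Real.pi * Complex.I : ℂ) ≠ 0 := by simp [Real.pi_ne_zero]
      have h9 := eulerFun_ne_zero z
      rw [Derivative.normalizedDerivOfComplex, h7.deriv_eq]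
      change _ + _ / eulerFun z = _ at h5
      simp only [Pi.mul_apply, Pi.smul_apply, Pi.add_apply, Pi.one_apply, smul_eq_mul]
      rw [← eq_sub_iff_add_eq', div_eq_iff h9] at h5
      rw [h5]
      push_cast
      field_simp
      ring
    rw [hF.deriv.unique h2, eisenTwo]
    congr 1
    have e2 : C (1 / 24 : ℚ) * C (24 : ℚ) = (1 : ℚ⟦X⟧) := by
      rw [← map_mul]
      norm_num
    rw [← map_neg]
    congr 1
    rw [show (24 : ℚ⟦X⟧) = C (24 : ℚ) by simp only [map_ofNat]]
    linear_combination (- sigmaSeries 1) * e2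
  have h2 : PowerSeries.derivative ℂ (toComplexSeries partitionSeries * F) = 0 := by
    refine mul_left_cancel₀ (X_ne_zero (R := ℂ)) ?_
    have h3 := toComplexSeries_qDeriv partitionSeries
    rw [qDeriv_partitionSeries, map_mul] at h3
    rw [derivative_mul_eq, mul_zero]
    linear_combination toComplexSeries partitionSeries * h1 - F * h3
  have h3 : toComplexSeries partitionSeries * F = 1 := by
    refine PowerSeries.derivative.ext ?_ ?_
    · rw [h2, PowerSeries.derivative_one]
    · rw [map_mul, h0, ← coeff_zero_eq_constantCoeff_apply, coeff_map,
        coeff_zero_eq_constantCoeff_apply, constantCoeff_partitionSeries]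
      simp
  have h4 : F = toComplexSeries eulerSeries := by
    have h5 := congrArg toComplexSeries partitionSeries_mul_eulerSeries
    rw [map_mul, map_one] at h5
    linear_combination F * (- h5) + toComplexSeries eulerSeries * h3
  rw [← h4]
  exact hF

end QSeries

/-! ### The transformation law of the square of the eta function -/

section EtaMultiplier

open PowerSeries UpperHalfPlane

open scoped Manifold ModularForm

/-- The cubic part of the exponent of the multiplier of the square of the eta function. Such
polynomial formulas make its behaviour under the generators `S` and `T` a finite computation. -/
def etaExpThree (γ : SL(2, ℤ)) : ZMod 3 :=
  let a : ZMod 3 := (γ 0 0 : ℤ)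
  let b : ZMod 3 := (γ 0 1 : ℤ)
  let c : ZMod 3 := (γ 1 0 : ℤ)
  let d : ZMod 3 := (γ 1 1 : ℤ)
  (1 - c ^ 2) * (b * d + c) + c * (a + d)

/-- The quartic part of the exponent of the multiplier of the square of the eta function. -/
def etaExpFour (γ : SL(2, ℤ)) : ZMod 4 :=
  let a : ZMod 4 := (γ 0 0 : ℤ)
  let b : ZMod 4 := (γ 0 1 : ℤ)
  let c : ZMod 4 := (γ 1 0 : ℤ)
  let d : ZMod 4 := (γ 1 1 : ℤ)
  (1 - c ^ 2) * (b * d + 3 * (c - 1) * d + c + 3) + c * (a + d - 3)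

/-- The multiplier of the square of the eta function, a character of `SL(2, ℤ)` of order twelve. -/
noncomputable def etaMultiplier (γ : SL(2, ℤ)) : ℂ :=
  ZMod.stdAddChar (etaExpThree γ) * ZMod.stdAddChar (- etaExpFour γ)

lemma det_eq_cast (R : Type*) [CommRing R] (γ : SL(2, ℤ)) :
    ((γ 0 0 : ℤ) : R) * (γ 1 1 : ℤ) - ((γ 0 1 : ℤ) : R) * (γ 1 0 : ℤ) = 1 := by
  have h := γ.det_coe
  rw [Matrix.det_fin_two] at h
  exact_mod_cast congrArg (Int.cast : ℤ → R) h

lemma mul_T_apply (γ : SL(2, ℤ)) :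
    (γ * ModularGroup.T) 0 0 = γ 0 0 ∧ (γ * ModularGroup.T) 0 1 = γ 0 0 + γ 0 1 ∧
      (γ * ModularGroup.T) 1 0 = γ 1 0 ∧ (γ * ModularGroup.T) 1 1 = γ 1 0 + γ 1 1 := by
  simp [Matrix.SpecialLinearGroup.coe_mul, ModularGroup.coe_T, Matrix.mul_apply, Fin.sum_univ_two]

lemma mul_S_apply (γ : SL(2, ℤ)) :
    (γ * ModularGroup.S) 0 0 = γ 0 1 ∧ (γ * ModularGroup.S) 0 1 = - γ 0 0 ∧
      (γ * ModularGroup.S) 1 0 = γ 1 1 ∧ (γ * ModularGroup.S) 1 1 = - γ 1 0 := by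
  simp [Matrix.SpecialLinearGroup.coe_mul, ModularGroup.coe_S, Matrix.mul_apply, Fin.sum_univ_two]

lemma etaExpThree_mul_T (γ : SL(2, ℤ)) :
    etaExpThree (γ * ModularGroup.T) = etaExpThree γ + 1 := by
  obtain ⟨h1, h2, h3, h4⟩ := mul_T_apply γ
  have hd := det_eq_cast (ZMod 3) γ
  simp only [etaExpThree, h1, h2, h3, h4, Int.cast_add]
  generalize ((γ 0 0 : ℤ) : ZMod 3) = a at *
  generalize ((γ 0 1 : ℤ) : ZMod 3) = b at *
  generalize ((γ 1 0 : ℤ) : ZMod 3) = c at *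
  generalize ((γ 1 1 : ℤ) : ZMod 3) = d at *
  clear h1 h2 h3 h4
  revert a b c d
  decide

lemma etaExpThree_mul_S (γ : SL(2, ℤ)) :
    etaExpThree (γ * ModularGroup.S) = etaExpThree γ := by
  obtain ⟨h1, h2, h3, h4⟩ := mul_S_apply γ
  have hd := det_eq_cast (ZMod 3) γ
  simp only [etaExpThree, h1, h2, h3, h4, Int.cast_neg]
  generalize ((γ 0 0 : ℤ) : ZMod 3) = a at *
  generalize ((γ 0 1 : ℤ) : ZMod 3) = b at *
  generalize ((γ 1 0 : ℤ) : ZMod 3) = c at *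
  generalize ((γ 1 1 : ℤ) : ZMod 3) = d at *
  clear h1 h2 h3 h4
  revert a b c d
  decide

lemma etaExpFour_mul_T (γ : SL(2, ℤ)) :
    etaExpFour (γ * ModularGroup.T) = etaExpFour γ + 1 := by
  obtain ⟨h1, h2, h3, h4⟩ := mul_T_apply γ
  have hd := det_eq_cast (ZMod 4) γ
  simp only [etaExpFour, h1, h2, h3, h4, Int.cast_add]
  generalize ((γ 0 0 : ℤ) : ZMod 4) = a at *
  generalize ((γ 0 1 : ℤ) : ZMod 4) = b at *
  generalize ((γ 1 0 : ℤ) : ZMod 4) = c at *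
  generalize ((γ 1 1 : ℤ) : ZMod 4) = d at *
  clear h1 h2 h3 h4
  revert a b c d
  decide +kernel

lemma etaExpFour_mul_S (γ : SL(2, ℤ)) :
    etaExpFour (γ * ModularGroup.S) = etaExpFour γ + 1 := by
  obtain ⟨h1, h2, h3, h4⟩ := mul_S_apply γ
  have hd := det_eq_cast (ZMod 4) γ
  simp only [etaExpFour, h1, h2, h3, h4, Int.cast_neg]
  generalize ((γ 0 0 : ℤ) : ZMod 4) = a at *
  generalize ((γ 0 1 : ℤ) : ZMod 4) = b at *
  generalize ((γ 1 0 : ℤ) : ZMod 4) = c at *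
  generalize ((γ 1 1 : ℤ) : ZMod 4) = d at *
  clear h1 h2 h3 h4
  revert a b c d
  decide +kernel

lemma stdAddChar_neg_one_four : (ZMod.stdAddChar (-1 : ZMod 4) : ℂ) = -Complex.I := by
  have h := ZMod.stdAddChar_coe (N := 4) (-1)
  push_cast at h
  rw [h, show (2 * Real.pi * Complex.I * (-1) / 4 : ℂ) = -(Real.pi / 2 * Complex.I) by ring,
    Complex.exp_neg, Complex.exp_pi_div_two_mul_I, Complex.inv_I]

lemma etaMultiplier_one : etaMultiplier 1 = 1 := by
  have h3 : etaExpThree 1 = 0 := by decide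
  have h4 : etaExpFour 1 = 0 := by decide
  simp [etaMultiplier, h3, h4]

lemma etaMultiplier_mul_T (γ : SL(2, ℤ)) : etaMultiplier (γ * ModularGroup.T) =
    etaMultiplier γ * Complex.exp (2 * Real.pi * Complex.I / 12) := by
  have h := ZMod.stdAddChar_coe (N := 4) (-1)
  have h' := ZMod.stdAddChar_coe (N := 3) 1
  push_cast at h h'
  rw [etaMultiplier, etaExpThree_mul_T, etaExpFour_mul_T, neg_add, AddChar.map_add_eq_mul,
    AddChar.map_add_eq_mul, etaMultiplier, h, h',
    show (2 * Real.pi * Complex.I / 12 : ℂ) = 2 * Real.pi * Complex.I * 1 / 3 +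
      2 * Real.pi * Complex.I * (-1) / 4 by ring, Complex.exp_add]
  ring

lemma etaMultiplier_mul_S (γ : SL(2, ℤ)) : etaMultiplier (γ * ModularGroup.S) =
    etaMultiplier γ * (-Complex.I) := by
  rw [etaMultiplier, etaExpThree_mul_S, etaExpFour_mul_S, neg_add, AddChar.map_add_eq_mul,
    etaMultiplier, stdAddChar_neg_one_four]
  ring

/-- The square of the eta function. -/
noncomputable def etaSq (z : ℍ) : ℂ := ModularForm.eta z ^ 2

lemma etaSq_slash_T : etaSq ∣[(1 : ℤ)] ModularGroup.T =
    Complex.exp (2 * Real.pi * Complex.I / 12) • etaSq := by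
  ext z
  have h1 : Function.Periodic.qParam 1 ((1 : ℂ) + z) = Function.Periodic.qParam 1 z := by
    rw [add_comm]
    simp [Function.Periodic.qParam, mul_add, Complex.exp_add]
  have h2 : Function.Periodic.qParam 24 ((1 : ℂ) + z) ^ 2 =
      Complex.exp (2 * Real.pi * Complex.I / 12) * Function.Periodic.qParam 24 z ^ 2 := by
    simp only [Function.Periodic.qParam, ← Complex.exp_nat_mul]
    rw [← Complex.exp_add]
    congr 1
    push_cast
    ring
  have h3 : ((((1 : ℝ) +ᵥ z : ℍ)) : ℂ) = 1 + z := by simp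
  rw [ModularForm.SL_slash_apply, modular_T_smul]
  simp only [etaSq, Pi.smul_apply, smul_eq_mul, ModularForm.eta, mul_pow, h3, h2,
    ModularForm.eta_q, h1]
  rw [ModularGroup.denom_apply, ModularGroup.coe_T]
  simp
  ring

lemma etaSq_slash_S : etaSq ∣[(1 : ℤ)] ModularGroup.S = (-Complex.I) • etaSq := by
  ext z
  have h : ModularForm.eta (-1 / (z : ℂ)) = (Complex.sqrt Complex.I)⁻¹ *
      (Complex.sqrt z * ModularForm.eta z) := ModularForm.eta_comp_eq_csqrt_I_inv z.2
  have hsq (w : ℂ) : Complex.sqrt w ^ 2 = w := by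
    rw [Complex.sqrt, ← Complex.cpow_nat_mul]
    norm_num
  rw [ModularForm.SL_slash_apply, modular_S_smul]
  have h2 : etaSq (.mk (-(z : ℂ))⁻¹ z.im_inv_neg_coe_pos) = Complex.I⁻¹ * (z * etaSq z) := by
    have h3 : (-(z : ℂ))⁻¹ = -1 / z := by simp [neg_div, inv_neg]
    simp only [etaSq]
    rw [h3, h, mul_pow, mul_pow, inv_pow, hsq, hsq]
  have h0 := z.ne_zero
  rw [h2, ModularGroup.denom_S, Pi.smul_apply, smul_eq_mul, Complex.inv_I, zpow_neg, zpow_one]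
  field_simp

/-- The transformation law of the square of the eta function. -/
lemma etaSq_slash (γ : SL(2, ℤ)) : etaSq ∣[(1 : ℤ)] γ = etaMultiplier γ • etaSq := by
  have key (x : SL(2, ℤ)) (u : ℂ) (hx : etaSq ∣[(1 : ℤ)] x = u • etaSq)
      (hu : ∀ γ, etaMultiplier (γ * x) = etaMultiplier γ * u) (γ : SL(2, ℤ)) :
      etaSq ∣[(1 : ℤ)] γ = etaMultiplier γ • etaSq ↔
        etaSq ∣[(1 : ℤ)] (γ * x) = etaMultiplier (γ * x) • etaSq := by
    have e : (etaMultiplier γ • etaSq) ∣[(1 : ℤ)] x = etaMultiplier (γ * x) • etaSq := by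
      rw [ModularForm.SL_smul_slash, hx, hu, mul_smul]
    rw [SlashAction.slash_mul, ← e]
    refine ⟨fun h => by rw [h], fun h => ?_⟩
    have h' := congrArg (fun f => f ∣[(1 : ℤ)] x⁻¹) h
    simpa only [← SlashAction.slash_mul, mul_inv_cancel, SlashAction.slash_one,
      mul_inv_cancel_right] using h'
  have hmem : γ ∈ Subgroup.closure {ModularGroup.S, ModularGroup.T} := by
    simp [SpecialLinearGroup.SL2Z_generators]
  have hgen (x : SL(2, ℤ)) (hx : x ∈ ({ModularGroup.S, ModularGroup.T} : Set SL(2, ℤ))) :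
      ∃ u : ℂ, etaSq ∣[(1 : ℤ)] x = u • etaSq ∧
        ∀ γ, etaMultiplier (γ * x) = etaMultiplier γ * u := by
    rcases hx with rfl | rfl
    · exact ⟨_, etaSq_slash_S, etaMultiplier_mul_S⟩
    · exact ⟨_, etaSq_slash_T, etaMultiplier_mul_T⟩
  induction hmem using Subgroup.closure_induction_right with
  | one => rw [SlashAction.slash_one, etaMultiplier_one, one_smul]
  | mul_right γ _ x hx ih =>
    obtain ⟨u, h1, h2⟩ := hgen x hx
    exact (key x u h1 h2 γ).1 ih
  | mul_inv_cancel γ _ x hx ih =>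
    obtain ⟨u, h1, h2⟩ := hgen x hx
    refine (key x u h1 h2 (γ * x⁻¹)).2 ?_
    rwa [inv_mul_cancel_right]

end EtaMultiplier

/-! ### The Hecke operator at `ℓ` on multiples of powers of the eta function -/

section Hecke

open PowerSeries UpperHalfPlane

open scoped Manifold ModularForm

lemma hasQSeries_partitionSeries :
    HasQSeries (toComplexSeries partitionSeries) (fun z => (eulerFun z)⁻¹) := by
  set g : ℂ → ℂ := fun q => (∏' n : ℕ, (1 - q ^ (n + 1)))⁻¹ with hg
  have hne : ∀ q ∈ Metric.ball (0 : ℂ) 1, (∏' n : ℕ, (1 - q ^ (n + 1))) ≠ 0 := by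
    intro q hq
    have hq' : ‖q‖ < 1 := by simpa using hq
    have h1 : ∀ n : ℕ, 1 + -q ^ (n + 1) ≠ 0 := by
      intro n h
      have h2 : ‖q ^ (n + 1)‖ < 1 := by
        rw [norm_pow]
        exact pow_lt_one₀ (norm_nonneg _) hq' (Nat.succ_ne_zero n)
      rw [← sub_eq_add_neg, sub_eq_zero] at h
      rw [← h, norm_one] at h2
      exact lt_irrefl _ h2
    have h2 : Summable fun n : ℕ => ‖-q ^ (n + 1)‖ := by
      simpa using (summable_nat_add_iff 1).mpr (summable_geometric_of_lt_one (norm_nonneg _) hq')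
    simpa [sub_eq_add_neg] using tprod_one_add_ne_zero_of_summable h1 h2
  have hd : DifferentiableOn ℂ g (Metric.ball 0 1) :=
    ModularForm.differentiableOn_tprod_one_sub_pow.inv hne
  have hF : HasQSeries (PowerSeries.mk fun n => (n.factorial : ℂ)⁻¹ * iteratedDeriv n g 0)
      (fun z => (eulerFun z)⁻¹) := by
    intro τ
    have hq : Function.Periodic.qParam 1 τ ∈ Metric.ball (0 : ℂ) 1 := by
      simpa using Function.Periodic.norm_qParam_lt_one one_pos τ.im_pos
    have h := Complex.hasSum_taylorSeries_on_ball hd hq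
    change HasSum _ (g (Function.Periodic.qParam 1 τ))
    refine Eq.mpr (congrArg (fun s => HasSum s _) (funext fun m => ?_)) h
    rw [coeff_mk, sub_zero]
    simp only [smul_eq_mul]
    ring
  have h1 := (hF.mul hasQSeries_eulerFun).unique (G := 1) (by
    convert HasQSeries.one using 1
    funext z
    simp [eulerFun_ne_zero])
  have h2 := congrArg toComplexSeries partitionSeries_mul_eulerSeries
  rw [map_mul, map_one] at h2
  have h3 : toComplexSeries partitionSeries =
      PowerSeries.mk fun n => (n.factorial : ℂ)⁻¹ * iteratedDeriv n g 0 := by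
    linear_combination - toComplexSeries partitionSeries * h1 +
      (PowerSeries.mk fun n => (n.factorial : ℂ)⁻¹ * iteratedDeriv n g 0) * h2
  rw [h3]
  exact hF

lemma HasQSeries.slash_T {F : ℂ⟦X⟧} {h : ℍ → ℂ} (hF : HasQSeries F h) (w : ℤ) :
    h ∣[w] ModularGroup.T = h := by
  ext z
  have h1 : Function.Periodic.qParam 1 ((ModularGroup.T • z : ℍ) : ℂ) =
      Function.Periodic.qParam 1 z := by
    rw [modular_T_smul, coe_vadd, add_comm]
    simp [Function.Periodic.qParam, mul_add, Complex.exp_add]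
  have h2 := hF (ModularGroup.T • z)
  rw [h1] at h2
  rw [ModularForm.SL_slash_apply, h2.unique (hF z), ModularGroup.denom_apply, ModularGroup.coe_T]
  simp

lemma HasQSeries.X_pow (e : ℕ) :
    HasQSeries (X ^ e) (fun z => Function.Periodic.qParam 1 z ^ e) := fun τ => by
  refine Eq.mpr (congrArg (fun s => HasSum s _) (funext fun m => ?_))
    (hasSum_ite_eq e (Function.Periodic.qParam 1 τ ^ e))
  rw [coeff_X_pow]
  split_ifs with h
  · simp [h]
  · simp

section Points

variable (ℓ : ℕ) [NeZero ℓ]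

lemma cast_pos_of_neZero : (0 : ℝ) < ℓ := by exact_mod_cast Nat.pos_of_ne_zero (NeZero.ne ℓ)

lemma cast_ne_zero_of_neZero : (ℓ : ℂ) ≠ 0 := by exact_mod_cast NeZero.ne ℓ

/-- The point `(z + t) / ℓ` of the upper half plane. -/
noncomputable def divPoint (t : ℕ) (z : ℍ) : ℍ :=
  ⟨(z + t) / ℓ, by
    have h : ((z + t) / ℓ : ℂ) = ((ℓ : ℝ)⁻¹ : ℝ) * (z + t) := by
      push_cast
      ring
    rw [h, Complex.im_ofReal_mul]
    simpa using mul_pos (inv_pos.2 (cast_pos_of_neZero ℓ)) z.im_pos⟩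

/-- The point `ℓ z` of the upper half plane. -/
noncomputable def mulPoint (z : ℍ) : ℍ :=
  ⟨ℓ * z, by
    have h : (ℓ * z : ℂ) = ((ℓ : ℝ) : ℂ) * z := by push_cast; rfl
    rw [h, Complex.im_ofReal_mul]
    exact mul_pos (cast_pos_of_neZero ℓ) z.im_pos⟩

lemma coe_divPoint (t : ℕ) (z : ℍ) : (divPoint ℓ t z : ℂ) = (z + t) / ℓ := rfl

lemma coe_mulPoint (z : ℍ) : (mulPoint ℓ z : ℂ) = ℓ * z := rfl

lemma coe_S_smul (z : ℍ) : ((ModularGroup.S • z : ℍ) : ℂ) = -1 / z := by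
  rw [modular_S_smul]
  simp [neg_div, inv_neg]

lemma mulPoint_S_smul (z : ℍ) :
    mulPoint ℓ (ModularGroup.S • z) = ModularGroup.S • divPoint ℓ 0 z := by
  ext
  have h1 := cast_ne_zero_of_neZero ℓ
  have h2 := z.ne_zero
  rw [coe_mulPoint, coe_S_smul, coe_S_smul, coe_divPoint]
  push_cast
  field_simp
  simp [h2]

lemma divPoint_zero_S_smul (z : ℍ) :
    divPoint ℓ 0 (ModularGroup.S • z) = ModularGroup.S • mulPoint ℓ z := by
  ext
  have h1 := cast_ne_zero_of_neZero ℓ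
  have h2 := z.ne_zero
  rw [coe_divPoint, coe_S_smul, coe_S_smul, coe_mulPoint]
  push_cast
  field_simp
  simp

/-- The matrices that carry the translates `(z + 24 b') / ℓ` to the translates
`(- 1 / z + 24 b) / ℓ`. -/
lemma exists_divPoint_S_smul {b b' m : ℕ} (h : 576 * (b * b') + 1 = ℓ * m) :
    ∃ γ : SL(2, ℤ), γ 1 0 = ℓ ∧ (12 : ℤ) ∣ γ 0 0 ∧ (12 : ℤ) ∣ γ 1 1 ∧ ∀ z : ℍ,
      divPoint ℓ (24 * b) (ModularGroup.S • z) = γ • divPoint ℓ (24 * b') z ∧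
        denom γ (divPoint ℓ (24 * b') z) = z := by
  have h' : (576 * (b * b') + 1 : ℤ) = ℓ * m := by exact_mod_cast h
  obtain ⟨γ, g1, g2, g3, g4⟩ : ∃ γ : SL(2, ℤ), γ 0 0 = 24 * (b : ℤ) ∧ γ 0 1 = -(m : ℤ) ∧
      γ 1 0 = (ℓ : ℤ) ∧ γ 1 1 = -(24 * (b' : ℤ)) :=
    ⟨⟨!![24 * (b : ℤ), -(m : ℤ); (ℓ : ℤ), -(24 * (b' : ℤ))], by
      rw [Matrix.det_fin_two_of]
      linear_combination -h'⟩, rfl, rfl, rfl, rfl⟩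
  refine ⟨γ, g3, ⟨2 * b, by rw [g1]; ring⟩, ⟨-(2 * b'), by rw [g4]; ring⟩, fun z => ?_⟩
  have h1 := cast_ne_zero_of_neZero ℓ
  have h2 := z.ne_zero
  have h3 : (576 * (b * b') + 1 : ℂ) = ℓ * m := by exact_mod_cast h
  constructor
  · ext
    rw [coe_specialLinearGroup_apply, coe_divPoint, coe_divPoint, coe_S_smul, g1, g2, g3, g4]
    have hden : (ℓ : ℂ) * ((z + (24 * b' : ℕ)) / ℓ) + -(24 * b') = z := by
      push_cast
      field_simp
      ring
    simp only [algebraMap_int_eq, eq_intCast]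
    push_cast at hden ⊢
    rw [hden]
    field_simp
    linear_combination -h3
  · rw [ModularGroup.denom_apply, coe_divPoint, g3, g4]
    simp
    field_simp
    ring

end Points

lemma etaMultiplier_of_dvd {γ : SL(2, ℤ)} {n : ℕ} (hc : γ 1 0 = n) (ha : (12 : ℤ) ∣ γ 0 0)
    (hd : (12 : ℤ) ∣ γ 1 1) : etaMultiplier γ = (-Complex.I) ^ n := by
  have e3 : etaExpThree γ = 0 := by
    have h := det_eq_cast (ZMod 3) γ
    have ha' : ((γ 0 0 : ℤ) : ZMod 3) = 0 :=
      (ZMod.intCast_zmod_eq_zero_iff_dvd _ 3).2 (dvd_trans (by norm_num) ha)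
    have hd' : ((γ 1 1 : ℤ) : ZMod 3) = 0 :=
      (ZMod.intCast_zmod_eq_zero_iff_dvd _ 3).2 (dvd_trans (by norm_num) hd)
    simp only [etaExpThree]
    rw [ha', hd'] at h ⊢
    generalize ((γ 0 1 : ℤ) : ZMod 3) = b at *
    generalize ((γ 1 0 : ℤ) : ZMod 3) = c at *
    clear hc ha hd ha' hd'
    revert b c
    decide
  have e4 : etaExpFour γ = n := by
    have h := det_eq_cast (ZMod 4) γ
    have ha' : ((γ 0 0 : ℤ) : ZMod 4) = 0 :=
      (ZMod.intCast_zmod_eq_zero_iff_dvd _ 4).2 (dvd_trans (by norm_num) ha)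
    have hd' : ((γ 1 1 : ℤ) : ZMod 4) = 0 :=
      (ZMod.intCast_zmod_eq_zero_iff_dvd _ 4).2 (dvd_trans (by norm_num) hd)
    have hn : (n : ZMod 4) = ((γ 1 0 : ℤ) : ZMod 4) := by
      rw [hc]
      simp
    simp only [etaExpFour]
    rw [ha', hd'] at h ⊢
    rw [hn]
    generalize ((γ 0 1 : ℤ) : ZMod 4) = b at *
    generalize ((γ 1 0 : ℤ) : ZMod 4) = c at *
    clear hn hc ha hd ha' hd'
    revert b c
    decide
  rw [etaMultiplier, e3, e4, AddChar.map_zero_eq_one, one_mul, ← stdAddChar_neg_one_four,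
    ← AddChar.map_nsmul_eq_pow]
  simp

lemma etaSq_smul (γ : SL(2, ℤ)) (z : ℍ) :
    etaSq (γ • z) = etaMultiplier γ * (denom γ z * etaSq z) := by
  have h := congrFun (etaSq_slash γ) z
  rw [ModularForm.SL_slash_apply, zpow_neg, zpow_one, Pi.smul_apply, smul_eq_mul,
    mul_inv_eq_iff_eq_mul₀ (denom_ne_zero γ z)] at h
  rw [h]
  ring

lemma etaSq_pow_mul_smul {w : ℤ} (g : ModularForm 𝒮ℒ w) (s : ℕ) (γ : SL(2, ℤ)) (z : ℍ) :
    etaSq (γ • z) ^ s * g (γ • z) =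
      etaMultiplier γ ^ s * denom γ z ^ (w + s) * (etaSq z ^ s * g z) := by
  have h0 := denom_ne_zero γ z
  have h : g (γ • z) = denom γ z ^ w * g z := by
    have h1 := congrFun (g.slash_action_eq' _ ⟨γ, rfl⟩) z
    have h2 : ((g : ℍ → ℂ) ∣[w] γ) z = g z := h1
    rw [ModularForm.SL_slash_apply, zpow_neg, mul_inv_eq_iff_eq_mul₀ (zpow_ne_zero _ h0)] at h2
    rw [h2, mul_comm]
  rw [h, etaSq_smul, zpow_add₀ h0, zpow_natCast]
  ring

/-- The action of the Hecke operator attached to `ℓ` on functions which are invariant under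
`z ↦ z + 24`. The constant `c` is the factor of the second term. -/
noncomputable def heckeSum (ℓ : ℕ) [NeZero ℓ] (c : ℂ) (f : ℍ → ℂ) (z : ℍ) : ℂ :=
  (ℓ : ℂ)⁻¹ * ∑ b : ZMod ℓ, f (divPoint ℓ (24 * b.val) z) + c * f (mulPoint ℓ z)

/-- The Hecke operator preserves the transformation law under `z ↦ - 1 / z`: it exchanges the term
of `z / ℓ` with the one of `ℓ z` and permutes the other ones. -/
lemma heckeSum_S_smul {ℓ : ℕ} [Fact ℓ.Prime] (hℓ : 3 < ℓ) {f : ℍ → ℂ} {s : ℕ} {κ : ℤ}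
    (hf : ∀ (γ : SL(2, ℤ)) (z : ℍ), f (γ • z) = etaMultiplier γ ^ s * denom γ z ^ κ * f z)
    (z : ℍ) :
    heckeSum ℓ ((-1) ^ ((ℓ - 1) / 2 * s) * (ℓ : ℂ) ^ (κ - 1)) f (ModularGroup.S • z) =
      (-Complex.I) ^ (ℓ * s) * (z : ℂ) ^ κ *
        heckeSum ℓ ((-1) ^ ((ℓ - 1) / 2 * s) * (ℓ : ℂ) ^ (κ - 1)) f z := by
  have hp : ℓ.Prime := Fact.out
  have hℓ0 : (ℓ : ℂ) ≠ 0 := cast_ne_zero_of_neZero ℓ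
  have hz0 := z.ne_zero
  set ε : ℂ := (-1) ^ ((ℓ - 1) / 2 * s) with hε
  have hε2 : ε * ε = 1 := by
    rw [hε, ← mul_pow]
    norm_num
  have hεI : (-Complex.I) ^ (ℓ * s) = ε * (-Complex.I) ^ s := by
    obtain ⟨j, hj⟩ := hp.odd_of_ne_two (by lia)
    have e : (ℓ - 1) / 2 = j := by lia
    rw [hε, e, hj, add_mul, one_mul, pow_add, mul_assoc, pow_mul]
    simp
  have hSm : etaMultiplier ModularGroup.S = -Complex.I := by
    rw [← one_mul ModularGroup.S, etaMultiplier_mul_S, etaMultiplier_one, one_mul]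
  -- The nonzero residues are permuted by `b ↦ - 1 / (576 b)`.
  have h576 : (576 : ZMod ℓ) ≠ 0 := by
    have h := (ZMod.natCast_eq_zero_iff 576 ℓ).not.2 (fun hd => by
      rw [show 576 = 2 ^ 6 * 3 ^ 2 by norm_num] at hd
      rcases (Nat.Prime.dvd_mul hp).1 hd with h | h
      · have := Nat.le_of_dvd (by norm_num) (hp.dvd_of_dvd_pow h)
        lia
      · have := Nat.le_of_dvd (by norm_num) (hp.dvd_of_dvd_pow h)
        lia)
    exact_mod_cast h
  let ι : ZMod ℓ → ZMod ℓ := fun b => -(576 * b)⁻¹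
  have hι : Function.Involutive ι := fun b => by
    simp only [ι, mul_inv, mul_neg, neg_neg, inv_neg, inv_inv]
    field_simp
  have h0 : f (divPoint ℓ (24 * (0 : ZMod ℓ).val) (ModularGroup.S • z)) =
      (-Complex.I) ^ s * (ℓ * (z : ℂ)) ^ κ * f (mulPoint ℓ z) := by
    rw [ZMod.val_zero, mul_zero, divPoint_zero_S_smul, hf, hSm, ModularGroup.denom_S, coe_mulPoint]
  have hb (b : ZMod ℓ) (hb : b ≠ 0) : f (divPoint ℓ (24 * b.val) (ModularGroup.S • z)) =
      (-Complex.I) ^ (ℓ * s) * (z : ℂ) ^ κ * f (divPoint ℓ (24 * (ι b).val) z) := by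
    have hd : ℓ ∣ 576 * (b.val * (ι b).val) + 1 := by
      rw [← ZMod.natCast_eq_zero_iff]
      push_cast
      rw [ZMod.natCast_zmod_val, ZMod.natCast_zmod_val]
      simp only [ι]
      field_simp
      simp
    obtain ⟨m, hm⟩ := hd
    obtain ⟨γ, h1, h2, h3, h4⟩ := exists_divPoint_S_smul ℓ hm
    rw [(h4 z).1, hf, (h4 z).2, etaMultiplier_of_dvd h1 h2 h3, pow_mul]
  have hm : f (mulPoint ℓ (ModularGroup.S • z)) =
      (-Complex.I) ^ s * ((z : ℂ) / ℓ) ^ κ * f (divPoint ℓ (24 * (0 : ZMod ℓ).val) z) := by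
    rw [mulPoint_S_smul, hf, hSm, ModularGroup.denom_S, coe_divPoint, ZMod.val_zero]
    simp
  have hsum : ∑ b ∈ Finset.univ.erase (0 : ZMod ℓ), f (divPoint ℓ (24 * b.val) (ModularGroup.S • z))
      = (-Complex.I) ^ (ℓ * s) * (z : ℂ) ^ κ *
        ∑ b ∈ Finset.univ.erase (0 : ZMod ℓ), f (divPoint ℓ (24 * b.val) z) := by
    rw [Finset.mul_sum]
    refine Finset.sum_bij (fun b _ => ι b) (fun b h => ?_) (fun a _ b _ h => hι.injective h)
      (fun b h => ⟨ι b, ?_, hι b⟩) (fun b h => hb b (Finset.ne_of_mem_erase h))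
    · have := Finset.ne_of_mem_erase h
      simp [ι, h576, this]
    · have := Finset.ne_of_mem_erase h
      simp [ι, h576, this]
  simp only [heckeSum]
  rw [← Finset.add_sum_erase _ _ (Finset.mem_univ (0 : ZMod ℓ)),
    ← Finset.add_sum_erase _ (fun b : ZMod ℓ => f (divPoint ℓ (24 * b.val) z))
      (Finset.mem_univ (0 : ZMod ℓ)), hsum, h0, hm, hεI, mul_zpow, div_zpow, zpow_sub_one₀ hℓ0]
  have hk : (ℓ : ℂ) ^ κ ≠ 0 := zpow_ne_zero _ hℓ0
  field_simp
  linear_combination (-((ℓ : ℂ) ^ κ * f (mulPoint ℓ z))) * hε2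

/-- The power series formed by the coefficients whose index is congruent to `β` modulo `ℓ`. -/
noncomputable def progression {R : Type*} [CommRing R] (ℓ β : ℕ) (F : R⟦X⟧) : R⟦X⟧ :=
  PowerSeries.mk fun m => coeff (ℓ * m + β) F

/-- Averaging over the translates `(z + 24 b) / ℓ` extracts the coefficients in a progression. -/
lemma hasQSeries_progression {A : ℂ⟦X⟧} {a : ℍ → ℂ} (hA : HasQSeries A a) {ℓ β S S' : ℕ}
    [Fact ℓ.Prime] (hℓ : 3 < ℓ) (hβ : β < ℓ) (hS : 24 * β + S = ℓ * S') :
    HasQSeries (progression ℓ β A) (fun z => (Function.Periodic.qParam 24 z ^ S')⁻¹ *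
      ((ℓ : ℂ)⁻¹ * ∑ b : ZMod ℓ, Function.Periodic.qParam 24 (divPoint ℓ (24 * b.val) z) ^ S *
        a (divPoint ℓ (24 * b.val) z))) := by
  intro z
  have hp : ℓ.Prime := Fact.out
  have hℓ0 : (ℓ : ℂ) ≠ 0 := cast_ne_zero_of_neZero ℓ
  have h1 := ((hasSum_sum (s := Finset.univ) fun (b : ZMod ℓ) _ =>
    (hA (divPoint ℓ (24 * b.val) z)).mul_left
      (Function.Periodic.qParam 24 (divPoint ℓ (24 * b.val) z) ^ S)).mul_left (ℓ : ℂ)⁻¹).mul_left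
        (Function.Periodic.qParam 24 z ^ S')⁻¹
  have hi : Function.Injective (fun m : ℕ => ℓ * m + β) := fun m n h => by
    have h' : ℓ * m + β = ℓ * n + β := h
    exact Nat.eq_of_mul_eq_mul_left hp.pos (Nat.add_right_cancel h')
  -- Orthogonality of the additive characters picks out the progression.
  have hterm (n : ℕ) : ∑ b : ZMod ℓ, Function.Periodic.qParam 24 (divPoint ℓ (24 * b.val) z) ^ S *
      coeff n A • Function.Periodic.qParam 1 (divPoint ℓ (24 * b.val) z) ^ n =
      coeff n A * Complex.exp (2 * Real.pi * Complex.I * (24 * n + S) * z / (24 * ℓ)) *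
        if ((24 * n + S : ℕ) : ZMod ℓ) = 0 then (ℓ : ℂ) else 0 := by
    have h2 := AddChar.sum_mulShift ((24 * n + S : ℕ) : ZMod ℓ) (ZMod.isPrimitive_stdAddChar ℓ)
    rw [ZMod.card] at h2
    have h3 : (if ((24 * n + S : ℕ) : ZMod ℓ) = 0 then (ℓ : ℂ) else 0) =
        ((if ((24 * n + S : ℕ) : ZMod ℓ) = 0 then ℓ else 0 : ℕ) : ℂ) := by
      split_ifs <;> simp
    rw [h3, ← h2, Finset.mul_sum]
    refine Finset.sum_congr rfl fun b _ => ?_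
    have h4 := ZMod.stdAddChar_coe (N := ℓ) ((b.val * (24 * n + S) : ℕ) : ℤ)
    rw [Int.cast_natCast, Nat.cast_mul, ZMod.natCast_zmod_val] at h4
    rw [h4, smul_eq_mul, mul_assoc, ← Complex.exp_add, mul_left_comm]
    simp only [Function.Periodic.qParam, ← Complex.exp_nat_mul, ← Complex.exp_add, coe_divPoint]
    congr 2
    push_cast
    field_simp
    ring
  refine Eq.mpr (congrArg (fun s => HasSum s _) (funext fun m => ?_))
    ((hi.hasSum_iff fun n hn => ?_).2 h1)
  · have h5 : ((24 * (ℓ * m + β) + S : ℕ) : ZMod ℓ) = 0 := by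
      rw [ZMod.natCast_eq_zero_iff]
      exact ⟨24 * m + S', by linear_combination hS⟩
    simp only [Function.comp_apply]
    rw [hterm, if_pos h5, progression, coeff_mk, smul_eq_mul]
    have h6 : Complex.exp (2 * Real.pi * Complex.I * (24 * (ℓ * m + β : ℕ) + S) * z / (24 * ℓ)) =
        Function.Periodic.qParam 24 z ^ S' * Function.Periodic.qParam 1 z ^ m := by
      have hS' : (24 * β + S : ℂ) = ℓ * S' := by exact_mod_cast hS
      simp only [Function.Periodic.qParam, ← Complex.exp_nat_mul, ← Complex.exp_add]
      congr 1
      push_cast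
      field_simp
      linear_combination (z : ℂ) * hS'
    have h7 : Function.Periodic.qParam 24 z ≠ 0 := Function.Periodic.qParam_ne_zero _
    rw [h6]
    field_simp
  · have h5 : ((24 * n + S : ℕ) : ZMod ℓ) ≠ 0 := by
      rw [Ne, ZMod.natCast_eq_zero_iff]
      intro hd
      refine hn ⟨n / ℓ, ?_⟩
      have h6 : (ℓ : ℤ) ∣ 24 * ((n : ℤ) - β) := by
        have h7 : (ℓ : ℤ) ∣ 24 * n + S := by exact_mod_cast hd
        have h8 : (24 * β + S : ℤ) = ℓ * S' := by exact_mod_cast hS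
        have h9 : (ℓ : ℤ) ∣ 24 * β + S := ⟨S', h8⟩
        have := dvd_sub h7 h9
        rwa [show (24 * n + S - (24 * β + S) : ℤ) = 24 * ((n : ℤ) - β) by ring] at this
      have h7 : ¬ (ℓ : ℤ) ∣ 24 := by
        intro h
        have h8 : ℓ ∣ 2 ^ 3 * 3 := by exact_mod_cast h
        rcases (Nat.Prime.dvd_mul hp).1 h8 with h | h
        · have := Nat.le_of_dvd (by norm_num) (hp.dvd_of_dvd_pow h)
          lia
        · have := Nat.le_of_dvd (by norm_num) h
          lia
      have h8 : (ℓ : ℤ) ∣ (n : ℤ) - β :=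
        ((Nat.prime_iff_prime_int.1 hp).dvd_or_dvd h6).resolve_left h7
      have h9 : n % ℓ = β := by
        have h10 : n ≡ β [MOD ℓ] := ((Nat.modEq_iff_dvd).2 h8).symm
        rw [h10, Nat.mod_eq_of_lt hβ]
      have := Nat.div_add_mod n ℓ
      simp only
      lia
    rw [hterm, if_neg h5]
    simp

lemma hasQSeries_expand {A : ℂ⟦X⟧} {a : ℍ → ℂ} (hA : HasQSeries A a) (ℓ : ℕ) [NeZero ℓ] :
    HasQSeries (expand ℓ (NeZero.ne ℓ) A) (fun z => a (mulPoint ℓ z)) := by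
  intro z
  have hi : Function.Injective (fun m : ℕ => ℓ * m) :=
    fun m n h => Nat.eq_of_mul_eq_mul_left (Nat.pos_of_ne_zero (NeZero.ne ℓ)) h
  refine (hi.hasSum_iff fun n hn => ?_).1 ?_
  · rw [coeff_expand_of_not_dvd _ _ _ fun ⟨m, hm⟩ => hn ⟨m, hm.symm⟩, zero_smul]
  · refine Eq.mpr (congrArg (fun s => HasSum s _) (funext fun m => ?_)) (hA (mulPoint ℓ z))
    simp only [Function.comp_apply]
    rw [coeff_expand_mul]
    congr 1
    simp only [Function.Periodic.qParam, ← Complex.exp_nat_mul, coe_mulPoint]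
    congr 1
    push_cast
    ring

lemma etaSq_eq (z : ℍ) : etaSq z = Function.Periodic.qParam 24 z ^ 2 * eulerFun z ^ 2 := by
  rw [etaSq, eta_eq, mul_pow]

lemma etaSq_ne_zero (z : ℍ) : etaSq z ≠ 0 := pow_ne_zero _ (ModularForm.eta_ne_zero z.2)

lemma qParam_twentyFour_pow (z : ℍ) :
    Function.Periodic.qParam 24 z ^ 24 = Function.Periodic.qParam 1 z := by
  simp only [Function.Periodic.qParam, ← Complex.exp_nat_mul]
  congr 1
  push_cast
  ring

/-- The product of an even power of the eta function and a modular form of level one is mapped by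
the Hecke operator to a product of the same kind. -/
lemma IsLevelOne.hecke {w : ℤ} {F : ℚ⟦X⟧} (hF : IsLevelOne w F) {ℓ β s s' e : ℕ} (hp : ℓ.Prime)
    (hℓ : 3 < ℓ) (hβ : β < ℓ) (h1 : 12 * β + s = ℓ * s') (h2 : ℓ * s = s' + 12 * e) :
    IsLevelOne (w + s - s') (partitionSeries ^ (2 * s') *
      (progression ℓ β (eulerSeries ^ (2 * s) * F) +
        C ((-1) ^ ((ℓ - 1) / 2 * s) * (ℓ : ℚ) ^ (w + s - 1)) *
          (X ^ e * expand ℓ hp.ne_zero (eulerSeries ^ (2 * s) * F)))) := by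
  have : Fact ℓ.Prime := ⟨hp⟩
  obtain ⟨g, hg⟩ := hF
  set c : ℂ := (-1) ^ ((ℓ - 1) / 2 * s) * (ℓ : ℂ) ^ (w + s - 1) with hc
  let f : ℍ → ℂ := fun z => etaSq z ^ s * g z
  let G : ℍ → ℂ := fun z => heckeSum ℓ c f z / etaSq z ^ s'
  have hA : HasQSeries (toComplexSeries (eulerSeries ^ (2 * s) * F)) (eulerFun ^ (2 * s) * g) := by
    rw [map_mul, map_pow]
    exact (hasQSeries_eulerFun.pow _).mul hg
  have hq : HasQSeries (toComplexSeries (partitionSeries ^ (2 * s') *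
      (progression ℓ β (eulerSeries ^ (2 * s) * F) +
        C ((-1) ^ ((ℓ - 1) / 2 * s) * (ℓ : ℚ) ^ (w + s - 1)) *
          (X ^ e * expand ℓ hp.ne_zero (eulerSeries ^ (2 * s) * F))))) G := by
    have h3 := (hasQSeries_partitionSeries.pow (2 * s')).mul
      ((hasQSeries_progression hA hℓ hβ (S := 2 * s) (S' := 2 * s') (by lia)).add
        (((HasQSeries.X_pow e).mul (hasQSeries_expand hA ℓ)).smul c))
    have e1 : toComplexSeries (progression ℓ β (eulerSeries ^ (2 * s) * F)) =
        progression ℓ β (toComplexSeries (eulerSeries ^ (2 * s) * F)) := by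
      ext m
      simp only [progression, coeff_map, coeff_mk]
    have e2 : (((-1) ^ ((ℓ - 1) / 2 * s) * (ℓ : ℚ) ^ (w + s - 1) : ℚ) : ℂ) = c := by
      rw [hc]
      push_cast
      rfl
    rw [map_mul, map_pow, map_add, toComplexSeries_C_mul, e1, e2, map_mul toComplexSeries (X ^ e),
      map_pow, PowerSeries.map_X, PowerSeries.map_expand]
    convert h3 using 1
    funext z
    have h4 : Function.Periodic.qParam 24 z ≠ 0 := Function.Periodic.qParam_ne_zero _
    have h5 : Function.Periodic.qParam 24 (mulPoint ℓ z) ^ (2 * s) =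
        Function.Periodic.qParam 24 z ^ (2 * s') * Function.Periodic.qParam 1 z ^ e := by
      have h6 : Function.Periodic.qParam 24 (mulPoint ℓ z) = Function.Periodic.qParam 24 z ^ ℓ := by
        simp only [Function.Periodic.qParam, ← Complex.exp_nat_mul, coe_mulPoint]
        congr 1
        ring
      rw [h6, ← qParam_twentyFour_pow, ← pow_mul, ← pow_mul, ← pow_add,
        show 2 * s' + 24 * e = ℓ * (2 * s) by lia]
    have h6 (z : ℍ) : f z = Function.Periodic.qParam 24 z ^ (2 * s) *
        (eulerFun z ^ (2 * s) * g z) := by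
      simp only [f]
      rw [etaSq_eq, ← mul_pow, ← pow_mul, mul_pow, mul_assoc]
    have h7 := eulerFun_ne_zero z
    simp only [G, heckeSum, Pi.mul_apply, Pi.pow_apply, Pi.add_apply, Pi.smul_apply, smul_eq_mul,
      inv_pow]
    simp only [h6, h5]
    rw [etaSq_eq, ← mul_pow, ← pow_mul, mul_pow]
    field_simp
  have hS : G ∣[w + s - s'] ModularGroup.S = G := by
    ext z
    have h3 := heckeSum_S_smul (f := f) hℓ (etaSq_pow_mul_smul g s) z
    rw [← hc] at h3
    have h4 : (-Complex.I) ^ (ℓ * s) = (-Complex.I) ^ s' := by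
      rw [h2, pow_add, show 12 * e = 4 * (3 * e) by ring, pow_mul _ 4, Even.neg_pow (n := 4) (by decide),
        Complex.I_pow_four, one_pow, mul_one]
    have hSm : etaMultiplier ModularGroup.S = -Complex.I := by
      rw [← one_mul ModularGroup.S, etaMultiplier_mul_S, etaMultiplier_one, one_mul]
    have h5 := z.ne_zero
    have h6 := etaSq_ne_zero z
    have h7 : (-Complex.I) ^ s' ≠ 0 := pow_ne_zero _ (neg_ne_zero.2 Complex.I_ne_zero)
    rw [ModularForm.SL_slash_apply, ModularGroup.denom_S]
    simp only [G]
    rw [h3, h4, etaSq_smul, hSm, ModularGroup.denom_S, zpow_neg, zpow_sub₀ h5, zpow_natCast,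
      mul_pow, mul_pow]
    have h8 : (z : ℂ) ^ (w + s) ≠ 0 := zpow_ne_zero _ h5
    field_simp
  obtain ⟨k, hk⟩ := exists_modularForm hS (hq.slash_T _) hq.mdiff hq.isBoundedAtImInfty
  exact ⟨k, by rw [hk]; exact hq⟩

end Hecke

/-! ### Integrality and the Frobenius congruence -/

section Integrality

open PowerSeries

/-- The power series with integral coefficients. -/
noncomputable def intSeries : Subring ℚ⟦X⟧ := (PowerSeries.map (Int.castRingHom ℚ)).range

lemma mem_intSeries_iff {F : ℚ⟦X⟧} : F ∈ intSeries ↔ ∀ n, ∃ a : ℤ, coeff n F = a := by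
  constructor
  · rintro ⟨G, rfl⟩ n
    exact ⟨coeff n G, by simp⟩
  · intro h
    choose a ha using h
    exact ⟨PowerSeries.mk a, by ext n; simp [ha]⟩

lemma C_intCast_mem_intSeries (a : ℤ) : C (a : ℚ) ∈ intSeries := ⟨C a, by simp⟩

lemma qDeriv_mem_intSeries {F : ℚ⟦X⟧} (hF : F ∈ intSeries) : qDeriv F ∈ intSeries := by
  rw [mem_intSeries_iff] at hF ⊢
  intro n
  obtain ⟨a, ha⟩ := hF n
  exact ⟨n * a, by rw [coeff_qDeriv, ha]; push_cast; ring⟩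

lemma progression_mem_intSeries {F : ℚ⟦X⟧} (hF : F ∈ intSeries) (ℓ β : ℕ) :
    progression ℓ β F ∈ intSeries := by
  rw [mem_intSeries_iff] at hF ⊢
  exact fun n => by simpa only [progression, coeff_mk] using hF (ℓ * n + β)

lemma expand_mem_intSeries {F : ℚ⟦X⟧} (hF : F ∈ intSeries) {ℓ : ℕ} (hℓ : ℓ ≠ 0) :
    expand ℓ hℓ F ∈ intSeries := by
  obtain ⟨G, rfl⟩ := hF
  exact ⟨expand ℓ hℓ G, PowerSeries.map_expand ..⟩

lemma sigmaSeries_mem_intSeries (k : ℕ) : sigmaSeries k ∈ intSeries :=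
  mem_intSeries_iff.2 fun n => ⟨ArithmeticFunction.sigma k n, by simp [sigmaSeries]⟩

lemma partitionSeries_mem_intSeries : partitionSeries ∈ intSeries :=
  mem_intSeries_iff.2 fun n => ⟨Fintype.card n.Partition, by simp [partitionSeries]⟩

lemma rankMomentSeries_mem_intSeries (k : ℕ) : rankMomentSeries k ∈ intSeries :=
  mem_intSeries_iff.2 fun n => ⟨rankMoment k n, by simp [rankMomentSeries]⟩

lemma X_mem_intSeries : (X : ℚ⟦X⟧) ∈ intSeries := ⟨X, by simp⟩

lemma eulerSeries_mem_intSeries : eulerSeries ∈ intSeries := by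
  obtain ⟨G, hG⟩ := partitionSeries_mem_intSeries
  have h0 : constantCoeff G = ((1 : ℤˣ) : ℤ) := by
    have h1 := constantCoeff_partitionSeries
    rw [← hG, ← coeff_zero_eq_constantCoeff_apply, coeff_map] at h1
    simpa using h1
  have h1 := congrArg (PowerSeries.map (Int.castRingHom ℚ)) (mul_invOfUnit G 1 h0)
  rw [map_mul, hG, map_one] at h1
  have h2 := partitionSeries_mul_eulerSeries
  refine ⟨invOfUnit G 1, ?_⟩
  linear_combination eulerSeries * h1 - PowerSeries.map (Int.castRingHom ℚ) (invOfUnit G 1) * h2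

section Local

variable (ℓ : ℕ) [Fact ℓ.Prime]

/-- The power series with bounded denominators prime to `ℓ`. -/
noncomputable def locSeries : Subring ℚ⟦X⟧ where
  carrier := {F | ∃ N : ℕ, ¬ ℓ ∣ N ∧ C (N : ℚ) * F ∈ intSeries}
  mul_mem' := by
    rintro F G ⟨M, hM, hF⟩ ⟨N, hN, hG⟩
    refine ⟨M * N, fun h => ?_, ?_⟩
    · exact ((Nat.Prime.dvd_mul Fact.out).1 h).elim hM hN
    · have := mul_mem hF hG
      convert this using 1
      push_cast
      rw [map_mul]
      ring
  one_mem' := ⟨1, (Nat.Prime.one_lt Fact.out).ne' ∘ Nat.dvd_one.1, by simp [one_mem]⟩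
  add_mem' := by
    rintro F G ⟨M, hM, hF⟩ ⟨N, hN, hG⟩
    refine ⟨M * N, fun h => ?_, ?_⟩
    · exact ((Nat.Prime.dvd_mul Fact.out).1 h).elim hM hN
    · have := add_mem (mul_mem (C_intCast_mem_intSeries N) hF)
        (mul_mem (C_intCast_mem_intSeries M) hG)
      convert this using 1
      push_cast
      rw [map_mul]
      ring
  zero_mem' := ⟨1, (Nat.Prime.one_lt Fact.out).ne' ∘ Nat.dvd_one.1, by simp [zero_mem]⟩
  neg_mem' := by
    rintro F ⟨M, hM, hF⟩
    exact ⟨M, hM, by simpa using neg_mem hF⟩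

lemma intSeries_le_locSeries : intSeries ≤ locSeries ℓ := fun F hF =>
  ⟨1, (Nat.Prime.one_lt Fact.out).ne' ∘ Nat.dvd_one.1, by simpa using hF⟩

/-- The rational numbers with denominator prime to `ℓ`. -/
noncomputable def locRat : Subring ℚ := (locSeries ℓ).comap (C : ℚ →+* ℚ⟦X⟧)

variable {ℓ}

lemma C_mem_locSeries {a : ℚ} (ha : a ∈ locRat ℓ) : C a ∈ locSeries ℓ := ha

lemma inv_natCast_mem_locRat {n : ℕ} (hn : ¬ ℓ ∣ n) : (n : ℚ)⁻¹ ∈ locRat ℓ := by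
  refine ⟨n, hn, ?_⟩
  have h0 : (n : ℚ) ≠ 0 := by
    rintro h
    rw [Nat.cast_eq_zero] at h
    exact hn (h ▸ dvd_zero ℓ)
  rw [← map_mul, mul_inv_cancel₀ h0, map_one]
  exact one_mem _

lemma div_natCast_mem_locRat {a : ℚ} (ha : a ∈ locRat ℓ) {n : ℕ} (hn : ¬ ℓ ∣ n) :
    a / n ∈ locRat ℓ := mul_mem ha (inv_natCast_mem_locRat hn)

lemma not_dvd_den_of_coeff {F : ℚ⟦X⟧} (hF : F ∈ locSeries ℓ) (n : ℕ) : ¬ ℓ ∣ (coeff n F).den := by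
  obtain ⟨N, hN, hF⟩ := hF
  obtain ⟨a, ha⟩ := mem_intSeries_iff.1 hF n
  rw [coeff_C_mul] at ha
  have h0 : (N : ℤ) ≠ 0 := by
    rintro h
    rw [Nat.cast_eq_zero] at h
    exact hN (h ▸ dvd_zero ℓ)
  have h1 : coeff n F = Rat.divInt a N := by
    rw [Rat.divInt_eq_div, eq_div_iff (by exact_mod_cast h0)]
    push_cast
    linarith
  have h2 : ((coeff n F).den : ℤ) ∣ N := by
    rw [h1]
    exact Rat.den_dvd _ _
  exact fun h => hN (h.trans (by exact_mod_cast h2))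

lemma not_dvd_den_of_mem {a : ℚ} (ha : a ∈ locRat ℓ) : ¬ ℓ ∣ a.den := by
  simpa using not_dvd_den_of_coeff (C_mem_locSeries ha) 0

/-- An element of `locRat ℓ` is congruent to an integer modulo `ℓ`. -/
lemma exists_int_sub_eq {a : ℚ} (ha : a ∈ locRat ℓ) :
    ∃ c : ℤ, ∃ b ∈ locRat ℓ, a - c = ℓ * b := by
  have h1 := not_dvd_den_of_mem ha
  have hcop : IsCoprime (a.den : ℤ) (ℓ : ℤ) :=
    Nat.isCoprime_iff_coprime.2 ((Nat.Prime.coprime_iff_not_dvd Fact.out).2 h1).symm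
  obtain ⟨u, v, huv⟩ := hcop
  refine ⟨a.num * u, a.num * v / a.den, ?_, ?_⟩
  · exact div_natCast_mem_locRat (by exact_mod_cast intCast_mem (locRat ℓ) (a.num * v)) h1
  · have h0 : (a.den : ℚ) ≠ 0 := by exact_mod_cast a.den_nz
    have huv' : (u * a.den + v * ℓ : ℚ) = 1 := by exact_mod_cast huv
    have h2 := Rat.mul_den_eq_num a
    field_simp
    push_cast
    linear_combination h2 - (a.num : ℚ) * huv'

lemma qDeriv_C_mul (a : ℚ) (F : ℚ⟦X⟧) : qDeriv (C a * F) = C a * qDeriv F := by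
  ext n
  simp only [coeff_qDeriv, coeff_C_mul]
  ring

lemma qDeriv_mem_locSeries {F : ℚ⟦X⟧} (hF : F ∈ locSeries ℓ) : qDeriv F ∈ locSeries ℓ := by
  obtain ⟨N, hN, hF⟩ := hF
  exact ⟨N, hN, by rw [← qDeriv_C_mul]; exact qDeriv_mem_intSeries hF⟩

lemma progression_C_mul (a : ℚ) (F : ℚ⟦X⟧) (n β : ℕ) :
    progression n β (C a * F) = C a * progression n β F := by
  ext m
  simp only [progression, coeff_mk, coeff_C_mul]

lemma progression_add (F G : ℚ⟦X⟧) (n β : ℕ) :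
    progression n β (F + G) = progression n β F + progression n β G := by
  ext m
  simp only [progression, coeff_mk, map_add]

lemma progression_mem_locSeries {F : ℚ⟦X⟧} (hF : F ∈ locSeries ℓ) (n β : ℕ) :
    progression n β F ∈ locSeries ℓ := by
  obtain ⟨N, hN, hF⟩ := hF
  exact ⟨N, hN, by rw [← progression_C_mul]; exact progression_mem_intSeries hF _ _⟩

end Local

/-- The part of a product with a series in `q ^ ℓ` whose exponents lie in an arithmetic
progression. -/
lemma progression_expand_mul {R : Type*} [CommRing R] {ℓ β : ℕ} (hℓ : ℓ ≠ 0) (hβ : β < ℓ)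
    (F G : R⟦X⟧) : progression ℓ β (expand ℓ hℓ F * G) = F * progression ℓ β G := by
  ext m
  rw [progression, coeff_mk, coeff_mul, coeff_mul]
  symm
  refine Finset.sum_of_injOn (fun p => (ℓ * p.1, ℓ * p.2 + β)) (fun p _ q _ h => ?_)
    (fun p hp => ?_) (fun p hp hp' => ?_) (fun p hp => ?_)
  · rw [Prod.mk.injEq] at h
    have h1 := Nat.eq_of_mul_eq_mul_left (Nat.pos_of_ne_zero hℓ) h.1
    have h2 := Nat.eq_of_mul_eq_mul_left (Nat.pos_of_ne_zero hℓ) (Nat.add_right_cancel h.2)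
    exact Prod.ext h1 h2
  · have h := Finset.HasAntidiagonal.mem_antidiagonal.1 hp
    refine Finset.mem_coe.2 (Finset.HasAntidiagonal.mem_antidiagonal.2 ?_)
    simp only
    rw [← h]
    ring
  · rw [coeff_expand_of_not_dvd, zero_mul]
    rintro ⟨a, ha⟩
    refine hp' ⟨(a, m - a), ?_, ?_⟩
    · have h := Finset.HasAntidiagonal.mem_antidiagonal.1 hp
      rw [ha] at h
      have h2 : a ≤ m := by
        by_contra h3
        have h4 : ℓ * (m + 1) ≤ ℓ * a := Nat.mul_le_mul_left _ (by lia)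
        rw [mul_add, mul_one] at h4
        lia
      exact Finset.mem_coe.2 (Finset.HasAntidiagonal.mem_antidiagonal.2 (by simp only; lia))
    · have h := Finset.HasAntidiagonal.mem_antidiagonal.1 hp
      rw [ha] at h
      have h2 : a ≤ m := by
        by_contra h3
        have h4 : ℓ * (m + 1) ≤ ℓ * a := Nat.mul_le_mul_left _ (by lia)
        rw [mul_add, mul_one] at h4
        lia
      refine Prod.ext ha.symm ?_
      simp only
      rw [Nat.mul_sub]
      have := Nat.mul_le_mul_left ℓ h2
      lia
  · simp only [coeff_expand_mul, progression, coeff_mk]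

/-- The Frobenius congruence for integral power series. -/
lemma exists_pow_sub_expand {F : ℚ⟦X⟧} (hF : F ∈ intSeries) {ℓ : ℕ} (hℓ : ℓ.Prime) :
    ∃ H ∈ intSeries, F ^ ℓ - expand ℓ hℓ.ne_zero F = C (ℓ : ℚ) * H := by
  have : Fact ℓ.Prime := ⟨hℓ⟩
  obtain ⟨G, rfl⟩ := hF
  have h1 : PowerSeries.map (Int.castRingHom (ZMod ℓ)) (G ^ ℓ - expand ℓ hℓ.ne_zero G) = 0 := by
    rw [map_sub, map_pow, PowerSeries.map_expand, sub_eq_zero]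
    have h := MvPowerSeries.map_frobenius_expand (σ := Unit) (R := ZMod ℓ) ℓ hℓ.ne_zero
      (f := PowerSeries.map (Int.castRingHom (ZMod ℓ)) G)
    rw [ZMod.frobenius_zmod, MvPowerSeries.map_id] at h
    exact h.symm
  have h2 : ∀ n, ∃ a : ℤ, coeff n (G ^ ℓ - expand ℓ hℓ.ne_zero G) = ℓ * a := by
    intro n
    have h3 := congrArg (coeff n) h1
    rw [coeff_map, map_zero, eq_intCast, ZMod.intCast_zmod_eq_zero_iff_dvd] at h3
    exact h3
  choose a ha using h2
  refine ⟨PowerSeries.map (Int.castRingHom ℚ) (PowerSeries.mk a), ⟨_, rfl⟩, ?_⟩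
  rw [← map_pow, ← PowerSeries.map_expand, ← map_sub]
  ext n
  rw [coeff_map, ha, coeff_C_mul, coeff_map, coeff_mk]
  simp

end Integrality

/-! ### Sums of modular forms modulo `ℓ` -/

section LevelOneSums

open PowerSeries

section Bernoulli

variable {ℓ : ℕ} [Fact ℓ.Prime]

lemma inv_prime_mem_locRat {p : ℕ} (hp : p.Prime) (h : p ≠ ℓ) : (1 : ℚ) / p ∈ locRat ℓ := by
  rw [one_div]
  exact inv_natCast_mem_locRat fun hd => h ((Nat.prime_dvd_prime_iff_eq Fact.out hp).1 hd).symm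

/-- One half of the von Staudt-Clausen theorem. -/
lemma bernoulli_mem_locRat {k : ℕ} (h : ¬ (ℓ - 1) ∣ 2 * k) : bernoulli (2 * k) ∈ locRat ℓ := by
  obtain ⟨a, ha⟩ := Bernoulli.vonStaudt_clausen k
  rw [← sub_eq_iff_eq_add] at ha
  rw [← ha]
  refine sub_mem (intCast_mem _ _) (sum_mem fun p hp => ?_)
  simp only [Finset.mem_filter] at hp
  refine inv_prime_mem_locRat hp.2.1 fun e => h (e ▸ hp.2.2)

/-- The other half of the von Staudt-Clausen theorem: `ℓ B_{ℓ - 1} ≡ -1` modulo `ℓ`. -/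
lemma exists_mul_bernoulli_add_one {h : ℕ} (hh : ℓ = 2 * h + 1) :
    ∃ b ∈ locRat ℓ, ℓ * bernoulli (2 * h) + 1 = ℓ * b := by
  obtain ⟨a, ha⟩ := Bernoulli.vonStaudt_clausen h
  have hp : ℓ.Prime := Fact.out
  have hm : ℓ ∈ {p ∈ Finset.range (2 * h + 2) | p.Prime ∧ (p - 1) ∣ 2 * h} := by
    simp only [Finset.mem_filter, Finset.mem_range]
    refine ⟨by lia, hp, ?_⟩
    rw [show ℓ - 1 = 2 * h by lia]
  rw [← Finset.add_sum_erase _ _ hm] at ha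
  refine ⟨_, sub_mem (intCast_mem (locRat ℓ) a) (sum_mem (t := Finset.erase
    {p ∈ Finset.range (2 * h + 2) | p.Prime ∧ (p - 1) ∣ 2 * h} ℓ)
    (f := fun p : ℕ => (1 : ℚ) / p) fun p hp => ?_), ?_⟩
  · have h1 := Finset.mem_of_mem_erase hp
    simp only [Finset.mem_filter] at h1
    exact inv_prime_mem_locRat h1.2.1 (Finset.ne_of_mem_erase hp)
  · have h0 : (ℓ : ℚ) ≠ 0 := by exact_mod_cast hp.ne_zero
    rw [ha]
    field_simp
    ring

end Bernoulli

/-- The sums of modular forms of level one, weight at most `W` and integral `q`-expansion, up to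
`ℓ` times a power series with bounded denominators prime to `ℓ`. The bound `W` is rational because
the weights in question are given by fractions. -/
noncomputable def levelOneSum (ℓ : ℕ) [Fact ℓ.Prime] (W : ℚ) : AddSubgroup ℚ⟦X⟧ :=
  AddSubgroup.closure ({F | ∃ w : ℤ, (w : ℚ) ≤ W ∧ IsLevelOne w F ∧ F ∈ intSeries} ∪
    {F | ∃ H ∈ locSeries ℓ, F = C (ℓ : ℚ) * H})

section

variable {ℓ : ℕ} [Fact ℓ.Prime] {W V : ℚ} {F G : ℚ⟦X⟧}

namespace levelOneSum

lemma C_mul_mem_of_locSeries (hF : F ∈ locSeries ℓ) (W : ℚ) :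
    C (ℓ : ℚ) * F ∈ levelOneSum ℓ W :=
  AddSubgroup.subset_closure (Or.inr ⟨F, hF, rfl⟩)

lemma mem_of_isLevelOne {w : ℤ} (hF : IsLevelOne w F) (hF' : F ∈ locSeries ℓ) (hw : (w : ℚ) ≤ W) :
    F ∈ levelOneSum ℓ W := by
  obtain ⟨N, hN, hF''⟩ := hF'
  -- a multiple `M N` with `M N ≡ 1` modulo `ℓ`
  have hcop : IsCoprime (N : ℤ) (ℓ : ℤ) :=
    Nat.isCoprime_iff_coprime.2 ((Nat.Prime.coprime_iff_not_dvd Fact.out).2 hN).symm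
  obtain ⟨u, v, huv⟩ := hcop
  have huv' : (u * N + v * ℓ : ℚ) = 1 := by exact_mod_cast huv
  have e : F = C (u : ℚ) * (C (N : ℚ) * F) + C (ℓ : ℚ) * (C (v : ℚ) * F) := by
    have h := congrArg (C : ℚ →+* ℚ⟦X⟧) huv'
    rw [map_add, map_mul, map_mul, map_one] at h
    linear_combination - F * h
  have hF' : F ∈ locSeries ℓ := ⟨N, hN, hF''⟩
  rw [e]
  refine add_mem (AddSubgroup.subset_closure (Or.inl ⟨w, hw, (hF.C_mul _).C_mul _,
    mul_mem (C_intCast_mem_intSeries u) hF''⟩)) (C_mul_mem_of_locSeries ?_ W)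
  exact mul_mem (intSeries_le_locSeries ℓ (C_intCast_mem_intSeries v)) hF'

/-- Induction for elements of `levelOneSum ℓ W`. -/
lemma induction {p : ℚ⟦X⟧ → Prop} (hF : F ∈ levelOneSum ℓ W)
    (form : ∀ (w : ℤ) (F : ℚ⟦X⟧), (w : ℚ) ≤ W → IsLevelOne w F → F ∈ locSeries ℓ → p F)
    (mul : ∀ F ∈ locSeries ℓ, p (C (ℓ : ℚ) * F)) (add : ∀ F G, p F → p G → p (F + G))
    (neg : ∀ F, p F → p (-F)) : p F := by
  induction hF using AddSubgroup.closure_induction with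
  | mem F hF =>
    rcases hF with ⟨w, hw, h1, h2⟩ | ⟨H, hH, rfl⟩
    · exact form w F hw h1 (intSeries_le_locSeries ℓ h2)
    · exact mul H hH
  | zero => simpa using mul 0 (zero_mem _)
  | add F G _ _ hF hG => exact add F G hF hG
  | neg F _ hF => exact neg F hF

lemma mono (hF : F ∈ levelOneSum ℓ V) (h : V ≤ W) : F ∈ levelOneSum ℓ W :=
  induction hF (fun _ _ hw h1 h2 => mem_of_isLevelOne h1 h2 (hw.trans h))
    (fun _ hF => C_mul_mem_of_locSeries hF W) (fun _ _ => add_mem) fun _ => neg_mem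

lemma le_locSeries (hF : F ∈ levelOneSum ℓ W) : F ∈ locSeries ℓ :=
  induction hF (fun _ _ _ _ h => h)
    (fun _ hF => mul_mem (C_mem_locSeries (natCast_mem _ _)) hF) (fun _ _ => add_mem)
    fun _ => neg_mem

lemma C_mul_mem {a : ℚ} (ha : a ∈ locRat ℓ) (hF : F ∈ levelOneSum ℓ W) :
    C a * F ∈ levelOneSum ℓ W := by
  refine induction (p := fun F => C a * F ∈ levelOneSum ℓ W) hF
    (fun _ _ hw h1 h2 => mem_of_isLevelOne (h1.C_mul a)
    (mul_mem (C_mem_locSeries ha) h2) hw) (fun F hF => ?_) (fun F G hF hG => ?_) fun F hF => ?_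
  · rw [mul_left_comm]
    exact C_mul_mem_of_locSeries (mul_mem (C_mem_locSeries ha) hF) W
  · rw [mul_add]
    exact add_mem hF hG
  · rw [mul_neg]
    exact neg_mem hF

lemma mul_mem' (hF : F ∈ levelOneSum ℓ V) (hG : G ∈ levelOneSum ℓ W) :
    F * G ∈ levelOneSum ℓ (V + W) := by
  refine induction (p := fun F => F * G ∈ levelOneSum ℓ (V + W)) hF (fun v F hv h1 h2 => ?_)
      (fun F hF => ?_) (fun F F' hF hF' => ?_)
    fun F hF => ?_
  · refine induction (p := fun G => F * G ∈ levelOneSum ℓ (V + W)) hG (fun w G hw h3 h4 => ?_)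
        (fun G hG => ?_) (fun G G' hG hG' => ?_)
      fun G hG => ?_
    · exact mem_of_isLevelOne (h1.mul h3) (mul_mem h2 h4) (by push_cast; linarith)
    · rw [mul_left_comm]
      exact C_mul_mem_of_locSeries (mul_mem h2 hG) _
    · rw [mul_add]
      exact add_mem hG hG'
    · rw [mul_neg]
      exact neg_mem hG
  · rw [mul_assoc]
    exact C_mul_mem_of_locSeries (mul_mem hF (le_locSeries hG)) _
  · rw [add_mul]
    exact add_mem hF hF'
  · rw [neg_mul]
    exact neg_mem hF

lemma one_mem' : (1 : ℚ⟦X⟧) ∈ levelOneSum ℓ 0 :=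
  mem_of_isLevelOne IsLevelOne.one (one_mem _) (by simp)

end levelOneSum

lemma sigmaSeries_mem_locSeries (k : ℕ) : sigmaSeries k ∈ locSeries ℓ :=
  intSeries_le_locSeries ℓ (sigmaSeries_mem_intSeries k)

lemma eisenTwo_mem_intSeries : eisenTwo ∈ intSeries :=
  sub_mem (one_mem _) (mul_mem (ofNat_mem _ 24) (sigmaSeries_mem_intSeries 1))

lemma eisen_two : eisen 2 = C (1 / 6 : ℚ) * eisenTwo := by
  have e1 : C (1 / 6 : ℚ) * C 24 = (C 4 : ℚ⟦X⟧) := by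
    rw [← map_mul]
    norm_num
  rw [eisen, eisenTwo, bernoulli_two, show (24 : ℚ⟦X⟧) = C (24 : ℚ) by simp only [map_ofNat], ← inv_eq_one_div]
  norm_num
  norm_num at e1
  linear_combination sigmaSeries 1 * e1

lemma eisen_mem_locSeries {k : ℕ} (h : ¬ (ℓ - 1) ∣ 2 * k) : eisen (2 * k) ∈ locSeries ℓ := by
  refine sub_mem (C_mem_locSeries (bernoulli_mem_locRat h)) (mul_mem (C_mem_locSeries ?_)
    (sigmaSeries_mem_locSeries _))
  exact_mod_cast natCast_mem (locRat ℓ) (2 * (2 * k))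

/-- The Eisenstein series of weight `ℓ - 1` is congruent to `-1 / ℓ`. -/
lemma exists_mul_eisen_add_one {h : ℕ} (hh : ℓ = 2 * h + 1) :
    ∃ H ∈ locSeries ℓ, C (ℓ : ℚ) * eisen (2 * h) + 1 = C (ℓ : ℚ) * H := by
  obtain ⟨b, hb, e⟩ := exists_mul_bernoulli_add_one hh
  refine ⟨C b - C (2 * (2 * h : ℕ) : ℚ) * sigmaSeries (2 * h - 1),
    sub_mem (C_mem_locSeries hb) (mul_mem (C_mem_locSeries ?_) (sigmaSeries_mem_locSeries _)), ?_⟩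
  · exact_mod_cast natCast_mem (locRat ℓ) (2 * (2 * h))
  · have e' := congrArg (C : ℚ →+* ℚ⟦X⟧) e
    rw [map_add, map_mul, map_mul, map_one] at e'
    rw [eisen]
    linear_combination e'

end

end LevelOneSums

/-! ### Arithmetic progressions and Hecke congruences -/

section ProgressionLift

open PowerSeries

/-- The series `P ^ r 𝒰(F)`, where `P` is the generating series of the partition numbers and
`𝒰` extracts the coefficients in a progression modulo `ℓ`. Multiplying it by `η ^ r` gives the
series `∑ F_{ℓ m + β} q ^ (m + r / 24)`. -/
noncomputable def progressionLift (ℓ β r : ℕ) (F : ℚ⟦X⟧) : ℚ⟦X⟧ :=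
  partitionSeries ^ r * progression ℓ β F

lemma progressionLift_add (ℓ β r : ℕ) (F G : ℚ⟦X⟧) :
    progressionLift ℓ β r (F + G) = progressionLift ℓ β r F + progressionLift ℓ β r G := by
  rw [progressionLift, progression_add, mul_add]
  rfl

lemma progressionLift_C_mul (ℓ β r : ℕ) (a : ℚ) (F : ℚ⟦X⟧) :
    progressionLift ℓ β r (C a * F) = C a * progressionLift ℓ β r F := by
  rw [progressionLift, progression_C_mul, mul_left_comm]
  rfl

lemma progressionLift_neg (ℓ β r : ℕ) (F : ℚ⟦X⟧) :
    progressionLift ℓ β r (-F) = -progressionLift ℓ β r F := by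
  have h := progressionLift_C_mul ℓ β r (-1) F
  simpa using h

lemma progressionLift_sub (ℓ β r : ℕ) (F G : ℚ⟦X⟧) :
    progressionLift ℓ β r (F - G) = progressionLift ℓ β r F - progressionLift ℓ β r G := by
  rw [sub_eq_add_neg, progressionLift_add, progressionLift_neg, sub_eq_add_neg]

lemma progressionLift_zero (ℓ β r : ℕ) : progressionLift ℓ β r 0 = 0 := by
  simpa using progressionLift_C_mul ℓ β r 0 0

lemma progressionLift_sum (ℓ β r : ℕ) {ι : Type*} (s : Finset ι) (F : ι → ℚ⟦X⟧) :
    progressionLift ℓ β r (∑ i ∈ s, F i) = ∑ i ∈ s, progressionLift ℓ β r (F i) := by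
  classical
  induction s using Finset.induction_on with
  | empty => simp [progressionLift_zero]
  | insert a s ha ih => rw [Finset.sum_insert ha, Finset.sum_insert ha, progressionLift_add, ih]

lemma progressionLift_mem_locSeries {ℓ : ℕ} [Fact ℓ.Prime] {F : ℚ⟦X⟧} (hF : F ∈ locSeries ℓ)
    (n β r : ℕ) : progressionLift n β r F ∈ locSeries ℓ :=
  mul_mem (pow_mem (intSeries_le_locSeries ℓ partitionSeries_mem_intSeries) _)
    (progression_mem_locSeries hF _ _)

/-- The operator on `G` which corresponds to the derivation `24 q d/dq` of `η ^ r G`. -/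
noncomputable def etaPowDeriv (r : ℕ) (F : ℚ⟦X⟧) : ℚ⟦X⟧ := 24 * qDeriv F + r * eisenTwo * F

lemma qDeriv_progression (ℓ β : ℕ) (F : ℚ⟦X⟧) : progression ℓ β (qDeriv F) =
    C (ℓ : ℚ) * qDeriv (progression ℓ β F) + C (β : ℚ) * progression ℓ β F := by
  ext m
  rw [map_add, coeff_C_mul, coeff_C_mul, coeff_qDeriv]
  simp only [progression, coeff_mk, coeff_qDeriv]
  push_cast
  ring

/-- The derivation `qDerivShift` gains a factor of `ℓ` under `progressionLift`. -/
lemma progressionLift_qDerivShift {ℓ β r : ℕ} (h : 24 * β = ℓ * r + 1) (F : ℚ⟦X⟧) :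
    progressionLift ℓ β r (qDerivShift F) =
      C (ℓ / 24 : ℚ) * etaPowDeriv r (progressionLift ℓ β r F) := by
  have h' : (24 * β : ℚ) = ℓ * r + 1 := by exact_mod_cast h
  have hβ : C (β : ℚ) - C (1 / 24) = (C (ℓ / 24 : ℚ) * (r : ℚ⟦X⟧)) := by
    rw [← map_natCast (C : ℚ →+* ℚ⟦X⟧), ← map_sub, ← map_mul]
    congr 1
    linear_combination h' / 24
  have e1 : progression ℓ β (qDerivShift F) = C (ℓ : ℚ) * qDeriv (progression ℓ β F) +
      C (ℓ / 24 : ℚ) * (r : ℚ⟦X⟧) * progression ℓ β F := by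
    rw [qDerivShift, sub_eq_add_neg, progression_add, ← neg_mul, ← map_neg, progression_C_mul,
      qDeriv_progression, map_neg]
    linear_combination progression ℓ β F * hβ
  have e2 : qDeriv (partitionSeries ^ r) = r * partitionSeries ^ r * sigmaSeries 1 := by
    rw [Derivation.leibniz_pow, qDeriv_partitionSeries]
    rcases r with _ | r
    · simp
    · simp only [Nat.add_sub_cancel, smul_eq_mul, nsmul_eq_mul]
      rw [pow_succ]
      ring
  have e3 : C (ℓ / 24 : ℚ) * 24 = (C (ℓ : ℚ) : ℚ⟦X⟧) := by
    rw [show (24 : ℚ⟦X⟧) = C (24 : ℚ) by simp only [map_ofNat], ← map_mul]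
    congr 1
    ring
  rw [progressionLift, progressionLift, e1, etaPowDeriv, Derivation.leibniz, e2, eisenTwo]
  simp only [smul_eq_mul]
  linear_combination - partitionSeries ^ r * qDeriv (progression ℓ β F) * e3

section Congruences

variable {ℓ β r : ℕ} [Fact ℓ.Prime]

/-- The exponents to which the Hecke operator is applied are integral and nonnegative. -/
lemma exists_heckeExponent (hℓ : 3 < ℓ) (hβ : β < ℓ) (h : 24 * β = ℓ * r + 1) {t : ℕ}
    (ht : t = 1 ∨ t = ℓ) : ∃ s s' e : ℕ, 2 * s + 1 = ℓ * t ∧ 2 * s' = r + t ∧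
      ℓ * s = s' + 12 * e := by
  have hp : ℓ.Prime := Fact.out
  have hr : r < 24 := by
    by_contra hr
    have : ℓ * 24 ≤ ℓ * r := Nat.mul_le_mul_left _ (by lia)
    lia
  obtain ⟨j, c, d, hj, hd, hrc⟩ : ∃ j c d : ℕ, ℓ = 24 * j + (2 * c + 1) ∧ c * c + c = 6 * d ∧
      r + (2 * c + 1) = 24 := by
    have h2 : ¬ 2 ∣ ℓ := fun hd => by
      have := (Nat.prime_dvd_prime_iff_eq Nat.prime_two hp).1 hd
      lia
    have h3 : ¬ 3 ∣ ℓ := fun hd => by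
      have := (Nat.prime_dvd_prime_iff_eq Nat.prime_three hp).1 hd
      lia
    obtain ⟨j, c, d, hj, hd⟩ : ∃ j c d : ℕ, ℓ = 24 * j + (2 * c + 1) ∧
        ((c = 0 ∧ d = 0) ∨ (c = 2 ∧ d = 1) ∨ (c = 3 ∧ d = 2) ∨ (c = 5 ∧ d = 5) ∨
          (c = 6 ∧ d = 7) ∨ (c = 8 ∧ d = 12) ∨ (c = 9 ∧ d = 15) ∨ (c = 11 ∧ d = 22)) :=
      ⟨ℓ / 24, ℓ % 24 / 2, (ℓ % 24 / 2 + 1) * (ℓ % 24 / 2) / 6, by lia, by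
        have h24 : ℓ % 24 < 24 := Nat.mod_lt _ (by norm_num)
        have h2' : ¬ 2 ∣ ℓ % 24 := by lia
        have h3' : ¬ 3 ∣ ℓ % 24 := by lia
        clear h
        generalize ℓ % 24 = m at *
        interval_cases m <;> simp_all⟩
    rw [hj, add_mul, mul_assoc] at h
    generalize j * r = m at h
    refine ⟨j, c, d, hj, ?_, ?_⟩ <;>
    rcases hd with ⟨rfl, rfl⟩ | ⟨rfl, rfl⟩ | ⟨rfl, rfl⟩ | ⟨rfl, rfl⟩ | ⟨rfl, rfl⟩ | ⟨rfl, rfl⟩ |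
      ⟨rfl, rfl⟩ | ⟨rfl, rfl⟩ <;> lia
  rcases ht with rfl | ht
  · have hK : 1 ≤ 24 * j * j + 2 * j * c + j * (2 * c + 1) + d := by
      rcases Nat.eq_zero_or_pos j with rfl | hj0
      · have : 0 < d := by
          by_contra hd0
          have : d = 0 := by lia
          rw [this] at hd
          have : c = 0 := by lia
          lia
        lia
      · have : j ≤ j * (2 * c + 1) := Nat.le_mul_of_pos_right _ (by lia)
        lia
    refine ⟨12 * j + c, 12 - c, 24 * j * j + 2 * j * c + j * (2 * c + 1) + d - 1, by lia, by lia, ?_⟩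
    rw [hj]
    zify [hK, show c ≤ 12 by lia]
    have hd' : (c * c + c : ℤ) = 6 * d := by exact_mod_cast hd
    linear_combination 2 * hd'
  · obtain rfl : ℓ = t := ht.symm
    set D := 24 * j * j + 2 * j * (2 * c + 1) + d with hD
    have hD1 : ℓ * ℓ = 24 * D + 1 := by
      zify
      have hj' : (ℓ : ℤ) = 24 * j + (2 * c + 1) := by exact_mod_cast hj
      have hd' : (c * c + c : ℤ) = 6 * d := by exact_mod_cast hd
      rw [hj', hD]
      push_cast
      linear_combination 4 * hd'
    have hD2 : 1 ≤ D := by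
      by_contra hD0
      have h0 : D = 0 := by lia
      rw [h0] at hD1
      have : ℓ ≤ ℓ * ℓ := Nat.le_mul_of_pos_right _ (by lia)
      lia
    have hK : j + 1 ≤ ℓ * D := le_trans (by lia) (Nat.le_mul_of_pos_right ℓ hD2)
    refine ⟨12 * D, 12 * j + 12, ℓ * D - (j + 1), by lia, by lia, ?_⟩
    rw [Nat.mul_sub, mul_left_comm]
    lia

/-- The Hecke operator, applied to the product of a power of the eta function and a modular form
`F`, produces a modular form which is congruent to `progressionLift (P F)`. -/
lemma exists_isLevelOne_congr (hℓ : 3 < ℓ) (hβ : β < ℓ) (h : 24 * β = ℓ * r + 1)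
    {w : ℤ} {F : ℚ⟦X⟧} (hF : IsLevelOne w F) (hF' : F ∈ intSeries) {k t s s' e : ℕ}
    (hs : 2 * s + 1 = ℓ * t) (hs' : 2 * s' = r + t) (he : ℓ * s = s' + 12 * e) (hk : k + 1 ≤ s)
    (hE : ∃ H ∈ intSeries, eulerSeries ^ (ℓ * t) -
      expand ℓ (NeZero.ne ℓ) eulerSeries ^ t = C ((ℓ : ℚ) ^ k) * H) :
    ∃ G ∈ intSeries, IsLevelOne (w + s - s') G ∧ ∃ H ∈ intSeries,
      G - progressionLift ℓ β r (partitionSeries * F) = C ((ℓ : ℚ) ^ k) * H := by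
  have hp : ℓ.Prime := Fact.out
  rcases lt_or_ge w 0 with hw | hw
  · refine ⟨0, zero_mem _, IsLevelOne.zero _, 0, zero_mem _, ?_⟩
    rw [hF.eq_zero_of_neg hw, mul_zero, progressionLift_zero, sub_zero, mul_zero]
  lift w to ℕ using hw
  have h1 : 12 * β + s = ℓ * s' := by
    have : 2 * (12 * β + s) = 2 * (ℓ * s') := by
      calc 2 * (12 * β + s) = 24 * β + 2 * s := by ring
        _ = ℓ * (2 * s') := by rw [hs', mul_add, ← hs, h]; ring
        _ = 2 * (ℓ * s') := by ring
    lia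
  have hG := hF.hecke hp hℓ hβ h1 he
  obtain ⟨H, hH, hH'⟩ := hE
  have hPE := partitionSeries_mul_eulerSeries
  obtain ⟨n, hn⟩ : ∃ n, w + s - 1 = k + n := ⟨w + s - 1 - k, by lia⟩
  have hz : (ℓ : ℚ) ^ ((w : ℤ) + s - 1) = (ℓ : ℚ) ^ k * (ℓ : ℚ) ^ n := by
    rw [show ((w : ℤ) + s - 1) = ((k + n : ℕ) : ℤ) by lia, zpow_natCast, pow_add]
  have hint : eulerSeries ^ (2 * s) * F ∈ intSeries :=
    mul_mem (pow_mem eulerSeries_mem_intSeries _) hF'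
  have hexp : eulerSeries ^ (2 * s) * F = expand ℓ hp.ne_zero (eulerSeries ^ t) *
      (partitionSeries * F) + C ((ℓ : ℚ) ^ k) * (H * partitionSeries * F) := by
    rw [map_pow]
    have e1 : eulerSeries ^ (ℓ * t) * partitionSeries = eulerSeries ^ (2 * s) := by
      rw [← hs, pow_succ]
      linear_combination eulerSeries ^ (2 * s) * hPE
    linear_combination - F * e1 + partitionSeries * F * hH'
  set A : ℚ⟦X⟧ := C ((-1) ^ ((ℓ - 1) / 2 * s) * (ℓ : ℚ) ^ n) *
    (X ^ e * expand ℓ hp.ne_zero (eulerSeries ^ (2 * s) * F)) with hA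
  have hAint : A ∈ intSeries := by
    refine mul_mem ?_ (mul_mem (pow_mem X_mem_intSeries _) (expand_mem_intSeries hint _))
    exact_mod_cast C_intCast_mem_intSeries ((-1) ^ ((ℓ - 1) / 2 * s) * (ℓ : ℤ) ^ n)
  have hC : C ((-1) ^ ((ℓ - 1) / 2 * s) * (ℓ : ℚ) ^ ((w : ℤ) + s - 1)) *
      (X ^ e * expand ℓ hp.ne_zero (eulerSeries ^ (2 * s) * F)) = C ((ℓ : ℚ) ^ k) * A := by
    rw [hA, hz, ← mul_assoc (C ((ℓ : ℚ) ^ k)), ← map_mul]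
    congr 2
    ring
  rw [hC] at hG
  have hlk : C ((ℓ : ℚ) ^ k) ∈ intSeries := by
    exact_mod_cast C_intCast_mem_intSeries ((ℓ : ℤ) ^ k)
  have hP := partitionSeries_mem_intSeries
  refine ⟨_, mul_mem (pow_mem hP (2 * s')) (add_mem (progression_mem_intSeries hint ℓ β)
    (mul_mem hlk hAint)), hG, partitionSeries ^ (2 * s') *
      (progression ℓ β (H * partitionSeries * F) + A), mul_mem (pow_mem hP _)
      (add_mem (progression_mem_intSeries (mul_mem (mul_mem hH hP) hF') _ _) hAint), ?_⟩
  have e2 : partitionSeries ^ (2 * s') * eulerSeries ^ t = partitionSeries ^ r := by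
    rw [hs', pow_add, mul_assoc, ← mul_pow, hPE, one_pow, mul_one]
  rw [hexp, progression_add, progression_expand_mul hp.ne_zero hβ, progression_C_mul,
    progressionLift]
  linear_combination progression ℓ β (partitionSeries * F) * e2

lemma exists_eulerSeries_pow_sub : ∃ H ∈ intSeries, eulerSeries ^ (ℓ * 1) -
    expand ℓ (NeZero.ne ℓ) eulerSeries ^ 1 = C ((ℓ : ℚ) ^ 1) * H := by
  rw [mul_one, pow_one, pow_one]
  exact exists_pow_sub_expand eulerSeries_mem_intSeries Fact.out

lemma exists_eulerSeries_pow_sq_sub : ∃ H ∈ intSeries, eulerSeries ^ (ℓ * ℓ) -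
    expand ℓ (NeZero.ne ℓ) eulerSeries ^ ℓ = C ((ℓ : ℚ) ^ 2) * H := by
  have hp : ℓ.Prime := Fact.out
  obtain ⟨H, hH, h⟩ := exists_pow_sub_expand eulerSeries_mem_intSeries hp
  have hcast : ((ℓ : ℕ) : ℚ⟦X⟧) = C (ℓ : ℚ) := by simp
  let a : intSeries := ⟨eulerSeries ^ ℓ, pow_mem eulerSeries_mem_intSeries _⟩
  let b : intSeries := ⟨expand ℓ hp.ne_zero eulerSeries,
    expand_mem_intSeries eulerSeries_mem_intSeries _⟩
  have hab : (ℓ : intSeries) ∣ a - b := ⟨⟨H, hH⟩, Subtype.ext (by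
    push_cast
    rw [hcast]
    exact h)⟩
  obtain ⟨⟨K, hK⟩, hK'⟩ := dvd_sub_pow_of_dvd_sub hab 1
  refine ⟨K, hK, ?_⟩
  have h2 := congrArg Subtype.val hK'
  push_cast at h2
  rw [pow_one, hcast] at h2
  rw [pow_mul, map_pow]
  exact h2

end Congruences

end ProgressionLift

/-! ### Lifts of products with the partition series -/

section LiftOfForms

open PowerSeries

lemma cast_ne_zero_of_not_dvd {ℓ N : ℕ} (hN : ¬ ℓ ∣ N) : (N : ℚ) ≠ 0 := by
  intro h
  rw [Nat.cast_eq_zero] at h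
  exact hN (h ▸ dvd_zero ℓ)

variable {ℓ β r : ℕ} [Fact ℓ.Prime]

lemma natCast_eq_C (n : ℕ) : (n : ℚ⟦X⟧) = C (n : ℚ) := by simp

lemma C_inv_mul_C_mul {a : ℚ} (ha : a ≠ 0) (F : ℚ⟦X⟧) : C a⁻¹ * (C a * F) = F := by
  rw [← mul_assoc, ← map_mul, inv_mul_cancel₀ ha, map_one, one_mul]

/-- The lift of the product of the partition series with a modular form is a modular form modulo
`ℓ`. -/
lemma progressionLift_partitionSeries_mul_mem (hℓ : 3 < ℓ) (hβ : β < ℓ)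
    (h : 24 * β = ℓ * r + 1) {F : ℚ⟦X⟧} {W : ℚ} (hF : F ∈ levelOneSum ℓ W) :
    progressionLift ℓ β r (partitionSeries * F) ∈
      levelOneSum ℓ (W - 1 + ((ℓ : ℚ) - r) / 2) := by
  have hP := intSeries_le_locSeries ℓ partitionSeries_mem_intSeries
  refine levelOneSum.induction (p := fun F => progressionLift ℓ β r (partitionSeries * F) ∈
      levelOneSum ℓ (W - 1 + ((ℓ : ℚ) - r) / 2)) hF (fun w F hw h1 h2 => ?_) (fun F hF => ?_)
    (fun F G hF hG => ?_) fun F hF => ?_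
  · obtain ⟨N, hN, h3⟩ := h2
    obtain ⟨s, s', e, hs, hs', he⟩ := exists_heckeExponent hℓ hβ h (Or.inl rfl)
    obtain ⟨G, hG, hG', H, hH, hGH⟩ := exists_isLevelOne_congr hℓ hβ h (h1.C_mul N) h3 (k := 1)
      hs hs' he (by lia) exists_eulerSeries_pow_sub
    rw [mul_left_comm, progressionLift_C_mul, pow_one] at hGH
    have h4 : progressionLift ℓ β r (partitionSeries * F) = C (N : ℚ)⁻¹ * (G - C (ℓ : ℚ) * H) := by
      rw [← hGH, sub_sub_cancel, C_inv_mul_C_mul (cast_ne_zero_of_not_dvd hN)]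
    rw [h4]
    refine levelOneSum.C_mul_mem (inv_natCast_mem_locRat hN) (sub_mem
      (levelOneSum.mem_of_isLevelOne hG' (intSeries_le_locSeries ℓ hG) ?_)
      (levelOneSum.C_mul_mem_of_locSeries (intSeries_le_locSeries ℓ hH) _))
    have e1 : (2 * s + 1 : ℚ) = ℓ * (1 : ℕ) := by exact_mod_cast hs
    have e2 : (2 * s' : ℚ) = r + (1 : ℕ) := by exact_mod_cast hs'
    push_cast at e1 e2 ⊢
    linarith
  · rw [mul_left_comm, progressionLift_C_mul]
    exact levelOneSum.C_mul_mem_of_locSeries (progressionLift_mem_locSeries (mul_mem hP hF) _ _ _) _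
  · rw [mul_add, progressionLift_add]
    exact add_mem hF hG
  · rw [mul_neg, progressionLift_neg]
    exact neg_mem hF

/-- A congruence modulo `ℓ ^ 2`, at the cost of a larger weight. -/
lemma exists_isLevelOne_congr_sq (hℓ : 3 < ℓ) (hβ : β < ℓ) (h : 24 * β = ℓ * r + 1)
    {w : ℤ} {F : ℚ⟦X⟧} (hF : IsLevelOne w F) (hF' : F ∈ intSeries) :
    ∃ v : ℤ, (v : ℚ) = w + ((ℓ : ℚ) * (ℓ - 1) - r - 1) / 2 ∧ ∃ G ∈ intSeries, IsLevelOne v G ∧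
      ∃ H ∈ intSeries, G - progressionLift ℓ β r (partitionSeries * F) =
        C (ℓ : ℚ) * (C (ℓ : ℚ) * H) := by
  obtain ⟨s, s', e, hs, hs', he⟩ := exists_heckeExponent hℓ hβ h (Or.inr rfl)
  have h25 : 5 * 5 ≤ ℓ * ℓ := by
    have hp : ℓ.Prime := Fact.out
    have h4 : ℓ ≠ 4 := by
      rintro rfl
      exact absurd hp (by norm_num)
    exact Nat.mul_le_mul (by lia) (by lia)
  obtain ⟨G, hG, hG', H, hH, hGH⟩ := exists_isLevelOne_congr hℓ hβ h hF hF' (k := 2)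
    hs hs' he (by lia) exists_eulerSeries_pow_sq_sub
  refine ⟨_, ?_, G, hG, hG', H, hH, ?_⟩
  · have e1 : (2 * s + 1 : ℚ) = ℓ * ℓ := by exact_mod_cast hs
    have e2 : (2 * s' : ℚ) = r + ℓ := by exact_mod_cast hs'
    push_cast
    linarith
  · rw [hGH, pow_two, map_mul, mul_assoc]

/-- If the lift of the product of the partition series with a modular form is divisible by `ℓ`, then
so is a modular form congruent to it modulo `ℓ ^ 2`, and the quotient is again a modular form modulo
`ℓ`. -/
lemma C_inv_mul_progressionLift_mem (hℓ : 3 < ℓ) (hβ : β < ℓ) (h : 24 * β = ℓ * r + 1)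
    {w : ℤ} {F : ℚ⟦X⟧} (hF : IsLevelOne w F) (hF' : F ∈ locSeries ℓ)
    (hd : C (ℓ : ℚ)⁻¹ * progressionLift ℓ β r (partitionSeries * F) ∈ locSeries ℓ) :
    C (ℓ : ℚ)⁻¹ * progressionLift ℓ β r (partitionSeries * F) ∈
      levelOneSum ℓ (w + ((ℓ : ℚ) * (ℓ - 1) - r - 1) / 2) := by
  obtain ⟨N, hN, h3⟩ := hF'
  obtain ⟨v, hv, G, hG, hG', H, hH, hGH⟩ := exists_isLevelOne_congr_sq hℓ hβ h (hF.C_mul N) h3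
  rw [mul_left_comm, progressionLift_C_mul] at hGH
  have hl0 : (ℓ : ℚ) ≠ 0 := by exact_mod_cast (NeZero.ne ℓ)
  have hH' := intSeries_le_locSeries ℓ hH
  have e1 : C (ℓ : ℚ)⁻¹ * G = C (N : ℚ) * (C (ℓ : ℚ)⁻¹ *
      progressionLift ℓ β r (partitionSeries * F)) + C (ℓ : ℚ) * H := by
    have h5 := C_inv_mul_C_mul hl0 (C (ℓ : ℚ) * H)
    rw [← hGH] at h5
    linear_combination h5
  have e2 : C (ℓ : ℚ)⁻¹ * progressionLift ℓ β r (partitionSeries * F) =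
      C (N : ℚ)⁻¹ * (C (ℓ : ℚ)⁻¹ * G - C (ℓ : ℚ) * H) := by
    rw [e1, add_sub_cancel_right, C_inv_mul_C_mul (cast_ne_zero_of_not_dvd hN)]
  rw [e2]
  refine levelOneSum.C_mul_mem (inv_natCast_mem_locRat hN) (sub_mem
    (levelOneSum.mem_of_isLevelOne (hG'.C_mul _) ?_ hv.le)
    (levelOneSum.C_mul_mem_of_locSeries hH' _))
  rw [e1]
  exact add_mem (mul_mem (C_mem_locSeries (natCast_mem _ _)) hd)
    (mul_mem (C_mem_locSeries (natCast_mem _ _)) hH')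

/-- The series `E₂` is congruent to a modular form of weight `ℓ + 1`, the Serre derivative of the
Eisenstein series of weight `ℓ - 1`. -/
lemma eisenTwo_mem_levelOneSum (hℓ : 3 < ℓ) : eisenTwo ∈ levelOneSum ℓ (ℓ + 1) := by
  have hp : ℓ.Prime := Fact.out
  obtain ⟨m, hm⟩ := hp.odd_of_ne_two (by lia)
  have hm2 : 2 ≤ m := by lia
  obtain ⟨H, hH, hH'⟩ := exists_mul_eisen_add_one hm
  have hE := intSeries_le_locSeries ℓ eisenTwo_mem_intSeries
  have h1 := ((isLevelOne_eisen (k := 2 * m) (by lia) (by simp)).C_mul (ℓ : ℚ)).serre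
  have e1 : C (ℓ : ℚ) * eisen (2 * m) = C (ℓ : ℚ) * H - 1 := by rw [← hH', add_sub_cancel_right]
  have e2 : (((2 * m : ℕ) : ℤ) : ℚ⟦X⟧) = C (ℓ : ℚ) - 1 := by
    rw [← natCast_eq_C, hm]
    push_cast
    ring
  rw [e1, e2, map_sub, qDeriv_C_mul, Derivation.map_one_eq_zero, sub_zero] at h1
  set T := 12 * qDeriv H - (C (ℓ : ℚ) - 1) * eisenTwo * H + eisenTwo with hT
  have hT' : T ∈ locSeries ℓ := add_mem (sub_mem (mul_mem (ofNat_mem _ 12)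
    (qDeriv_mem_locSeries hH)) (mul_mem (mul_mem (sub_mem (C_mem_locSeries (natCast_mem _ _))
      (one_mem _)) hE) hH)) hE
  have e3 : 12 * (C (ℓ : ℚ) * qDeriv H) - (C (ℓ : ℚ) - 1) * eisenTwo * (C (ℓ : ℚ) * H - 1) =
      C (ℓ : ℚ) * T - eisenTwo := by
    rw [hT]
    ring
  rw [e3] at h1
  have h2 : C (ℓ : ℚ) * T - eisenTwo ∈ levelOneSum ℓ (ℓ + 1) :=
    levelOneSum.mem_of_isLevelOne h1 (sub_mem (mul_mem (C_mem_locSeries (natCast_mem _ _)) hT') hE)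
      (by rw [hm]; push_cast; linarith)
  have h3 := sub_mem (levelOneSum.C_mul_mem_of_locSeries hT' (ℓ + 1)) h2
  rwa [sub_sub_cancel] at h3

/-- The operator `etaPowDeriv` is a Serre derivative up to multiples of `E₂`, whence the increase
`ℓ + 1` of the weight. -/
lemma etaPowDeriv_mem_levelOneSum (hℓ : 3 < ℓ) (r : ℕ) {W : ℚ} {F : ℚ⟦X⟧}
    (hF : F ∈ levelOneSum ℓ W) : etaPowDeriv r F ∈ levelOneSum ℓ (W + ℓ + 1) := by
  have hE := intSeries_le_locSeries ℓ eisenTwo_mem_intSeries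
  refine levelOneSum.induction (p := fun F => etaPowDeriv r F ∈ levelOneSum ℓ (W + ℓ + 1)) hF
    (fun w F hw h1 h2 => ?_) (fun F hF => ?_) (fun F G hF hG => ?_) fun F hF => ?_
  · have h3 := h1.serre
    have h4 : 12 * qDeriv F - (w : ℚ⟦X⟧) * eisenTwo * F ∈ locSeries ℓ :=
      sub_mem (mul_mem (ofNat_mem _ 12) (qDeriv_mem_locSeries h2))
        (mul_mem (mul_mem (intCast_mem _ _) hE) h2)
    have h5 : 12 * qDeriv F - (w : ℚ⟦X⟧) * eisenTwo * F ∈ levelOneSum ℓ (W + ℓ + 1) :=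
      levelOneSum.mem_of_isLevelOne h3 h4 (by
        have : (3 : ℚ) < ℓ := by exact_mod_cast hℓ
        push_cast
        linarith)
    have h6 : eisenTwo * F ∈ levelOneSum ℓ (W + ℓ + 1) :=
      levelOneSum.mono (levelOneSum.mul_mem' (eisenTwo_mem_levelOneSum hℓ)
        (levelOneSum.mem_of_isLevelOne h1 h2 hw)) (by linarith)
    have e : etaPowDeriv r F = (2 : ℕ) • (12 * qDeriv F - (w : ℚ⟦X⟧) * eisenTwo * F) +
        (2 * w + r : ℤ) • (eisenTwo * F) := by
      rw [etaPowDeriv, nsmul_eq_mul, zsmul_eq_mul]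
      push_cast
      ring
    rw [e]
    exact add_mem (nsmul_mem h5 _) (zsmul_mem h6 _)
  · have e : etaPowDeriv r (C (ℓ : ℚ) * F) = C (ℓ : ℚ) * etaPowDeriv r F := by
      rw [etaPowDeriv, etaPowDeriv, qDeriv_C_mul]
      ring
    rw [e]
    exact levelOneSum.C_mul_mem_of_locSeries (add_mem (mul_mem (ofNat_mem _ 24)
      (qDeriv_mem_locSeries hF)) (mul_mem (mul_mem (natCast_mem _ _) hE) hF)) _
  · have e : etaPowDeriv r (F + G) = etaPowDeriv r F + etaPowDeriv r G := by
      simp only [etaPowDeriv, map_add]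
      ring
    rw [e]
    exact add_mem hF hG
  · have e : etaPowDeriv r (-F) = -etaPowDeriv r F := by
      simp only [etaPowDeriv, map_neg]
      ring
    rw [e]
    exact neg_mem hF

lemma eisen_mem_levelOneSum (hℓ : 3 < ℓ) {i : ℕ} (hi : i ≠ 0) (h : ¬ (ℓ - 1) ∣ 2 * i) :
    eisen (2 * i) ∈ levelOneSum ℓ (i * (ℓ + 1)) := by
  obtain rfl | hi2 : i = 1 ∨ 2 ≤ i := by lia
  · rw [mul_one, eisen_two]
    refine levelOneSum.C_mul_mem ?_ (levelOneSum.mono (eisenTwo_mem_levelOneSum hℓ) (by simp))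
    rw [one_div]
    refine inv_natCast_mem_locRat (n := 6) fun hd => ?_
    have hp : ℓ.Prime := Fact.out
    rcases (Nat.Prime.dvd_mul (m := 2) (n := 3) hp).1 hd with h | h
    · have := Nat.le_of_dvd (by norm_num) h
      lia
    · have := Nat.le_of_dvd (by norm_num) h
      lia
  · refine levelOneSum.mem_of_isLevelOne (isLevelOne_eisen (by lia) (by simp))
      (eisen_mem_locSeries h) ?_
    have h1 : (3 : ℚ) < ℓ := by exact_mod_cast hℓ
    have h2 : (0 : ℚ) ≤ i := by positivity
    push_cast
    nlinarith

lemma not_dvd_factorial {n : ℕ} (hn : n < ℓ) : ¬ ℓ ∣ n.factorial := fun h =>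
  absurd ((Nat.Prime.dvd_factorial Fact.out).1 h) (by lia)

end LiftOfForms

/-! ### Rank moments of order less than `ℓ - 1` -/

section LowMoments

open PowerSeries

variable {ℓ β r h : ℕ} [Fact ℓ.Prime]

lemma inv_factorial_mem_locRat {n : ℕ} (hn : n < ℓ) : (1 / (n.factorial : ℚ)) ∈ locRat ℓ := by
  rw [one_div]
  exact inv_natCast_mem_locRat (not_dvd_factorial hn)

lemma not_dvd_four_pow (hℓ : 3 < ℓ) (i : ℕ) : ¬ ℓ ∣ 4 ^ i := fun hd => by
  have hp : ℓ.Prime := Fact.out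
  have h2 := hp.dvd_of_dvd_pow hd
  have h3 := Nat.le_of_dvd (by norm_num) h2
  have h4 : ℓ = 4 := by lia
  rw [h4] at hp
  exact absurd hp (by norm_num)

/-- The coefficients in the expansion of a rank moment are `ℓ`-integral as long as `ℓ` does not
occur in the denominator. -/
lemma rankCoeff_mem_locRat (hℓ : 3 < ℓ) {k i : ℕ} (hi : 2 * i + 1 < ℓ) :
    ((2 * k).factorial : ℚ) / (4 ^ i * ((2 * i + 1).factorial : ℚ)) ∈ locRat ℓ := by
  have h1 : ¬ ℓ ∣ 4 ^ i * (2 * i + 1).factorial := fun hd =>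
    ((Nat.Prime.dvd_mul Fact.out).1 hd).elim (not_dvd_four_pow hℓ i) (not_dvd_factorial hi)
  have h2 := div_natCast_mem_locRat (natCast_mem (locRat ℓ) (2 * k).factorial) h1
  push_cast at h2
  exact h2

lemma eisen_mul_quasiCoeff_mem (hℓ : 3 < ℓ) {i j : ℕ} (hi : 2 * (i + 1) < ℓ)
    (hi' : 2 * (i + 1) ≠ ℓ - 1) (hij : i + 1 ≤ j)
    (hW : quasiCoeff (j - (i + 1)) ∈ levelOneSum ℓ ((j - (i + 1) : ℕ) * (ℓ + 1))) :
    C (1 / ((2 * (i + 1)).factorial : ℚ)) * eisen (2 * (i + 1)) * quasiCoeff (j - (i + 1)) ∈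
      levelOneSum ℓ (j * (ℓ + 1)) := by
  have hd : ¬ (ℓ - 1) ∣ 2 * (i + 1) := fun hd => by
    obtain ⟨c, hc⟩ := hd
    have : c ≠ 0 := by
      rintro rfl
      lia
    obtain rfl | hc2 : c = 1 ∨ 2 ≤ c := by lia
    · lia
    · have := Nat.mul_le_mul_left (ℓ - 1) hc2
      lia
  refine levelOneSum.mono (levelOneSum.mul_mem' (levelOneSum.C_mul_mem
    (inv_factorial_mem_locRat hi) (eisen_mem_levelOneSum hℓ (Nat.succ_ne_zero i) hd)) hW) ?_
  rw [Nat.cast_sub hij]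
  push_cast
  linarith

/-- Among the factors in `quasiCoeff j` only `E₂` is not modular, and it counts with weight `ℓ + 1`.
-/
lemma quasiCoeff_mem_levelOneSum (hℓ : 3 < ℓ) (hh : ℓ = 2 * h + 1) {j : ℕ} (hj : j < h) :
    quasiCoeff j ∈ levelOneSum ℓ (j * (ℓ + 1)) := by
  induction j using Nat.strong_induction_on with
  | _ j ih =>
    rcases Nat.eq_zero_or_pos j with rfl | hj0
    · rw [quasiCoeff_zero]
      exact levelOneSum.mono levelOneSum.one_mem' (by simp)
    · have h1 := quasiCoeff_rec j
      have hnd : ¬ ℓ ∣ 2 * j := Nat.not_dvd_of_pos_of_lt (by lia) (by lia)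
      have h2 : quasiCoeff j = C ((2 * j : ℕ) : ℚ)⁻¹ * (C (2 * j : ℚ) * quasiCoeff j) := by
        have := C_inv_mul_C_mul (cast_ne_zero_of_not_dvd hnd) (quasiCoeff j)
        push_cast at this ⊢
        exact this.symm
      rw [h2, h1, neg_mul, show (3 : ℚ⟦X⟧) = C (3 : ℚ) by simp only [map_ofNat]]
      refine levelOneSum.C_mul_mem (inv_natCast_mem_locRat hnd) (neg_mem
        (levelOneSum.C_mul_mem (ofNat_mem (locRat ℓ) 3) (sum_mem fun i hi => ?_)))
      have hi' := Finset.mem_range.1 hi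
      exact eisen_mul_quasiCoeff_mem hℓ (by lia) (by lia) (by lia) (ih _ (by lia) (by lia))

lemma rankSigma_one : rankSigma 1 =
    C (1 / 2 : ℚ) * rankMomentSeries 2 - C (1 / 24 : ℚ) * partitionSeries := by
  have h1 := rankMomentSeries_eq_sum 1
  rw [Finset.sum_range_succ, Finset.sum_range_one] at h1
  norm_num [Nat.factorial, rankSigma_zero] at h1
  have e1 : (C (1 / 2 : ℚ) : ℚ⟦X⟧) * C 2 = 1 := by
    rw [← map_mul]
    norm_num
  have e2 : (C (1 / 2 : ℚ) : ℚ⟦X⟧) * C (1 / 12) = C (1 / 24) := by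
    rw [← map_mul]
    norm_num
  linear_combination (-(C (1 / 2 : ℚ) : ℚ⟦X⟧)) * h1 - rankSigma 1 * e1 - partitionSeries * e2

lemma one_div_mem_locRat {n : ℕ} (hn : ¬ ℓ ∣ n) : (1 / n : ℚ) ∈ locRat ℓ := by
  rw [one_div]
  exact inv_natCast_mem_locRat hn

lemma half_mem_locRat (hℓ : 3 < ℓ) : (1 / 2 : ℚ) ∈ locRat ℓ := by
  exact_mod_cast one_div_mem_locRat (n := 2) (Nat.not_dvd_of_pos_of_lt (by lia) (by lia))

lemma not_dvd_twentyFour (hℓ : 3 < ℓ) : ¬ ℓ ∣ 24 := fun hd => by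
  have hp : ℓ.Prime := Fact.out
  rcases (Nat.Prime.dvd_mul (m := 2 ^ 3) (n := 3) hp).1 hd with h | h
  · have := Nat.le_of_dvd (by norm_num) (hp.dvd_of_dvd_pow h)
    lia
  · have := Nat.le_of_dvd (by norm_num) h
    lia

lemma one_div_twentyFour_mem_locRat (hℓ : 3 < ℓ) : (1 / 24 : ℚ) ∈ locRat ℓ := by
  exact_mod_cast one_div_mem_locRat (n := 24) (not_dvd_twentyFour hℓ)

lemma partitionSeries_mem_locSeries : partitionSeries ∈ locSeries ℓ :=
  intSeries_le_locSeries ℓ partitionSeries_mem_intSeries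

lemma qDerivShift_mem_locSeries (hℓ : 3 < ℓ) {F : ℚ⟦X⟧} (hF : F ∈ locSeries ℓ) :
    qDerivShift F ∈ locSeries ℓ :=
  sub_mem (qDeriv_mem_locSeries hF)
    (mul_mem (C_mem_locSeries (one_div_twentyFour_mem_locRat hℓ)) hF)

/-- The recursion for `rankSigma`, divided by its leading coefficient. -/
lemma rankSigma_succ_eq {j : ℕ} (hj : j ≠ 0) : rankSigma (j + 1) =
    C (((2 * j + 1) * (2 * j) : ℕ) : ℚ)⁻¹ * (C 2 * (partitionSeries * quasiCoeff (j + 1)) -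
      C 6 * qDerivShift (rankSigma j)) := by
  have h1 := rankSigma_succ j
  have h0 : (((2 * j + 1) * (2 * j) : ℕ) : ℚ) ≠ 0 := by
    have : (2 * j + 1) * (2 * j) ≠ 0 := by positivity
    exact_mod_cast this
  have h2 := C_inv_mul_C_mul h0 (rankSigma (j + 1))
  rw [← h2]
  congr 1
  push_cast
  simp only [map_ofNat]
  linear_combination h1

lemma not_dvd_consecutive {j : ℕ} (hj : j ≠ 0) (hj' : 2 * j + 1 < ℓ) :
    ¬ ℓ ∣ (2 * j + 1) * (2 * j) := fun hd =>
  ((Nat.Prime.dvd_mul Fact.out).1 hd).elim (Nat.not_dvd_of_pos_of_lt (by lia) hj')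
    (Nat.not_dvd_of_pos_of_lt (by lia) (by lia))

lemma rankSigma_mem_locSeries (hℓ : 3 < ℓ) (hh : ℓ = 2 * h + 1) {j : ℕ} (hj : j < h) :
    rankSigma j ∈ locSeries ℓ := by
  induction j with
  | zero =>
    rw [rankSigma_zero]
    exact partitionSeries_mem_locSeries
  | succ j ih =>
    rcases Nat.eq_zero_or_pos j with rfl | hj0
    · rw [rankSigma_one]
      exact sub_mem (mul_mem (C_mem_locSeries (half_mem_locRat hℓ))
        (intSeries_le_locSeries ℓ (rankMomentSeries_mem_intSeries 2)))
        (mul_mem (C_mem_locSeries (one_div_twentyFour_mem_locRat hℓ)) partitionSeries_mem_locSeries)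
    · rw [rankSigma_succ_eq hj0.ne']
      refine mul_mem (C_mem_locSeries (inv_natCast_mem_locRat (not_dvd_consecutive hj0.ne'
        (by lia)))) (sub_mem (mul_mem (C_mem_locSeries (ofNat_mem _ 2)) (mul_mem
          partitionSeries_mem_locSeries (levelOneSum.le_locSeries
            (quasiCoeff_mem_levelOneSum hℓ hh hj)))) (mul_mem (C_mem_locSeries (ofNat_mem _ 6))
              (qDerivShift_mem_locSeries hℓ (ih (by lia)))))

lemma progressionLift_qDerivShift_mem (hℓ : 3 < ℓ) (hc : 24 * β = ℓ * r + 1) {F : ℚ⟦X⟧}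
    (hF : F ∈ locSeries ℓ) (W : ℚ) : progressionLift ℓ β r (qDerivShift F) ∈ levelOneSum ℓ W := by
  have e : (C (ℓ / 24 : ℚ) : ℚ⟦X⟧) = C (ℓ : ℚ) * C (1 / 24) := by
    rw [← map_mul]
    congr 1
    ring
  rw [progressionLift_qDerivShift hc, e, mul_assoc]
  refine levelOneSum.C_mul_mem_of_locSeries (mul_mem
    (C_mem_locSeries (one_div_twentyFour_mem_locRat hℓ)) (add_mem (mul_mem (ofNat_mem _ 24)
      (qDeriv_mem_locSeries ?_)) (mul_mem (mul_mem (natCast_mem _ _)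
        (intSeries_le_locSeries ℓ eisenTwo_mem_intSeries)) ?_))) W
  · exact progressionLift_mem_locSeries hF _ _ _
  · exact progressionLift_mem_locSeries hF _ _ _

/-- For `2 ≤ j < h` the derivative in the recursion for `rankSigma j` is divisible by `ℓ` after
lifting, so that only the modular part is left. -/
lemma progressionLift_rankSigma_mem (hℓ : 3 < ℓ) (hβ : β < ℓ) (hc : 24 * β = ℓ * r + 1)
    (hh : ℓ = 2 * h + 1) {j : ℕ} (hj2 : 2 ≤ j) (hj : j < h) :
    progressionLift ℓ β r (rankSigma j) ∈ levelOneSum ℓ (j * (ℓ + 1) - 1 + ((ℓ : ℚ) - r) / 2) := by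
  obtain ⟨i, rfl⟩ : ∃ i, j = i + 1 := ⟨j - 1, by lia⟩
  rw [rankSigma_succ_eq (by lia : i ≠ 0), progressionLift_C_mul, progressionLift_sub,
    progressionLift_C_mul, progressionLift_C_mul]
  exact levelOneSum.C_mul_mem (inv_natCast_mem_locRat (not_dvd_consecutive (by lia) (by lia)))
    (sub_mem (levelOneSum.C_mul_mem (ofNat_mem _ 2) (progressionLift_partitionSeries_mul_mem hℓ hβ hc
      (quasiCoeff_mem_levelOneSum hℓ hh hj))) (levelOneSum.C_mul_mem (ofNat_mem _ 6)
        (progressionLift_qDerivShift_mem hℓ hc (rankSigma_mem_locSeries hℓ hh (by lia)) _)))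

lemma progressionLift_partitionSeries_mem (hℓ : 3 < ℓ) (hβ : β < ℓ) (hc : 24 * β = ℓ * r + 1) :
    progressionLift ℓ β r partitionSeries ∈ levelOneSum ℓ (-1 + ((ℓ : ℚ) - r) / 2) := by
  have h1 := progressionLift_partitionSeries_mul_mem hℓ hβ hc levelOneSum.one_mem'
  rw [mul_one] at h1
  exact levelOneSum.mono h1 (by linarith)

lemma progressionLift_rankSigma_one (m : ℕ) : progressionLift m β r (rankSigma 1) =
    C (1 / 2 : ℚ) * progressionLift m β r (rankMomentSeries 2) -
      C (1 / 24 : ℚ) * progressionLift m β r partitionSeries := by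
  rw [rankSigma_one, progressionLift_sub, progressionLift_C_mul, progressionLift_C_mul]

lemma progressionLift_rankMomentSeries_mem (m k : ℕ) :
    progressionLift m β r (rankMomentSeries k) ∈ locSeries ℓ :=
  progressionLift_mem_locSeries (intSeries_le_locSeries ℓ (rankMomentSeries_mem_intSeries k)) _ _ _

/-- The low rank moments are, modulo `ℓ`, a multiple of the second one plus modular forms. -/
theorem exists_progressionLift_rankMomentSeries_sub_mem (hℓ : 3 < ℓ) (hβ : β < ℓ)
    (hc : 24 * β = ℓ * r + 1) (hh : ℓ = 2 * h + 1) {k : ℕ} (hk2 : 2 ≤ k) (hk : k < h) :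
    ∃ c : ℤ, progressionLift ℓ β r (rankMomentSeries (2 * k)) -
      C (c : ℚ) * progressionLift ℓ β r (rankMomentSeries 2) ∈
        levelOneSum ℓ (k * (ℓ + 1) - 1 + ((ℓ : ℚ) - r) / 2) := by
  obtain ⟨m, rfl⟩ : ∃ m, k = m + 2 := ⟨k - 2, by lia⟩
  set W : ℚ := ((m + 2 : ℕ) : ℚ) * (ℓ + 1) - 1 + ((ℓ : ℚ) - r) / 2 with hW
  set a : ℕ → ℚ := fun i => ((2 * (m + 2)).factorial : ℚ) / (4 ^ i * ((2 * i + 1).factorial : ℚ))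
    with ha
  have ha' (i : ℕ) (hi : i ≤ m + 2) : a i ∈ locRat ℓ := rankCoeff_mem_locRat hℓ (by lia)
  have hPmem : progressionLift ℓ β r partitionSeries ∈ levelOneSum ℓ W :=
    levelOneSum.mono (progressionLift_partitionSeries_mem hℓ hβ hc) (by
      rw [hW]
      have : (0 : ℚ) ≤ ((m + 2 : ℕ) : ℚ) * (ℓ + 1) := by positivity
      linarith)
  have h1 := congrArg (progressionLift ℓ β r) (rankMomentSeries_eq_sum (m + 2))
  rw [progressionLift_sum, Finset.sum_range_succ, Finset.sum_range_succ] at h1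
  simp only [progressionLift_C_mul] at h1
  rw [show m + 2 - (m + 1) = 1 by lia, show m + 2 - (m + 2) = 0 by lia, rankSigma_zero,
    progressionLift_rankSigma_one] at h1
  obtain ⟨c, b, hb, hcb⟩ := exists_int_sub_eq (mul_mem (ha' (m + 1) (by lia)) (half_mem_locRat hℓ))
  refine ⟨c, ?_⟩
  have e1 : C (a (m + 1)) * C (1 / 2 : ℚ) = (C (c : ℚ) + C (ℓ : ℚ) * C b : ℚ⟦X⟧) := by
    rw [← map_mul, ← map_mul, ← map_add]
    congr 1
    linear_combination hcb
  have e2 : progressionLift ℓ β r (rankMomentSeries (2 * (m + 2))) -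
      C (c : ℚ) * progressionLift ℓ β r (rankMomentSeries 2) =
      ∑ i ∈ Finset.range (m + 1), C (a i) * progressionLift ℓ β r (rankSigma (m + 2 - i)) +
      C (ℓ : ℚ) * (C b * progressionLift ℓ β r (rankMomentSeries 2)) -
      C (a (m + 1)) * (C (1 / 24 : ℚ) * progressionLift ℓ β r partitionSeries) +
      C (a (m + 2)) * progressionLift ℓ β r partitionSeries := by
    linear_combination h1 + progressionLift ℓ β r (rankMomentSeries 2) * e1
  rw [e2]
  refine add_mem (sub_mem (add_mem (sum_mem fun i hi => ?_) ?_) ?_) ?_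
  · have hi' := Finset.mem_range.1 hi
    refine levelOneSum.C_mul_mem (ha' i (by lia)) (levelOneSum.mono
      (progressionLift_rankSigma_mem hℓ hβ hc hh (by lia) (by lia)) ?_)
    rw [hW]
    have : ((m + 2 - i : ℕ) : ℚ) ≤ ((m + 2 : ℕ) : ℚ) := by exact_mod_cast Nat.sub_le _ _
    have h2 : (0 : ℚ) ≤ ℓ + 1 := by positivity
    nlinarith
  · exact levelOneSum.C_mul_mem_of_locSeries (mul_mem (C_mem_locSeries hb)
      (progressionLift_rankMomentSeries_mem _ _)) _
  · exact levelOneSum.C_mul_mem (ha' _ (by lia)) (levelOneSum.C_mul_mem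
      (one_div_twentyFour_mem_locRat hℓ) hPmem)
  · exact levelOneSum.C_mul_mem (ha' _ le_rfl) hPmem

end LowMoments

/-! ### The rank moment of order `ℓ - 1` -/

section HighMoments

open PowerSeries

lemma isLevelOne_mul_eisen {ℓ h : ℕ} (hℓ : 3 < ℓ) (hh : ℓ = 2 * h + 1) :
    IsLevelOne (2 * h : ℕ) (C (ℓ : ℚ) * eisen (2 * h)) :=
  (isLevelOne_eisen (by lia) (by simp)).C_mul _

variable {ℓ β r h : ℕ} [Fact ℓ.Prime]

/-- The denominator `ℓ` first occurs in `quasiCoeff ((ℓ - 1) / 2)`, through the Eisenstein series of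
weight `ℓ - 1`. -/
lemma exists_quasiCoeff_half_eq (hℓ : 3 < ℓ) (hh : ℓ = 2 * h + 1) :
    ∃ Y ∈ levelOneSum ℓ (h * (ℓ + 1)), quasiCoeff h =
      Y - C (3 / ((2 * h : ℕ) * (2 * h).factorial : ℚ)) * eisen (2 * h) := by
  obtain ⟨m, rfl⟩ : ∃ m, h = m + 1 := ⟨h - 1, by lia⟩
  have h1 := quasiCoeff_rec (m + 1)
  have hnd : ¬ ℓ ∣ 2 * (m + 1) := Nat.not_dvd_of_pos_of_lt (by lia) (by lia)
  have h2 := C_inv_mul_C_mul (cast_ne_zero_of_not_dvd hnd) (quasiCoeff (m + 1))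
  rw [Finset.sum_range_succ, Nat.sub_self, quasiCoeff_zero, mul_one] at h1
  set T := ∑ i ∈ Finset.range m, C (1 / ((2 * (i + 1)).factorial : ℚ)) * eisen (2 * (i + 1)) *
    quasiCoeff (m + 1 - (i + 1))
  refine ⟨C ((2 * (m + 1) : ℕ) : ℚ)⁻¹ * (C (-3) * T), ?_, ?_⟩
  · refine levelOneSum.C_mul_mem (inv_natCast_mem_locRat hnd) (levelOneSum.C_mul_mem
      (neg_mem (ofNat_mem (locRat ℓ) 3)) (sum_mem fun i hi => ?_))
    have hi' := Finset.mem_range.1 hi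
    exact eisen_mul_quasiCoeff_mem hℓ (by lia) (by lia) (by lia)
      (quasiCoeff_mem_levelOneSum hℓ hh (by lia))
  · have e1 : (C (3 / ((2 * (m + 1) : ℕ) * (2 * (m + 1)).factorial : ℚ)) : ℚ⟦X⟧) =
        C ((2 * (m + 1) : ℕ) : ℚ)⁻¹ * (C 3 * C (1 / ((2 * (m + 1)).factorial : ℚ))) := by
      rw [← map_mul, ← map_mul]
      congr 1
      field_simp
    have e2 : (C ((2 * (m + 1) : ℕ) : ℚ) : ℚ⟦X⟧) = C (2 * ((m + 1 : ℕ) : ℚ)) := by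
      push_cast
      rfl
    have e3 : (C (-3 : ℚ) : ℚ⟦X⟧) = -3 := by
      rw [map_neg]
      simp only [map_ofNat]
    have e4 : (C (3 : ℚ) : ℚ⟦X⟧) = 3 := by simp only [map_ofNat]
    rw [← h2, e1, e2, h1, e3, e4]
    ring

/-- By von Staudt-Clausen, `ℓ` times the Eisenstein series with constant term `B_{ℓ - 1}` is
`ℓ`-integral. -/
lemma mul_eisen_mem_locSeries (hh : ℓ = 2 * h + 1) : C (ℓ : ℚ) * eisen (2 * h) ∈ locSeries ℓ := by
  obtain ⟨H, hH, e⟩ := exists_mul_eisen_add_one hh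
  rw [← eq_sub_iff_add_eq] at e
  rw [e]
  exact sub_mem (mul_mem (C_mem_locSeries (natCast_mem _ _)) hH) (one_mem _)

lemma progressionLift_mul_eisen_mem (hℓ : 3 < ℓ) (hβ : β < ℓ) (hc : 24 * β = ℓ * r + 1)
    (hh : ℓ = 2 * h + 1) :
    progressionLift ℓ β r (partitionSeries * (C (ℓ : ℚ) * eisen (2 * h))) ∈
      levelOneSum ℓ ((ℓ : ℚ) - 1 - 1 + ((ℓ : ℚ) - r) / 2) :=
  progressionLift_partitionSeries_mul_mem hℓ hβ hc (levelOneSum.mem_of_isLevelOne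
    (isLevelOne_mul_eisen hℓ hh) (mul_eisen_mem_locSeries hh) (by rw [hh]; push_cast; linarith))

/-- The element `-6 / ((ℓ - 1) (ℓ - 2) (ℓ - 3))` is congruent to `1` modulo `ℓ`. -/
lemma exists_neg_six_div_eq (hℓ : 3 < ℓ) (hh : ℓ = 2 * h + 1) : ∃ b ∈ locRat ℓ,
    -6 / ((2 * h : ℚ) * (2 * h - 1) * (2 * h - 2)) = 1 + ℓ * b := by
  obtain ⟨m, rfl⟩ : ∃ m, h = m + 2 := by
    have hp : ℓ.Prime := Fact.out
    exact ⟨h - 2, by lia⟩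
  have hnd : ¬ ℓ ∣ (2 * m + 4) * (2 * m + 3) * (2 * m + 2) := fun hd => by
    rcases (Nat.Prime.dvd_mul Fact.out).1 hd with hd | hd
    · exact ((Nat.Prime.dvd_mul Fact.out).1 hd).elim (Nat.not_dvd_of_pos_of_lt (by lia) (by lia))
        (Nat.not_dvd_of_pos_of_lt (by lia) (by lia))
    · exact Nat.not_dvd_of_pos_of_lt (by lia) (by lia) hd
  have h1 := div_natCast_mem_locRat (intCast_mem (locRat ℓ) (-((ℓ : ℤ) ^ 2 - 6 * ℓ + 11))) hnd
  refine ⟨_, h1, ?_⟩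
  have h0 := cast_ne_zero_of_not_dvd hnd
  have hl : (ℓ : ℚ) = 2 * m + 5 := by
    rw [hh]
    push_cast
    ring
  push_cast at h0 ⊢
  rw [show (2 * ((m : ℚ) + 2)) * (2 * (m + 2) - 1) * (2 * (m + 2) - 2) =
    (2 * m + 4) * (2 * m + 3) * (2 * m + 2) by ring]
  rw [hl]
  field_simp
  ring

/-- Fermat's little theorem for powers of `4`. -/
lemma exists_four_pow_eq (hℓ : 3 < ℓ) (hh : ℓ = 2 * h + 1) : ∃ b : ℤ, (4 : ℤ) ^ h = 1 + ℓ * b := by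
  have hp : ℓ.Prime := Fact.out
  have hcop : IsCoprime (2 : ℤ) ℓ := Nat.isCoprime_iff_coprime.2
    ((Nat.coprime_primes Nat.prime_two hp).2 (by lia))
  have h1 := (Int.ModEq.pow_card_sub_one_eq_one hp hcop).symm.dvd
  obtain ⟨b, hb⟩ := h1
  rw [show ℓ - 1 = 2 * h by lia, pow_mul] at hb
  exact ⟨b, by linear_combination hb⟩

/-- The rank moment of order `ℓ - 1`. The terms with `ℓ` in the denominator are the lifts of `P e`
and of `P`, where `e ≡ -1` is the normalized Eisenstein series of weight `ℓ - 1`; up to integral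
terms they combine to `(H₁ - H₂) / ℓ`. -/
theorem exists_progressionLift_rankMomentSeries_half_sub_mem (hℓ : 3 < ℓ) (hβ : β < ℓ)
    (hc : 24 * β = ℓ * r + 1) (hh : ℓ = 2 * h + 1) :
    ∃ (c v₁ v₂ : ℤ) (H₁ H₂ : ℚ⟦X⟧), (v₁ : ℚ) = ((ℓ : ℚ) * (ℓ - 1) - r - 1) / 2 ∧
      (v₂ : ℚ) = ((ℓ : ℚ) * (ℓ + 1) - r - 3) / 2 ∧ IsLevelOne v₁ H₁ ∧ IsLevelOne v₂ H₂ ∧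
      H₁ ∈ intSeries ∧ H₂ ∈ intSeries ∧ (∃ K ∈ locSeries ℓ, H₁ - H₂ = C (ℓ : ℚ) * K) ∧
      progressionLift ℓ β r (rankMomentSeries (2 * h)) -
        C (c : ℚ) * progressionLift ℓ β r (rankMomentSeries 2) - C (ℓ : ℚ)⁻¹ * (H₁ - H₂) ∈
          levelOneSum ℓ (((ℓ : ℚ) * (ℓ + 1) - r - 3) / 2) := by
  have hp : ℓ.Prime := Fact.out
  have hl0 : (ℓ : ℚ) ≠ 0 := by exact_mod_cast hp.ne_zero
  have hP : partitionSeries ∈ locSeries ℓ := partitionSeries_mem_locSeries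
  have hlQ : (ℓ : ℚ) = 2 * h + 1 := by exact_mod_cast hh
  have hl3 : (3 : ℚ) < ℓ := by exact_mod_cast hℓ
  set W : ℚ := ((ℓ : ℚ) * (ℓ + 1) - r - 3) / 2 with hW
  have hWh : W = h * (ℓ + 1) - 1 + ((ℓ : ℚ) - r) / 2 := by
    rw [hW]
    have : (h : ℚ) = (ℓ - 1) / 2 := by rw [hlQ]; ring
    rw [this]
    ring
  set L := progressionLift ℓ β r with hL
  set e := C (ℓ : ℚ) * eisen (2 * h) with he
  have he' : e ∈ locSeries ℓ := mul_eisen_mem_locSeries hh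
  obtain ⟨H, hH, heH⟩ := exists_mul_eisen_add_one hh
  rw [← he] at heH
  -- The forms `H₁` and `H₂` lift `P` and `-u N P e` modulo `ℓ ^ 2`, where `N` clears the denominators
  -- of `e` and `u N ≡ 1` modulo `ℓ`.
  obtain ⟨N, hN, hNe⟩ := he'
  have hcop : IsCoprime (N : ℤ) (ℓ : ℤ) :=
    Nat.isCoprime_iff_coprime.2 ((Nat.Prime.coprime_iff_not_dvd hp).2 hN).symm
  obtain ⟨u, v, huv⟩ := hcop
  have huv' : (C (u : ℚ) * C (N : ℚ) + C (v : ℚ) * C (ℓ : ℚ) : ℚ⟦X⟧) = 1 := by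
    rw [← map_mul, ← map_mul, ← map_add]
    have : (u * N + v * ℓ : ℚ) = 1 := by exact_mod_cast huv
    rw [this, map_one]
  have heL := isLevelOne_mul_eisen hℓ hh
  rw [← he] at heL
  obtain ⟨v₁, hv₁, H₁, hH₁, hH₁', K₁, hK₁, e₁⟩ :=
    exists_isLevelOne_congr_sq hℓ hβ hc IsLevelOne.one (one_mem _)
  obtain ⟨v₂, hv₂, H₂, hH₂, hH₂', K₂, hK₂, e₂⟩ :=
    exists_isLevelOne_congr_sq hℓ hβ hc ((heL.C_mul N).C_mul (-u)) (by
      have := mul_mem (C_intCast_mem_intSeries (-u)) hNe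
      push_cast at this
      exact this)
  rw [← hL] at e₁ e₂
  have hK₁' := intSeries_le_locSeries ℓ hK₁
  have hK₂' := intSeries_le_locSeries ℓ hK₂
  have hdiff : H₁ - H₂ = C (ℓ : ℚ) * (L (partitionSeries * (H - C (v : ℚ) * e)) +
      C (ℓ : ℚ) * (K₁ - K₂)) := by
    have e3 : partitionSeries * 1 - partitionSeries * (C (-(u : ℚ)) * (C (N : ℚ) * e)) =
        C (ℓ : ℚ) * (partitionSeries * (H - C (v : ℚ) * e)) := by
      rw [map_neg]
      linear_combination partitionSeries * e * huv' + partitionSeries * heH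
    have e4 := congrArg L e3
    rw [hL, progressionLift_sub, progressionLift_C_mul] at e4
    rw [hL] at e₁ e₂ ⊢
    linear_combination e₁ - e₂ + e4
  obtain ⟨Y, hY, hYW⟩ := exists_quasiCoeff_half_eq hℓ hh
  obtain ⟨x, hx, hx'⟩ := exists_neg_six_div_eq hℓ hh
  obtain ⟨y, hy'⟩ := exists_four_pow_eq hℓ hh
  obtain ⟨m, hm⟩ : ∃ m, h = m + 2 := ⟨h - 2, by lia⟩
  set a : ℕ → ℚ := fun i => ((2 * h).factorial : ℚ) / (4 ^ i * ((2 * i + 1).factorial : ℚ))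
    with ha
  have ha' (i : ℕ) (hi : i < h) : a i ∈ locRat ℓ := rankCoeff_mem_locRat hℓ (by lia)
  have hLP : L partitionSeries ∈ levelOneSum ℓ W :=
    levelOneSum.mono (progressionLift_partitionSeries_mem hℓ hβ hc) (by
      rw [hWh]
      have : (0 : ℚ) ≤ h * (ℓ + 1) := by positivity
      linarith)
  have hLe : L (partitionSeries * e) ∈ levelOneSum ℓ W :=
    levelOneSum.mono (progressionLift_mul_eisen_mem hℓ hβ hc hh) (by
      rw [hW]
      nlinarith)
  have hsum : L (rankMomentSeries (2 * h)) =
      ∑ i ∈ Finset.range m, C (a (i + 1)) * L (rankSigma (h - (i + 1))) +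
        C (a 0) * L (rankSigma h) + C (a (m + 1)) * L (rankSigma 1) +
        C (a h) * L partitionSeries := by
    have h1 := congrArg L (rankMomentSeries_eq_sum h)
    rw [hL, progressionLift_sum] at h1
    rw [show Finset.range (h + 1) = Finset.range (m + 1 + 1 + 1) by rw [hm],
      Finset.sum_range_succ, Finset.sum_range_succ, Finset.sum_range_succ'] at h1
    simp only [progressionLift_C_mul] at h1
    rw [show h - (m + 1) = 1 by lia, show m + 1 + 1 = h by lia, Nat.sub_self, Nat.sub_zero,
      rankSigma_zero] at h1
    exact h1
  obtain ⟨c, b, hb, hcb⟩ :=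
    exists_int_sub_eq (mul_mem (ha' (m + 1) (by lia)) (half_mem_locRat hℓ))
  refine ⟨c, v₁, v₂, H₁, H₂, ?_, ?_, hH₁', hH₂', hH₁, hH₂, ⟨_, ?_, hdiff⟩, ?_⟩
  · rw [hv₁]
    push_cast
    ring
  · rw [hv₂, hW, hlQ]
    push_cast
    ring
  · exact add_mem (progressionLift_mem_locSeries (mul_mem hP (sub_mem hH (mul_mem
      (C_mem_locSeries (intCast_mem _ v)) (mul_eisen_mem_locSeries hh)))) _ _ _)
      (mul_mem (C_mem_locSeries (natCast_mem _ ℓ)) (sub_mem hK₁' hK₂'))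
  have hnd : ¬ ℓ ∣ (2 * (m + 1) + 1) * (2 * (m + 1)) := not_dvd_consecutive (by lia) (by lia)
  set d : ℚ := (((2 * (m + 1) + 1) * (2 * (m + 1)) : ℕ) : ℚ) with hd
  have hd0 : d ≠ 0 := cast_ne_zero_of_not_dvd hnd
  have hd' : (2 * h - 1 : ℚ) * (2 * h - 2) = d := by
    rw [hd, hm]
    push_cast
    ring
  -- the coefficients of `P e` and of `P`, in which `ℓ` occurs in the denominator
  have q₁ : a 0 * (d⁻¹ * (2 * (3 / ((2 * h : ℕ) * (2 * h).factorial : ℚ)))) * (ℓ : ℚ)⁻¹ =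
      -(ℓ : ℚ)⁻¹ - x := by
    have hf : ((2 * h).factorial : ℚ) ≠ 0 := by positivity
    have hh0 : (h : ℚ) ≠ 0 := by
      rw [hm]
      positivity
    have h0 : a 0 = (2 * h).factorial := by simp [ha]
    have h1 : x = (-6 / ((2 * h : ℚ) * d) - 1) * (ℓ : ℚ)⁻¹ := by
      rw [← hd', ← mul_assoc, hx']
      field_simp
      ring
    rw [h0, h1]
    push_cast
    field_simp
    ring
  have h4 : ((4 : ℚ) ^ h) = 1 + ℓ * y := by exact_mod_cast hy'
  have q₂ : a h = (ℓ : ℚ)⁻¹ - (y : ℚ) * (1 / (4 ^ h : ℕ)) := by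
    have h0 : a h = 1 / (4 ^ h * ℓ) := by
      rw [ha, hlQ]
      simp only [Nat.factorial_succ]
      have hf : ((2 * h).factorial : ℚ) ≠ 0 := by positivity
      push_cast
      field_simp
    rw [h0]
    push_cast
    have h40 : ((4 : ℚ) ^ h) ≠ 0 := by positivity
    field_simp
    linear_combination -h4
  have q₃ : a (m + 1) * (1 / 2) = c + ℓ * b := by linear_combination hcb
  have E₁ : (C (a 0) * (C d⁻¹ * (C 2 * C (3 / ((2 * h : ℕ) * (2 * h).factorial : ℚ)))) *
      C (ℓ : ℚ)⁻¹ : ℚ⟦X⟧) = -C (ℓ : ℚ)⁻¹ - C x := by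
    rw [← map_mul, ← map_mul, ← map_mul, ← map_mul, q₁, map_sub, map_neg]
  have E₂ : (C (a h) : ℚ⟦X⟧) = C (ℓ : ℚ)⁻¹ - C ((y : ℚ) * (1 / (4 ^ h : ℕ))) := by
    rw [q₂, map_sub]
  have E₃ : (C (a (m + 1)) * C (1 / 2) : ℚ⟦X⟧) = C (c : ℚ) + C (ℓ : ℚ) * C b := by
    rw [← map_mul, q₃, map_add, map_mul]
  have hσ : L (rankSigma h) = C d⁻¹ * (C 2 * (L (partitionSeries * Y) -
      C (3 / ((2 * h : ℕ) * (2 * h).factorial : ℚ)) * (C (ℓ : ℚ)⁻¹ * L (partitionSeries * e))) -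
      C 6 * L (qDerivShift (rankSigma (m + 1)))) := by
    have h1 : partitionSeries * quasiCoeff (m + 1 + 1) = partitionSeries * Y -
        C (3 / ((2 * h : ℕ) * (2 * h).factorial : ℚ)) * (C (ℓ : ℚ)⁻¹ * (partitionSeries * e)) := by
      have h2 := C_inv_mul_C_mul hl0 (eisen (2 * h))
      rw [← he] at h2
      rw [show m + 1 + 1 = h by lia, hYW]
      linear_combination
        partitionSeries * C (3 / ((2 * h : ℕ) * (2 * h).factorial : ℚ)) * h2
    rw [show rankSigma h = rankSigma (m + 1 + 1) by rw [hm], rankSigma_succ_eq (by lia), h1, hL]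
    simp only [progressionLift_C_mul, progressionLift_sub]
    rfl
  have hPH : L (partitionSeries * e) + L partitionSeries = C (ℓ : ℚ) * L (partitionSeries * H) := by
    have h1 : partitionSeries * e + partitionSeries = C (ℓ : ℚ) * (partitionSeries * H) := by
      linear_combination partitionSeries * heH
    have h2 := congrArg L h1
    rw [hL, progressionLift_add, progressionLift_C_mul] at h2
    exact h2
  have hPHv : L (partitionSeries * (H - C (v : ℚ) * e)) =
      L (partitionSeries * H) - C (v : ℚ) * L (partitionSeries * e) := by
    rw [hL, ← progressionLift_C_mul, ← progressionLift_sub]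
    congr 1
    ring
  have h1 := C_inv_mul_C_mul hl0 (L (partitionSeries * H))
  have key : L (rankMomentSeries (2 * h)) - C (c : ℚ) * L (rankMomentSeries 2) -
      C (ℓ : ℚ)⁻¹ * (H₁ - H₂) =
      ∑ i ∈ Finset.range m, C (a (i + 1)) * L (rankSigma (h - (i + 1))) +
      C (a 0) * (C d⁻¹ * (C 2 * L (partitionSeries * Y))) -
      C (a 0) * (C d⁻¹ * (C 6 * L (qDerivShift (rankSigma (m + 1))))) +
      C x * L (partitionSeries * e) - C ((y : ℚ) * (1 / (4 ^ h : ℕ))) * L partitionSeries -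
      C (a (m + 1)) * (C (1 / 24) * L partitionSeries) + C (v : ℚ) * L (partitionSeries * e) +
      C (ℓ : ℚ) * (C b * L (rankMomentSeries 2) - (K₁ - K₂)) := by
    rw [hdiff, C_inv_mul_C_mul hl0, hPHv, hsum, hσ, hL, progressionLift_rankSigma_one, ← hL]
    rw [← hPH] at h1
    linear_combination (-L (partitionSeries * e)) * E₁ + L partitionSeries * E₂ +
      L (rankMomentSeries 2) * E₃ + h1
  rw [key]
  have hW0 : (0 : ℚ) ≤ (ℓ : ℚ) + 1 := by positivity
  refine add_mem (add_mem (sub_mem (sub_mem (add_mem (sub_mem (add_mem (sum_mem fun i hi => ?_)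
    ?_) ?_) ?_) ?_) ?_) ?_) ?_
  · have hi' := Finset.mem_range.1 hi
    refine levelOneSum.C_mul_mem (ha' _ (by lia)) (levelOneSum.mono
      (progressionLift_rankSigma_mem hℓ hβ hc hh (by lia) (by lia)) ?_)
    rw [hWh]
    have : ((h - (i + 1) : ℕ) : ℚ) ≤ (h : ℚ) := by exact_mod_cast Nat.sub_le _ _
    nlinarith
  · refine levelOneSum.C_mul_mem (ha' _ (by lia)) (levelOneSum.C_mul_mem
      (inv_natCast_mem_locRat hnd) (levelOneSum.C_mul_mem (ofNat_mem _ 2) (levelOneSum.mono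
        (progressionLift_partitionSeries_mul_mem hℓ hβ hc hY) hWh.ge)))
  · exact levelOneSum.C_mul_mem (ha' _ (by lia)) (levelOneSum.C_mul_mem
      (inv_natCast_mem_locRat hnd) (levelOneSum.C_mul_mem (ofNat_mem _ 6)
        (progressionLift_qDerivShift_mem hℓ hc (rankSigma_mem_locSeries hℓ hh (by lia)) _)))
  · exact levelOneSum.C_mul_mem hx hLe
  · exact levelOneSum.C_mul_mem (mul_mem (intCast_mem _ y)
      (one_div_mem_locRat (not_dvd_four_pow hℓ h))) hLP
  · exact levelOneSum.C_mul_mem (ha' _ (by lia)) (levelOneSum.C_mul_mem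
      (one_div_twentyFour_mem_locRat hℓ) hLP)
  · exact levelOneSum.C_mul_mem (intCast_mem _ v) hLe
  · exact levelOneSum.C_mul_mem_of_locSeries (sub_mem (mul_mem (C_mem_locSeries hb)
      (progressionLift_rankMomentSeries_mem _ _)) (sub_mem hK₁' hK₂')) _

end HighMoments

/-! ### The second rank moment -/

section SecondMoment

open PowerSeries

lemma etaPowDeriv_C_mul (r : ℕ) (a : ℚ) (F : ℚ⟦X⟧) :
    etaPowDeriv r (C a * F) = C a * etaPowDeriv r F := by
  rw [etaPowDeriv, etaPowDeriv, qDeriv_C_mul]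
  ring

/-- Multiplication by `E₂` expressed through `q d/dq` and the Serre derivative. -/
lemma C_mul_partitionSeries_mul_eisenTwo_mul (w : ℤ) (F : ℚ⟦X⟧) :
    C (2 * w - 1 : ℚ) * (partitionSeries * (eisenTwo * F)) =
      C 24 * qDerivShift (partitionSeries * F) -
        C 2 * (partitionSeries * (12 * qDeriv F - (w : ℚ⟦X⟧) * eisenTwo * F)) := by
  have e1 : (C (2 * w - 1 : ℚ) : ℚ⟦X⟧) = 2 * (w : ℚ⟦X⟧) - 1 := by
    rw [map_sub, map_mul, map_one, map_intCast]
    simp only [map_ofNat]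
  have e2 : (24 * C (1 / 24 : ℚ) : ℚ⟦X⟧) = 1 := by
    rw [show (24 : ℚ⟦X⟧) = C 24 by simp only [map_ofNat], ← map_mul]
    norm_num
  have e3 : qDeriv (partitionSeries * F) =
      partitionSeries * qDeriv F + F * (sigmaSeries 1 * partitionSeries) := by
    rw [Derivation.leibniz, qDeriv_partitionSeries, smul_eq_mul, smul_eq_mul]
  rw [e1, qDerivShift, e3, eisenTwo]
  simp only [map_ofNat]
  linear_combination (partitionSeries * F) * e2

variable {ℓ β r h : ℕ} [Fact ℓ.Prime]

/-- Multiplied by `ℓ`, the lift of `rankSigma ((ℓ - 1) / 2)` is a modular form modulo `ℓ`. -/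
lemma mul_progressionLift_rankSigma_half_mem (hℓ : 3 < ℓ) (hβ : β < ℓ) (hc : 24 * β = ℓ * r + 1)
    (hh : ℓ = 2 * h + 1) : C (ℓ : ℚ) * progressionLift ℓ β r (rankSigma h) ∈
      levelOneSum ℓ ((ℓ : ℚ) - 1 - 1 + ((ℓ : ℚ) - r) / 2) := by
  obtain ⟨Y, hY, hYW⟩ := exists_quasiCoeff_half_eq hℓ hh
  obtain ⟨m, hm⟩ : ∃ m, h = m + 2 := by
    have hp : ℓ.Prime := Fact.out
    exact ⟨h - 2, by lia⟩
  have hnd : ¬ ℓ ∣ (2 * (m + 1) + 1) * (2 * (m + 1)) := not_dvd_consecutive (by lia) (by lia)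
  have hγ : (3 / ((2 * h : ℕ) * (2 * h).factorial : ℚ)) ∈ locRat ℓ := by
    have h1 : ¬ ℓ ∣ (2 * h) * (2 * h).factorial := fun hd =>
      ((Nat.Prime.dvd_mul Fact.out).1 hd).elim (Nat.not_dvd_of_pos_of_lt (by lia) (by lia))
        (not_dvd_factorial (by lia))
    have h2 := div_natCast_mem_locRat (ofNat_mem (locRat ℓ) 3) h1
    push_cast at h2 ⊢
    exact h2
  have e : C (ℓ : ℚ) * rankSigma h =
      C (((2 * (m + 1) + 1) * (2 * (m + 1)) : ℕ) : ℚ)⁻¹ *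
        (C 2 * (C (ℓ : ℚ) * (partitionSeries * Y) -
          C (3 / ((2 * h : ℕ) * (2 * h).factorial : ℚ)) *
            (partitionSeries * (C (ℓ : ℚ) * eisen (2 * h)))) -
          C 6 * (C (ℓ : ℚ) * qDerivShift (rankSigma (m + 1)))) := by
    rw [show rankSigma h = rankSigma (m + 1 + 1) by rw [hm], rankSigma_succ_eq (by lia),
      show m + 1 + 1 = h by lia, hYW]
    ring
  rw [← progressionLift_C_mul, e]
  simp only [progressionLift_sub, progressionLift_C_mul]
  refine levelOneSum.C_mul_mem (inv_natCast_mem_locRat hnd) (sub_mem (levelOneSum.C_mul_mem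
    (ofNat_mem _ 2) (sub_mem (levelOneSum.C_mul_mem_of_locSeries (progressionLift_mem_locSeries
      (mul_mem partitionSeries_mem_locSeries (levelOneSum.le_locSeries hY)) _ _ _) _)
      (levelOneSum.C_mul_mem hγ (progressionLift_mul_eisen_mem hℓ hβ hc hh))))
    (levelOneSum.C_mul_mem (ofNat_mem _ 6) (levelOneSum.C_mul_mem (natCast_mem _ ℓ)
      (progressionLift_qDerivShift_mem hℓ hc (rankSigma_mem_locSeries hℓ hh (by lia)) _))))

/-- The coefficient `quasiCoeff ((ℓ + 1) / 2)`, up to terms without `ℓ` in the denominator. -/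
lemma exists_quasiCoeff_half_succ_eq (hℓ : 3 < ℓ) (hh : ℓ = 2 * h + 1) :
    ∃ Y ∈ levelOneSum ℓ ((h + 1 : ℕ) * (ℓ + 1)), ∃ α ∈ locRat ℓ,
      C ((2 * (h + 1) : ℕ) : ℚ) * quasiCoeff (h + 1) = Y + C α * (eisenTwo * eisen (2 * h)) +
        C (-3 / ((2 * (h + 1)).factorial : ℚ)) * eisen (2 * (h + 1)) := by
  obtain ⟨Y, hY, hYW⟩ := exists_quasiCoeff_half_eq hℓ hh
  obtain ⟨m, hm⟩ : ∃ m, h = m + 2 := by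
    have hp : ℓ.Prime := Fact.out
    exact ⟨h - 2, by lia⟩
  set γ : ℚ := 3 / ((2 * h : ℕ) * (2 * h).factorial : ℚ) with hγ
  have hγ' : γ ∈ locRat ℓ := by
    have h1 : ¬ ℓ ∣ (2 * h) * (2 * h).factorial := fun hd =>
      ((Nat.Prime.dvd_mul Fact.out).1 hd).elim (Nat.not_dvd_of_pos_of_lt (by lia) (by lia))
        (not_dvd_factorial (by lia))
    have h2 := div_natCast_mem_locRat (ofNat_mem (locRat ℓ) 3) h1
    rw [hγ]
    push_cast at h2 ⊢
    exact h2
  have hW1 : quasiCoeff 1 = C (-3 / 4) * eisen 2 := by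
    have h1 := quasiCoeff_rec 1
    rw [Finset.sum_range_one] at h1
    norm_num [quasiCoeff_zero, Nat.factorial] at h1
    have e1 : (C (1 / 2 : ℚ) : ℚ⟦X⟧) * 2 = 1 := by
      rw [show (2 : ℚ⟦X⟧) = C 2 by simp only [map_ofNat], ← map_mul]
      norm_num
    have e2 : (C (-3 / 4 : ℚ) : ℚ⟦X⟧) = -3 * (C (1 / 2) * C (1 / 2)) := by
      rw [show (-3 : ℚ⟦X⟧) = C (-3) by rw [map_neg]; simp only [map_ofNat], ← map_mul, ← map_mul]
      norm_num
    rw [show (C (2 : ℚ) : ℚ⟦X⟧) = 2 by simp only [map_ofNat]] at h1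
    linear_combination C (1 / 2 : ℚ) * h1 - quasiCoeff 1 * e1 - eisen 2 * e2
  have h1 := quasiCoeff_rec (h + 1)
  rw [show Finset.range (h + 1) = Finset.range (m + 1 + 1 + 1) by rw [hm],
    Finset.sum_range_succ, Finset.sum_range_succ, Finset.sum_range_succ'] at h1
  rw [show m + 1 + 1 = h by lia, show h + 1 - (h + 1) = 0 by lia, show h + 1 - h = 1 by lia,
    show h + 1 - (0 + 1) = h by lia, quasiCoeff_zero, hW1, hYW, mul_one] at h1
  set T := ∑ i ∈ Finset.range m, C (1 / ((2 * (i + 1 + 1)).factorial : ℚ)) *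
    eisen (2 * (i + 1 + 1)) * quasiCoeff (h + 1 - (i + 1 + 1))
  have hT : T ∈ levelOneSum ℓ ((h + 1 : ℕ) * (ℓ + 1)) := sum_mem fun i hi => by
    have hi' := Finset.mem_range.1 hi
    exact eisen_mul_quasiCoeff_mem hℓ (by lia) (by lia) (by lia)
      (quasiCoeff_mem_levelOneSum hℓ hh (by lia))
  have h3 : (-3 : ℚ) ∈ locRat ℓ := neg_mem (ofNat_mem (locRat ℓ) 3)
  have h12 : (-3 * (1 / 2) * (1 / 6) : ℚ) ∈ locRat ℓ := by
    have : ((-3 : ℚ) * (1 / 2) * (1 / 6)) = -(1 / 2) * (1 / 2) := by norm_num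
    rw [this]
    exact mul_mem (neg_mem (half_mem_locRat hℓ)) (half_mem_locRat hℓ)
  refine ⟨C (-3) * T + C (-3 * (1 / 2) * (1 / 6)) * (eisenTwo * Y), ?_,
    3 * (1 / 2) * (1 / 6) * γ + 9 * (1 / 2) * (1 / 2) * (1 / 6) * (1 / ((2 * h).factorial : ℚ)),
    ?_, ?_⟩
  · refine add_mem (levelOneSum.C_mul_mem h3 hT) (levelOneSum.C_mul_mem h12
      (levelOneSum.mono (levelOneSum.mul_mem' (eisenTwo_mem_levelOneSum hℓ) hY) ?_))
    push_cast
    linarith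
  · have h12' : (3 * (1 / 2) * (1 / 6) : ℚ) ∈ locRat ℓ := by
      have := neg_mem h12
      norm_num at this ⊢
      exact this
    have h12'' : (9 * (1 / 2) * (1 / 2) * (1 / 6) : ℚ) ∈ locRat ℓ := by
      have := mul_mem (mul_mem (ofNat_mem (locRat ℓ) 3) (half_mem_locRat hℓ)) h12'
      norm_num at this ⊢
      exact this
    exact add_mem (mul_mem h12' hγ') (mul_mem h12'' (inv_factorial_mem_locRat (by lia)))
  · have c1 : (C (2 * ((h + 1 : ℕ) : ℚ)) : ℚ⟦X⟧) = C ((2 * (h + 1) : ℕ) : ℚ) := by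
      push_cast
      rfl
    rw [c1] at h1
    rw [h1, zero_add, mul_one, eisen_two, Nat.factorial_two]
    have c2 : (C (-3 / ((2 * (h + 1)).factorial : ℚ)) : ℚ⟦X⟧) =
        -3 * C (1 / ((2 * (h + 1)).factorial : ℚ)) := by
      rw [show (-3 : ℚ⟦X⟧) = C (-3) by rw [map_neg]; simp only [map_ofNat], ← map_mul]
      congr 1
      ring
    have c3 : (C (-3 : ℚ) : ℚ⟦X⟧) = -3 := by
      rw [map_neg]
      simp only [map_ofNat]
    have c4 : (C (-3 * (1 / 2) * (1 / 6) : ℚ) : ℚ⟦X⟧) =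
        -3 * (C (1 / (2 : ℕ) : ℚ) * C (1 / 6)) := by
      rw [← c3, ← map_mul, ← map_mul]
      congr 1
      norm_num
    have c5 : (C (3 * (1 / 2) * (1 / 6) * γ +
        9 * (1 / 2) * (1 / 2) * (1 / 6) * (1 / ((2 * h).factorial : ℚ))) : ℚ⟦X⟧) =
        -3 * (-(C (1 / (2 : ℕ) : ℚ) * C (1 / 6) * C γ) +
          C (1 / ((2 * h).factorial : ℚ)) * C (-3 / 4) * C (1 / 6)) := by
      rw [← c3]
      simp only [← map_mul, ← map_add, ← map_neg]
      congr 1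
      push_cast
      ring
    rw [c2, c3, c4, c5]
    ring

/-- The lift of `partitionSeries * quasiCoeff ((ℓ + 1) / 2)` involves, up to modular forms, a
single term with `ℓ` in the denominator: the product with `E₂ E_{ℓ-1}` is a derivative plus the
product with a modular form of weight `ℓ + 1`. -/
lemma exists_progressionLift_quasiCoeff_half_succ_sub_mem (hℓ : 3 < ℓ) (hβ : β < ℓ)
    (hc : 24 * β = ℓ * r + 1) (hh : ℓ = 2 * h + 1) :
    ∃ M ∈ locSeries ℓ, IsLevelOne ((2 * (h + 1) : ℕ) : ℤ) M ∧
      C ((2 * (h + 1) : ℕ) : ℚ) * progressionLift ℓ β r (partitionSeries * quasiCoeff (h + 1)) -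
        C (ℓ : ℚ)⁻¹ * progressionLift ℓ β r (partitionSeries * M) ∈
          levelOneSum ℓ ((h + 1 : ℕ) * (ℓ + 1) - 1 + ((ℓ : ℚ) - r) / 2) := by
  have hp : ℓ.Prime := Fact.out
  have hl0 : (ℓ : ℚ) ≠ 0 := by exact_mod_cast hp.ne_zero
  obtain ⟨Y, hY, α, hα, hYW⟩ := exists_quasiCoeff_half_succ_eq hℓ hh
  set e := C (ℓ : ℚ) * eisen (2 * h) with he
  have he' : e ∈ locSeries ℓ := mul_eisen_mem_locSeries hh
  have heL : IsLevelOne ((2 * h : ℕ) : ℤ) e := isLevelOne_mul_eisen hℓ hh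
  set s := 12 * qDeriv e - (((2 * h : ℕ) : ℤ) : ℚ⟦X⟧) * eisenTwo * e with hs
  have hsL : IsLevelOne ((2 * (h + 1) : ℕ) : ℤ) s := heL.serre.cast (by push_cast; ring)
  have hs' : s ∈ locSeries ℓ := sub_mem (mul_mem (ofNat_mem _ 12) (qDeriv_mem_locSeries he'))
    (mul_mem (mul_mem (intCast_mem _ _) (intSeries_le_locSeries ℓ eisenTwo_mem_intSeries)) he')
  have hnd : ¬ ℓ ∣ 4 * h - 1 := fun hd => by
    have h1 : ℓ ∣ 2 * ℓ - (4 * h - 1) := Nat.dvd_sub (dvd_mul_left _ _) hd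
    rw [show 2 * ℓ - (4 * h - 1) = 3 by lia] at h1
    exact absurd (Nat.le_of_dvd (by norm_num) h1) (by lia)
  have hnd2 : ¬ ℓ ∣ 2 * (h + 1) * (2 * h).factorial := fun hd =>
    (hp.dvd_mul.1 hd).elim (fun hd => by
      have h1 := (Nat.dvd_add_right (dvd_refl ℓ)).1 (show ℓ ∣ ℓ + 1 by
        rwa [show ℓ + 1 = 2 * (h + 1) by lia])
      exact hp.one_lt.ne' (Nat.dvd_one.1 h1)) (not_dvd_factorial (by lia))
  have hnd3 : ¬ (ℓ - 1) ∣ 2 * (h + 1) := fun hd => by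
    have h1 : ℓ - 1 ∣ 2 := (Nat.dvd_add_right (dvd_refl (ℓ - 1))).1 (by
      rwa [show ℓ - 1 + 2 = 2 * (h + 1) by lia])
    exact absurd (Nat.le_of_dvd (by norm_num) h1) (by lia)
  set t : ℚ := ((4 * h - 1 : ℕ) : ℚ)⁻¹ with ht
  have ht' : t ∈ locRat ℓ := inv_natCast_mem_locRat hnd
  set δ : ℚ := -3 / ((2 * (h + 1) * (2 * h).factorial : ℕ) : ℚ) with hδ
  have hδ' : δ ∈ locRat ℓ :=
    div_natCast_mem_locRat (neg_mem (ofNat_mem (locRat ℓ) 3)) hnd2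
  refine ⟨C δ * eisen (2 * (h + 1)) - C (2 * (α * t)) * s, ?_, ?_, ?_⟩
  · exact sub_mem (mul_mem (C_mem_locSeries hδ') (eisen_mem_locSeries hnd3))
      (mul_mem (C_mem_locSeries (mul_mem (ofNat_mem _ 2) (mul_mem hα ht'))) hs')
  · have h1 := ((isLevelOne_eisen (k := 2 * (h + 1)) (by lia) (by simp)).C_mul δ).add
      (hsL.C_mul (-(2 * (α * t))))
    rw [map_neg, neg_mul, ← sub_eq_add_neg] at h1
    exact h1
  have h4 : ((4 * h - 1 : ℕ) : ℚ) = 2 * (((2 * h : ℕ) : ℤ) : ℚ) - 1 := by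
    rw [Nat.cast_sub (by lia)]
    push_cast
    ring
  have hD := C_mul_partitionSeries_mul_eisenTwo_mul ((2 * h : ℕ) : ℤ) e
  rw [← hs, ← h4] at hD
  have hD' := congrArg (fun F => C t * F) hD
  rw [ht, C_inv_mul_C_mul (cast_ne_zero_of_not_dvd hnd), ← ht] at hD'
  have hδl : -3 / ((2 * (h + 1)).factorial : ℚ) = (ℓ : ℚ)⁻¹ * δ := by
    rw [hδ, hh, show 2 * (h + 1) = 2 * h + 1 + 1 by ring, Nat.factorial_succ, Nat.factorial_succ]
    push_cast
    field_simp
  have hdecomp : C ((2 * (h + 1) : ℕ) : ℚ) * (partitionSeries * quasiCoeff (h + 1)) =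
      partitionSeries * Y + C (α * t * 24 * (ℓ : ℚ)⁻¹) * qDerivShift (partitionSeries * e) +
      C (ℓ : ℚ)⁻¹ * (partitionSeries * (C δ * eisen (2 * (h + 1)) - C (2 * (α * t)) * s)) := by
    have h1 : C (ℓ : ℚ)⁻¹ * e = eisen (2 * h) := C_inv_mul_C_mul hl0 _
    rw [mul_left_comm, hYW, hδl, ← h1]
    simp only [map_mul] at hD' ⊢
    linear_combination C α * C (ℓ : ℚ)⁻¹ * hD'
  have hlift := congrArg (progressionLift ℓ β r) hdecomp
  rw [progressionLift_add, progressionLift_add, progressionLift_C_mul, progressionLift_C_mul,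
    progressionLift_C_mul, progressionLift_qDerivShift hc, ← mul_assoc, ← map_mul] at hlift
  rw [hlift, show α * t * 24 * (ℓ : ℚ)⁻¹ * (ℓ / 24) = α * t by field_simp, add_sub_cancel_right]
  have h3 : (3 : ℚ) < ℓ := by exact_mod_cast hℓ
  have h2 : (2 : ℚ) ≤ h := by
    have : 2 ≤ h := by lia
    exact_mod_cast this
  refine add_mem (progressionLift_partitionSeries_mul_mem hℓ hβ hc hY) (levelOneSum.C_mul_mem
    (mul_mem hα ht') (levelOneSum.mono (etaPowDeriv_mem_levelOneSum hℓ r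
      (progressionLift_mul_eisen_mem hℓ hβ hc hh)) ?_))
  push_cast
  nlinarith

/-- By Fermat's little theorem, the rank moments of orders `ℓ + 1` and `2` are congruent. -/
lemma exists_rankMomentSeries_sub_eq : ∃ H ∈ locSeries ℓ,
    rankMomentSeries (ℓ + 1) - rankMomentSeries 2 = C (ℓ : ℚ) * H := by
  have h1 (n : ℕ) : ∃ b : ℤ, rankMoment (ℓ + 1) n - rankMoment 2 n = ℓ * b := by
    rw [rankMoment_eq_sum, rankMoment_eq_sum, ← Finset.sum_sub_distrib]
    refine Finset.dvd_sum fun p _ => (ZMod.intCast_zmod_eq_zero_iff_dvd _ ℓ).1 ?_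
    push_cast
    rw [pow_succ, ZMod.pow_card]
    ring
  choose b hb using h1
  refine ⟨PowerSeries.mk fun n => (b n : ℚ), intSeries_le_locSeries ℓ
    (mem_intSeries_iff.2 fun n => ⟨b n, by simp⟩), ?_⟩
  ext n
  rw [map_sub, coeff_C_mul, rankMomentSeries, rankMomentSeries, coeff_mk, coeff_mk, coeff_mk]
  exact_mod_cast hb n

/-- The second rank moment. It is recovered from the moment of order `ℓ + 1`, whose expansion
contains half of it; the terms with `ℓ` in the denominator form the lift of a single modular form,
which is divisible by `ℓ` because everything else is `ℓ`-integral. -/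
theorem progressionLift_rankMomentSeries_two_mem (hℓ : 3 < ℓ) (hβ : β < ℓ)
    (hc : 24 * β = ℓ * r + 1) (hh : ℓ = 2 * h + 1) :
    progressionLift ℓ β r (rankMomentSeries 2) ∈
      levelOneSum ℓ (((ℓ : ℚ) * (ℓ + 3) - r - 1) / 2) := by
  have hp : ℓ.Prime := Fact.out
  have hl0 : (ℓ : ℚ) ≠ 0 := by exact_mod_cast hp.ne_zero
  have hlQ : (ℓ : ℚ) = 2 * h + 1 := by exact_mod_cast hh
  have hl3 : (3 : ℚ) < ℓ := by exact_mod_cast hℓ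
  obtain ⟨m, hm⟩ : ∃ m, h = m + 2 := ⟨h - 2, by lia⟩
  have hh2 : (2 : ℚ) ≤ h := by
    have : 2 ≤ h := by lia
    exact_mod_cast this
  set W : ℚ := ((ℓ : ℚ) * (ℓ + 3) - r - 1) / 2 with hW
  have hWh : W = (h + 1 : ℕ) * (ℓ + 1) - 1 + ((ℓ : ℚ) - r) / 2 := by
    rw [hW, hlQ]
    push_cast
    ring
  set L := progressionLift ℓ β r with hL
  obtain ⟨M, hM, hML, hMW⟩ := exists_progressionLift_quasiCoeff_half_succ_sub_mem hℓ hβ hc hh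
  rw [← hL, ← hWh] at hMW
  set Q := C ((2 * (h + 1) : ℕ) : ℚ) * L (partitionSeries * quasiCoeff (h + 1)) -
    C (ℓ : ℚ)⁻¹ * L (partitionSeries * M) with hQ
  have hS := mul_progressionLift_rankSigma_half_mem hℓ hβ hc hh
  rw [← hL] at hS
  set S := C (ℓ : ℚ) * L (rankSigma h) with hSdef
  have hDS := etaPowDeriv_mem_levelOneSum hℓ r hS
  have hLP : L partitionSeries ∈ levelOneSum ℓ W :=
    levelOneSum.mono (progressionLift_partitionSeries_mem hℓ hβ hc) (by
      rw [hW]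
      nlinarith)
  set f : ℚ := ((2 * h - 1).factorial : ℚ) with hf
  set a : ℕ → ℚ := fun i => ((2 * (h + 1)).factorial : ℚ) / (4 ^ i * ((2 * i + 1).factorial : ℚ))
    with ha
  have hfac : ((2 * (h + 1)).factorial : ℚ) =
      ((2 * (h + 1) : ℕ) : ℚ) * (((2 * h + 1) * (2 * h) : ℕ) : ℚ) * f := by
    rw [hf, hm, show 2 * (m + 2) - 1 = 2 * m + 3 by lia,
      show 2 * (m + 2 + 1) = 2 * m + 3 + 1 + 1 + 1 by ring, Nat.factorial_succ,
      Nat.factorial_succ, Nat.factorial_succ]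
    push_cast
    ring
  have hfac' : ((2 * (h + 1)).factorial : ℚ) = ℓ * ((2 * (h + 1) * (2 * h).factorial : ℕ) : ℚ) := by
    rw [show 2 * (h + 1) = 2 * h + 1 + 1 by lia, Nat.factorial_succ, Nat.factorial_succ, hh]
    push_cast
    ring
  -- the coefficients in the expansion of the moment of order `ℓ + 1`
  have a0 : a 0 = ((2 * (h + 1)).factorial : ℚ) := by simp [ha]
  have a1 : a 1 = ℓ * (((2 * (h + 1) * (2 * h).factorial : ℕ) : ℚ) * (1 / 24)) := by
    simp only [ha, hfac']
    norm_num [Nat.factorial]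
    ring
  have ai (i : ℕ) (hi : i < h) : ∃ b ∈ locRat ℓ, a i = ℓ * b := by
    have h1 : ¬ ℓ ∣ 4 ^ i * (2 * i + 1).factorial := fun hd =>
      (hp.dvd_mul.1 hd).elim (not_dvd_four_pow hℓ i) (not_dvd_factorial (by lia))
    refine ⟨_, div_natCast_mem_locRat
      (natCast_mem (locRat ℓ) (2 * (h + 1) * (2 * h).factorial)) h1, ?_⟩
    simp only [ha, hfac']
    push_cast
    ring
  obtain ⟨y, hy⟩ := exists_four_pow_eq hℓ hh
  have h4 : ((4 : ℚ) ^ h) = 1 + ℓ * y := by exact_mod_cast hy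
  have h40 : ((4 : ℚ) ^ h) ≠ 0 := by positivity
  have ah : a h = 1 + ℓ * ((1 - y) * (1 / (4 ^ h : ℕ))) := by
    have h1 : a h = (2 * h + 2) / 4 ^ h := by
      simp only [ha]
      rw [show 2 * (h + 1) = 2 * h + 1 + 1 by ring, Nat.factorial_succ (2 * h + 1)]
      have hf0 : ((2 * h + 1).factorial : ℚ) ≠ 0 := by positivity
      push_cast
      field_simp
      ring
    rw [h1]
    push_cast
    field_simp
    linear_combination hlQ * (-1 : ℚ) + (-1 : ℚ) * h4
  have ah1 : a (h + 1) = 1 / (4 ^ (h + 1) * (2 * h + 3) : ℕ) := by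
    simp only [ha]
    rw [Nat.factorial_succ]
    have hf0 : ((2 * (h + 1)).factorial : ℚ) ≠ 0 := by positivity
    push_cast
    field_simp
    ring
  have ah1' : a (h + 1) ∈ locRat ℓ := by
    rw [ah1]
    refine one_div_mem_locRat fun hd => (hp.dvd_mul.1 hd).elim (not_dvd_four_pow hℓ _) fun hd => ?_
    have h1 := (Nat.dvd_add_right (dvd_refl ℓ)).1 (show ℓ ∣ ℓ + 2 by
      rwa [show ℓ + 2 = 2 * h + 3 by lia])
    exact absurd (Nat.le_of_dvd (by norm_num) h1) (by lia)
  have hsum : L (rankMomentSeries (ℓ + 1)) =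
      ∑ i ∈ Finset.range m, C (a (i + 1 + 1)) * L (rankSigma (h + 1 - (i + 1 + 1))) +
        C (a 1) * L (rankSigma h) + C (a 0) * L (rankSigma (h + 1)) +
        C (a h) * L (rankSigma 1) + C (a (h + 1)) * L partitionSeries := by
    have h1 := congrArg L (rankMomentSeries_eq_sum (h + 1))
    rw [hL, progressionLift_sum] at h1
    rw [show Finset.range (h + 1 + 1) = Finset.range (m + 1 + 1 + 1 + 1) by rw [hm],
      Finset.sum_range_succ, Finset.sum_range_succ, Finset.sum_range_succ',
      Finset.sum_range_succ'] at h1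
    simp only [progressionLift_C_mul] at h1
    rw [show m + 1 + 1 = h by lia, show m + 3 = h + 1 by lia, show h + 1 - h = 1 by lia,
      Nat.sub_self, Nat.sub_zero, show h + 1 - (0 + 1) = h by lia, rankSigma_zero] at h1
    rw [show ℓ + 1 = 2 * (h + 1) by lia]
    exact h1
  -- the first two terms of the expansion
  have hσ : C (a 0) * L (rankSigma (h + 1)) = C (2 * f) * Q +
      C (ℓ : ℚ)⁻¹ * L (partitionSeries * (C (2 * f) * M)) -
      C (((2 * (h + 1) : ℕ) : ℚ) * f * 6 * (1 / 24)) * etaPowDeriv r S := by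
    have hd0 : (((2 * h + 1) * (2 * h) : ℕ) : ℚ) ≠ 0 := by
      have : (2 * h + 1) * (2 * h) ≠ 0 := by
        rw [hm]
        positivity
      exact_mod_cast this
    have h1 := congrArg L (rankSigma_succ_eq (show h ≠ 0 by lia))
    have h2 : C (a 0) * C (((2 * h + 1) * (2 * h) : ℕ) : ℚ)⁻¹ =
        (C ((2 * (h + 1) : ℕ) : ℚ) * C f : ℚ⟦X⟧) := by
      rw [← map_mul, ← map_mul]
      congr 1
      rw [a0, hfac]
      field_simp
    have h3 : C (ℓ / 24 : ℚ) * etaPowDeriv r (L (rankSigma h)) =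
        C (1 / 24) * etaPowDeriv r S := by
      rw [hSdef, etaPowDeriv_C_mul, ← mul_assoc, ← map_mul]
      congr 2
      ring
    have h4 : L (partitionSeries * (C (2 * f) * M)) =
        C (2 * f) * L (partitionSeries * M) := by
      rw [hL, ← progressionLift_C_mul]
      congr 1
      ring
    rw [hL, progressionLift_C_mul, progressionLift_sub, progressionLift_C_mul,
      progressionLift_C_mul, progressionLift_qDerivShift hc, ← hL, h3] at h1
    rw [h1, h4, ← mul_assoc, h2, hQ]
    simp only [map_mul]
    ring
  have hσ1 := progressionLift_rankSigma_one (β := β) (r := r) ℓ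
  rw [← hL] at hσ1
  obtain ⟨K, hK, hKe⟩ := exists_rankMomentSeries_sub_eq (ℓ := ℓ)
  have hK' : L (rankMomentSeries (ℓ + 1)) = L (rankMomentSeries 2) + C (ℓ : ℚ) * L K := by
    have h1 := congrArg L hKe
    rw [hL, progressionLift_sub, progressionLift_C_mul] at h1
    rw [hL]
    linear_combination h1
  set z : ℚ := (1 - y) * (1 / (4 ^ h : ℕ)) with hz
  have hz' : z ∈ locRat ℓ := mul_mem (sub_mem (one_mem _) (intCast_mem _ y))
    (one_div_mem_locRat (not_dvd_four_pow hℓ h))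
  have hahm : a h ∈ locRat ℓ := by
    rw [ah]
    exact add_mem (one_mem _) (mul_mem (natCast_mem _ ℓ) hz')
  have hfm : f ∈ locRat ℓ := natCast_mem _ _
  set R := ∑ i ∈ Finset.range m, C (a (i + 1 + 1)) * L (rankSigma (h + 1 - (i + 1 + 1)))
  set M' := C (2 * f) * M with hM'
  set U := R + C (((2 * (h + 1) * (2 * h).factorial : ℕ) : ℚ) * (1 / 24)) * S +
    C (2 * f) * Q - C (((2 * (h + 1) : ℕ) : ℚ) * f * 6 * (1 / 24)) * etaPowDeriv r S -
    C (a h) * (C (1 / 24) * L partitionSeries) + C (a (h + 1)) * L partitionSeries +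
    C (ℓ : ℚ) * (C z * (C (1 / 2) * L (rankMomentSeries 2)) - L K) with hU
  have hUmem : U ∈ levelOneSum ℓ W := by
    refine add_mem (add_mem (sub_mem (sub_mem (add_mem (add_mem (sum_mem fun i hi => ?_) ?_) ?_)
      ?_) ?_) ?_) ?_
    · have hi' := Finset.mem_range.1 hi
      obtain ⟨b, hb, hb'⟩ := ai (i + 1 + 1) (by lia)
      rw [hb', map_mul, mul_assoc]
      exact levelOneSum.C_mul_mem_of_locSeries (mul_mem (C_mem_locSeries hb)
        (progressionLift_mem_locSeries (rankSigma_mem_locSeries hℓ hh (by lia)) _ _ _)) _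
    · refine levelOneSum.C_mul_mem (mul_mem (natCast_mem _ _) (one_div_twentyFour_mem_locRat hℓ))
        (levelOneSum.mono hS ?_)
      rw [hW]
      nlinarith
    · exact levelOneSum.C_mul_mem (mul_mem (ofNat_mem _ 2) hfm) hMW
    · refine levelOneSum.C_mul_mem (mul_mem (mul_mem (mul_mem (natCast_mem _ _) hfm)
        (ofNat_mem _ 6)) (one_div_twentyFour_mem_locRat hℓ)) (levelOneSum.mono hDS ?_)
      rw [hWh]
      push_cast
      nlinarith
    · exact levelOneSum.C_mul_mem hahm (levelOneSum.C_mul_mem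
        (one_div_twentyFour_mem_locRat hℓ) hLP)
    · exact levelOneSum.C_mul_mem ah1' hLP
    · exact levelOneSum.C_mul_mem_of_locSeries (sub_mem (mul_mem (C_mem_locSeries hz')
        (mul_mem (C_mem_locSeries (half_mem_locRat hℓ)) (progressionLift_rankMomentSeries_mem _ _)))
        (progressionLift_mem_locSeries hK _ _ _)) _
  have e2 : (2 : ℚ⟦X⟧) * C (1 / 2) = 1 := by
    rw [show (2 : ℚ⟦X⟧) = C 2 by simp only [map_ofNat], ← map_mul]
    norm_num
  have key : C (1 / 2) * L (rankMomentSeries 2) = U +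
      C (ℓ : ℚ)⁻¹ * L (partitionSeries * M') := by
    have E₁ : (C (a h) : ℚ⟦X⟧) = 1 + C (ℓ : ℚ) * C z := by
      rw [ah, map_add, map_one, map_mul]
    have E₂ : C (a 1) * L (rankSigma h) =
        C (((2 * (h + 1) * (2 * h).factorial : ℕ) : ℚ) * (1 / 24)) * S := by
      rw [a1, hSdef, map_mul]
      ring
    rw [hU]
    linear_combination hsum - hK' + E₂ + hσ + C (a h) * hσ1 +
      C (1 / 2) * L (rankMomentSeries 2) * E₁ + L (rankMomentSeries 2) * e2
  have hloc : C (ℓ : ℚ)⁻¹ * L (partitionSeries * M') ∈ locSeries ℓ := by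
    rw [eq_sub_iff_add_eq'.2 key.symm]
    exact sub_mem (mul_mem (C_mem_locSeries (half_mem_locRat hℓ))
      (progressionLift_rankMomentSeries_mem _ _)) (levelOneSum.le_locSeries hUmem)
  have hfin := C_inv_mul_progressionLift_mem hℓ hβ hc (hML.C_mul (2 * f))
    (mul_mem (C_mem_locSeries (mul_mem (ofNat_mem _ 2) hfm)) hM) hloc
  have h2 : L (rankMomentSeries 2) = C 2 * (U + C (ℓ : ℚ)⁻¹ * L (partitionSeries * M')) := by
    rw [← key]
    simp only [map_ofNat]
    linear_combination (-L (rankMomentSeries 2)) * e2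
  rw [h2]
  refine levelOneSum.C_mul_mem (ofNat_mem _ 2) (add_mem hUmem (levelOneSum.mono hfin ?_))
  rw [hW, hlQ]
  push_cast
  nlinarith

end SecondMoment

/-! ### From formal series to functions on the upper half plane -/

section Translation

open PowerSeries

/-- The members of `levelOneSum ℓ W` as explicit finite sums. -/
lemma exists_sum_of_mem_levelOneSum {ℓ : ℕ} [Fact ℓ.Prime] {W : ℚ} {F : ℚ⟦X⟧}
    (hF : F ∈ levelOneSum ℓ W) : ∃ (s : ℕ) (w : Fin s → ℤ) (A : Fin s → ℚ⟦X⟧) (K : ℚ⟦X⟧),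
      (∀ i, (w i : ℚ) ≤ W ∧ IsLevelOne (w i) (A i) ∧ A i ∈ intSeries) ∧ K ∈ locSeries ℓ ∧
        F = ∑ i, A i + C (ℓ : ℚ) * K := by
  induction hF using AddSubgroup.closure_induction with
  | mem F hF =>
    rcases hF with ⟨w, hw, h1, h2⟩ | ⟨H, hH, rfl⟩
    · exact ⟨1, fun _ => w, fun _ => F, 0, fun _ => ⟨hw, h1, h2⟩, zero_mem _, by simp⟩
    · exact ⟨0, Fin.elim0, Fin.elim0, H, fun i => i.elim0, hH, by simp⟩
  | zero => exact ⟨0, Fin.elim0, Fin.elim0, 0, fun i => i.elim0, zero_mem _, by simp⟩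
  | add F G _ _ hF hG =>
    obtain ⟨s, w, A, K, hA, hK, rfl⟩ := hF
    obtain ⟨t, v, B, L, hB, hL, rfl⟩ := hG
    refine ⟨s + t, Fin.append w v, Fin.append A B, K + L, fun i => ?_, add_mem hK hL, ?_⟩
    · refine Fin.addCases (fun i => ?_) (fun i => ?_) i
      · simpa only [Fin.append_left] using hA i
      · simpa only [Fin.append_right] using hB i
    · rw [Fin.sum_univ_add]
      simp only [Fin.append_left, Fin.append_right]
      ring
  | neg F _ hF =>
    obtain ⟨s, w, A, K, hA, hK, rfl⟩ := hF
    refine ⟨s, w, fun i => -A i, -K, fun i => ⟨(hA i).1, ?_, neg_mem (hA i).2.2⟩, neg_mem hK, ?_⟩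
    · simpa using (hA i).2.1.C_mul (-1)
    · rw [Finset.sum_neg_distrib]
      ring

/-- The `q`-series of `η(24 z) ^ r * G(24 z)`, where `F` is the `q`-series of `G`. -/
noncomputable def etaStretch (r : ℕ) (F : ℚ⟦X⟧) : ℂ⟦X⟧ :=
  X ^ r * expand 24 (by norm_num) (toComplexSeries (eulerSeries ^ r * F))

lemma etaStretch_add (r : ℕ) (F G : ℚ⟦X⟧) :
    etaStretch r (F + G) = etaStretch r F + etaStretch r G := by
  simp only [etaStretch, mul_add, map_add]

lemma etaStretch_C_mul (r : ℕ) (a : ℚ) (F : ℚ⟦X⟧) :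
    etaStretch r (C a * F) = (a : ℂ) • etaStretch r F := by
  rw [etaStretch, mul_left_comm, toComplexSeries_C_mul, expand_smul, mul_smul_comm, etaStretch]

lemma coeff_X_pow_mul_expand {R : Type*} [CommRing R] (r m : ℕ) (A : R⟦X⟧) :
    coeff m (X ^ r * expand 24 (by norm_num) A) =
      ∑ n ∈ Finset.range (m + 1), if 24 * n + r = m then coeff n A else 0 := by
  rw [coeff_X_pow_mul']
  split_ifs with h
  · by_cases hd : 24 ∣ m - r
    · obtain ⟨n, hn⟩ := hd
      rw [hn, coeff_expand_mul, Finset.sum_eq_single n]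
      · rw [if_pos (by lia)]
      · exact fun b _ hb => if_neg (by lia)
      · exact fun hb => absurd (Finset.mem_range.2 (by lia)) hb
    · rw [coeff_expand_of_not_dvd _ _ _ hd, Finset.sum_eq_zero]
      exact fun n _ => if_neg fun hn => hd ⟨n, by lia⟩
  · exact (Finset.sum_eq_zero fun n _ => if_neg (by lia)).symm

lemma etaStretch_progressionLift (ℓ β r k : ℕ) :
    etaStretch r (progressionLift ℓ β r (rankMomentSeries k)) =
      stretchedSeries r fun n => rankMoment k (ℓ * n + β) := by
  have h1 : eulerSeries ^ r * progressionLift ℓ β r (rankMomentSeries k) =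
      progression ℓ β (rankMomentSeries k) := by
    rw [progressionLift, ← mul_assoc, ← mul_pow, mul_comm eulerSeries,
      partitionSeries_mul_eulerSeries, one_pow, one_mul]
  ext m
  rw [etaStretch, h1, coeff_X_pow_mul_expand, stretchedSeries, coeff_mk]
  refine Finset.sum_congr rfl fun n _ => ?_
  simp [progression, rankMomentSeries]

lemma isPrimeIntegral_toComplexSeries {ℓ : ℕ} [Fact ℓ.Prime] {F : ℚ⟦X⟧} (hF : F ∈ locSeries ℓ) :
    IsPrimeIntegral ℓ (toComplexSeries F) := fun n =>
  ⟨coeff n F, not_dvd_den_of_coeff hF n, by simp⟩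

lemma isPrimeIntegral_etaStretch {ℓ : ℕ} [Fact ℓ.Prime] {F : ℚ⟦X⟧} (hF : F ∈ locSeries ℓ) (r : ℕ) :
    IsPrimeIntegral ℓ (etaStretch r F) := fun n => by
  have h1 := isPrimeIntegral_toComplexSeries
    (mul_mem (pow_mem (intSeries_le_locSeries ℓ eulerSeries_mem_intSeries) r) hF)
  have h0 : ∃ a : ℚ, ¬ ℓ ∣ a.den ∧ (0 : ℂ) = a :=
    ⟨0, by simpa using (Fact.out : ℓ.Prime).one_lt.ne', by simp⟩
  rw [etaStretch, coeff_X_pow_mul']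
  split_ifs
  · by_cases hd : 24 ∣ n - r
    · obtain ⟨m, hm⟩ := hd
      rw [hm, coeff_expand_mul]
      exact h1 m
    · rw [coeff_expand_of_not_dvd _ _ _ hd]
      exact h0
  · exact h0

lemma isIntegralSeries_toComplexSeries {F : ℚ⟦X⟧} (hF : F ∈ intSeries) :
    IsIntegralSeries (toComplexSeries F) := fun n => by
  obtain ⟨a, ha⟩ := mem_intSeries_iff.1 hF n
  exact ⟨a, by simp [ha]⟩

lemma qExpansion_etaPowMul {F : ℚ⟦X⟧} {G : ℍ → ℂ} (hG : HasQSeries (toComplexSeries F) G) (r : ℕ) :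
    UpperHalfPlane.qExpansion 1 (etaPowMul r G) = etaStretch r F := by
  refine HasQSeries.qExpansion_eq ?_
  have h1 := (HasQSeries.X_pow r).mul (hasQSeries_expand ((hasQSeries_eulerFun.pow r).mul hG) 24)
  rw [← map_pow, ← map_mul] at h1
  refine Eq.mpr (congrArg _ (funext fun z => ?_)) h1
  have h2 : scale24 z = mulPoint 24 z := by
    ext
    simp [scale24, coe_mulPoint]
  have h3 : Function.Periodic.qParam 24 (mulPoint 24 z : ℂ) = Function.Periodic.qParam 1 z := by
    simp only [Function.Periodic.qParam, coe_mulPoint]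
    congr 1
    push_cast
    ring
  simp only [etaPowMul, h2, eta_eq, h3, Pi.mul_apply, Pi.pow_apply, mul_pow]
  ring

/-- A member of `levelOneSum ℓ W` yields a sum of integral modular forms of level one. -/
lemma exists_isSumOfLevelOneForms {ℓ : ℕ} [Fact ℓ.Prime] {W : ℚ} {F : ℚ⟦X⟧}
    (hF : F ∈ levelOneSum ℓ W) : ∃ (G : ℍ → ℂ) (A K : ℚ⟦X⟧),
      IsSumOfLevelOneForms IsIntegralSeries W G ∧ HasQSeries (toComplexSeries A) G ∧
        K ∈ locSeries ℓ ∧ F = A + C (ℓ : ℚ) * K := by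
  obtain ⟨s, w, A, K, hA, hK, e⟩ := exists_sum_of_mem_levelOneSum hF
  choose hw hL hA' using hA
  choose g hg using hL
  refine ⟨fun z => ∑ i, g i z, ∑ i, A i, K, ⟨s, w, g, fun i => ⟨hw i, ?_⟩, fun z => rfl⟩,
    fun z => ?_, hK, e⟩
  · rw [(hg i).qExpansion_eq]
    exact isIntegralSeries_toComplexSeries (hA' i)
  · refine Eq.mpr (congrArg (fun s => HasSum s _) (funext fun m => ?_))
      (hasSum_sum fun i _ => hg i z)
    rw [map_sum, map_sum, Finset.sum_smul]

lemma IsSumOfLevelOneForms.isPrimeIntegral {ℓ : ℕ} (hℓ : ℓ.Prime) {W : ℚ} {G : ℍ → ℂ}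
    (hG : IsSumOfLevelOneForms IsIntegralSeries W G) :
    IsSumOfLevelOneForms (IsPrimeIntegral ℓ) W G := by
  obtain ⟨s, w, g, h, e⟩ := hG
  refine ⟨s, w, g, fun i => ⟨(h i).1, fun n => ?_⟩, e⟩
  obtain ⟨a, ha⟩ := (h i).2 n
  exact ⟨a, by simpa using hℓ.one_lt.ne', by simpa using ha⟩

/-- A relation between `q`-series modulo `levelOneSum ℓ W`, as a congruence between the stretched
series. -/
lemma exists_seriesCongr {ℓ : ℕ} [Fact ℓ.Prime] {W : ℚ} {F B : ℚ⟦X⟧} (r : ℕ)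
    (hF : F - B ∈ levelOneSum ℓ W) : ∃ G : ℍ → ℂ, IsSumOfLevelOneForms IsIntegralSeries W G ∧
      SeriesCongr ℓ (etaStretch r F)
        (etaStretch r B + UpperHalfPlane.qExpansion 1 (etaPowMul r G)) := by
  obtain ⟨G, A, K, hG, hA, hK, e⟩ := exists_isSumOfLevelOneForms hF
  refine ⟨G, hG, etaStretch r K, isPrimeIntegral_etaStretch hK r, ?_⟩
  rw [qExpansion_etaPowMul hA, ← etaStretch_add, show F = B + A + C (ℓ : ℚ) * K by
    linear_combination e, etaStretch_add r (B + A), etaStretch_C_mul, add_sub_cancel_left,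
    Rat.cast_natCast]

end Translation

theorem theorem1p3 (ℓ β r : ℕ) (hℓ : ℓ.Prime) (hℓ3 : 3 < ℓ)
    (hβ1 : 1 ≤ β) (hβℓ : β ≤ ℓ - 1) (hβ : 24 * β ≡ 1 [MOD ℓ])
    (hr : (r : ℚ) = (24 * (β : ℚ) - 1) / ℓ) :
    (∃ G : ℍ → ℂ,
      IsSumOfLevelOneForms (IsPrimeIntegral ℓ) (((ℓ : ℚ) * (ℓ + 3) - r - 1) / 2) G ∧
      SeriesCongr ℓ
        (stretchedSeries r fun n => rankMoment 2 (ℓ * n + β))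
        (UpperHalfPlane.qExpansion 1 (etaPowMul r G))) ∧
    (∀ k : ℕ, 2 ≤ k → (k : ℚ) ≤ ((ℓ : ℚ) - 3) / 2 →
      ∃ (c : ℤ) (G : ℍ → ℂ),
        IsSumOfLevelOneForms (IsPrimeIntegral ℓ)
          ((k : ℚ) * (ℓ + 1) - 1 + ((ℓ : ℚ) - r) / 2) G ∧
        SeriesCongr ℓ
          (stretchedSeries r fun n => rankMoment (2 * k) (ℓ * n + β))
          ((c : ℂ) • (stretchedSeries r fun n => rankMoment 2 (ℓ * n + β)) +
            UpperHalfPlane.qExpansion 1 (etaPowMul r G))) ∧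
    (∃ (c : ℤ) (G : ℍ → ℂ) (w₁ w₂ : ℤ) (H₁ : ModularForm 𝒮ℒ w₁) (H₂ : ModularForm 𝒮ℒ w₂),
      IsSumOfLevelOneForms IsIntegralSeries (((ℓ : ℚ) * (ℓ + 1) - r - 3) / 2) G ∧
      (w₁ : ℚ) = ((ℓ : ℚ) * (ℓ - 1) - r - 1) / 2 ∧
      (w₂ : ℚ) = ((ℓ : ℚ) * (ℓ + 1) - r - 3) / 2 ∧
      IsIntegralSeries (UpperHalfPlane.qExpansion 1 H₁) ∧
      IsIntegralSeries (UpperHalfPlane.qExpansion 1 H₂) ∧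
      SeriesCongr ℓ (UpperHalfPlane.qExpansion 1 H₁) (UpperHalfPlane.qExpansion 1 H₂) ∧
      SeriesCongr ℓ
        (stretchedSeries r fun n => rankMoment (ℓ - 1) (ℓ * n + β))
        ((c : ℂ) • (stretchedSeries r fun n => rankMoment 2 (ℓ * n + β)) +
          UpperHalfPlane.qExpansion 1 (etaPowMul r G) +
          (1 / (ℓ : ℂ)) • UpperHalfPlane.qExpansion 1 (etaPowMul r fun z => H₁ z - H₂ z))) := by
  have := Fact.mk hℓ
  have hl0 : (ℓ : ℚ) ≠ 0 := by exact_mod_cast hℓ.ne_zero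
  have hβℓ' : β < ℓ := by lia
  have hc : 24 * β = ℓ * r + 1 := by
    rw [eq_div_iff hl0] at hr
    have h1 : (24 * β : ℚ) = ℓ * r + 1 := by linarith
    exact_mod_cast h1
  obtain ⟨h, hh⟩ := hℓ.odd_of_ne_two (by lia)
  refine ⟨?_, fun k hk2 hk => ?_, ?_⟩
  · have h1 := progressionLift_rankMomentSeries_two_mem hℓ3 hβℓ' hc hh
    rw [← sub_zero (progressionLift ℓ β r (rankMomentSeries 2))] at h1
    obtain ⟨G, hG, hG'⟩ := exists_seriesCongr r h1
    have h0 : etaStretch r 0 = 0 := by simp [etaStretch]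
    rw [etaStretch_progressionLift, h0, zero_add] at hG'
    exact ⟨G, hG.isPrimeIntegral hℓ, hG'⟩
  · have hk' : k < h := by
      have h1 : (k : ℚ) < h := by
        have h2 : (ℓ : ℚ) = 2 * h + 1 := by exact_mod_cast hh
        linarith
      exact_mod_cast h1
    obtain ⟨c, h1⟩ := exists_progressionLift_rankMomentSeries_sub_mem hℓ3 hβℓ' hc hh hk2 hk'
    obtain ⟨G, hG, hG'⟩ := exists_seriesCongr r h1
    rw [etaStretch_C_mul, etaStretch_progressionLift, etaStretch_progressionLift,
      Rat.cast_intCast] at hG'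
    exact ⟨c, G, hG.isPrimeIntegral hℓ, hG'⟩
  · obtain ⟨c, w₁, w₂, H₁, H₂, hw₁, hw₂, ⟨f₁, hf₁⟩, ⟨f₂, hf₂⟩, hH₁, hH₂, ⟨K, hK, hHK⟩, h1⟩ :=
      exists_progressionLift_rankMomentSeries_half_sub_mem hℓ3 hβℓ' hc hh
    rw [sub_sub (progressionLift _ _ _ _)] at h1
    obtain ⟨G, hG, hG'⟩ := exists_seriesCongr r h1
    refine ⟨c, G, w₁, w₂, f₁, f₂, hG, hw₁, hw₂, ?_, ?_, ?_, ?_⟩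
    · rw [hf₁.qExpansion_eq]
      exact isIntegralSeries_toComplexSeries hH₁
    · rw [hf₂.qExpansion_eq]
      exact isIntegralSeries_toComplexSeries hH₂
    · refine ⟨toComplexSeries K, isPrimeIntegral_toComplexSeries hK, ?_⟩
      rw [hf₁.qExpansion_eq, hf₂.qExpansion_eq, ← map_sub, hHK, toComplexSeries_C_mul,
        Rat.cast_natCast]
    · have hf : HasQSeries (toComplexSeries (H₁ - H₂)) (fun z => f₁ z - f₂ z) := fun z => by
        refine Eq.mpr (congrArg (fun s => HasSum s _) (funext fun m => ?_))
          ((hf₁ z).sub (hf₂ z))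
        rw [map_sub, map_sub, sub_smul]
      rw [etaStretch_add, etaStretch_C_mul, etaStretch_C_mul, etaStretch_progressionLift,
        etaStretch_progressionLift, Rat.cast_intCast, show 2 * h = ℓ - 1 by lia, Rat.cast_inv,
        Rat.cast_natCast, ← one_div, ← qExpansion_etaPowMul hf, add_right_comm] at hG'
      exact hG'
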